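/- \textbf{Notation.} Let $n,r\ge 0$, $N=2n+1$, $\mathcal Z=\mathbb Z[v,v^{-1}]$, $[\![m]\!]=\frac{v^{2m}-1}{v^2-1}$, and let a bar denote the ring involution $v\mapsto v^{-1}$ of $\mathcal Z$. Let $\mathcal H(B_r)$ be the $\mathcal Z$-algebra with generators $T_1,\dots,T_r$ and relations $T_i^2=(v^2-1)T_i+v^2$; $T_iT_j=T_jT_i$ for $|i-j|>1$; $T_jT_{j+1}T_j=T_{j+1}T_jT_{j+1}$ for $1\le j<r-1$; $T_{r-1}T_rT_{r-1}T_r=T_rT_{r-1}T_rT_{r-1}$. Let $W\subseteq\mathfrak S_{2r+1}$ be the subgroup of permutations commuting with $i\mapsto 2r+2-i$, a Coxeter group with generators $s_i=(i,i+1)(2r+2-i,2r+1-i)$ for $i<r$ and $s_r=(r,r+2)$; for $w\in W$ with reduced expression $w=s_{i_1}\cdots s_{i_k}$ put $T_w=T_{i_1}\cdots T_{i_k}$. Let $\Lambda(n+1,r)$ be the set of $\lambda\in\mathbb N^{n+1}$ with $\sum\lambda_i=r$, and $\widetilde\lambda=(\lambda_1,\dots,\lambda_n,2\lambda_{n+1}+1,\lambda_n,\dots,\lambda_1)\in\mathbb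 N^N$. Let $W_\lambda$ be the parabolic subgroup generated by the $s_k$ with $k\notin\{\lambda_1+\cdots+\lambda_i\mid 1\le i\le n\}$ and $x_\lambda=\sum_{w\in W_\lambda}T_w$. The $q$-Schur algebra of type $B$ is $$\mathcal S^\jmath(n,r)=\mathrm{End}_{\mathcal H(B_r)}\Big(\bigoplus_{\lambda\in\Lambda(n+1,r)}x_\lambda\mathcal H(B_r)\Big)$$ (endomorphisms of right modules, with composition as product). Put $\mathcal S^\jmath(n,r)_{\mathbb Q(v)}=\mathbb Q(v)\otimes_{\mathcal Z}\mathcal S^\jmath(n,r)$ and $\mathcal S^\jmath(n)_{\mathbb Q(v)}=\prod_{r\ge0}\mathcal S^\jmath(n,r)_{\mathbb Q(v)}$. Let $\Xi$ be the set of $N\times N$ matrices over $\mathbb N$ with $a_{i,j}=a_{N+1-i,N+1-j}$, let $\Xi^0\subseteq\Xi$ consist of those with zero diagonal, and let $|A|=\sum a_{i,j}$. For $A\in\Xi$ with $|A|=2r+1$ there are unique $\lambda,\mu\in\Lambda(n+1,r)$ and a unique double coset $W_\lambda dW_\mu$ with $a_{i,j}=|R_i^{\widetilde\lambda}\cap d(R_j^{\widetilde\mu})|$,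 where $R^{\widetilde\lambda}_1,R^{\widetilde\lambda}_2,\dots$ are the consecutive intervals of $\{1,\dots,2r+1\}$ of sizes $\widetilde\lambda_1,\widetilde\lambda_2,\dots$. Let $e_A\in\mathcal S^\jmath(n,r)$ be the unique endomorphism with $e_A(x_\nu)=\delta_{\mu,\nu}\sum_{w\in W_\lambda dW_\mu}T_w\in x_\lambda\mathcal H(B_r)$ (part of the claim is that it exists), and let $$[A]=v^{-(d(A)-r(A))}e_A,\qquad d(A)-r(A)=\tfrac12\Big(\sum_{i\ge k,\,j<l}a_{i,j}a_{k,l}-\sum_{j<n+1\le i}a_{i,j}\Big).$$ For $A\in\Xi^0$ and $\mathbf j\in\mathbb Z^N$ let $A(\mathbf j,r)=\sum_{\lambda\in\Lambda(n+1,r-|A|/2)}v^{\widetilde\lambda\cdot\mathbf j}[A+\mathrm{diag}(\widetilde\lambda)]$ if $|A|\le 2r$, and $A(\mathbf j,r)=0$ otherwise; let $A(\mathbf j)=(A(\mathbf j,r))_{r\ge0}\in\mathcal S^\jmath(n)_{\mathbb Q(v)}$. Let $O$ be the zero matrix, $E^\theta_{i,j}=E_{i,j}+E_{N+1-i,N+1-j}$,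 let $\mathrm{ro}(A)$, $\mathrm{co}(A)$ be the vectors of row and column sums, let $\mathbf e_i$ be the standard basis of $\mathbb Z^N$, and for $1\le h\le n$ let $\alpha_h=\mathbf e_h-\mathbf e_{h+1}$, $\alpha_h^-=-\mathbf e_h-\mathbf e_{h+1}$, $$\beta_p(A,h)=\sum_{j\ge p}a_{h,j}-\sum_{j>p}a_{h+1,j}+\delta_{h,n}\delta^{\le}_{p,n},\qquad \beta'_p(A,h)=\sum_{j\le p}a_{h+1,j}-\sum_{j<p}a_{h,j},$$ where $\delta^\le_{i,j}=1$ if $i\le j$ and $0$ otherwise. \textbf{Theorem.} Let $A=(a_{i,j})\in\Xi^0$, $\mathbf j,\mathbf j'\in\mathbb Z^N$ and $h\in\{1,\dots,n\}$. The following formulas hold in $\mathcal S^\jmath(n)_{\mathbb Q(v)}$: (1) $O(\mathbf j)A(\mathbf j')=v^{\mathrm{ro}(A)\cdot\mathbf j}A(\mathbf j+\mathbf j')$ and $A(\mathbf j')O(\mathbf j)=v^{\mathrm{co}(A)\cdot\mathbf j}A(\mathbf j+\mathbf j')$. (2) $$\begin{aligned}E^\theta_{h,h+1}(\mathbf 0)A(\mathbf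 j)=&\sum_{p<h,\ a_{h+1,p}\ge1}v^{\beta_p(A,h)}\overline{[\![a_{h,p}+1]\!]}\,(A+E^\theta_{h,p}-E^\theta_{h+1,p})(\mathbf j+\alpha_h)\\ &+\varepsilon\,\frac{v^{\beta_h(A,h)-j_h-j_{N+1-h}-1}}{1-v^{-2}}\Big((A-E^\theta_{h+1,h})(\mathbf j+\alpha_h)-(A-E^\theta_{h+1,h})(\mathbf j+\alpha_h^-)\Big)\\ &+v^{\beta_{h+1}(A,h)+j_{h+1}+j_{N-h}}\,\overline{[\![a_{h,h+1}+1]\!]}\,(A+E^\theta_{h,h+1})(\mathbf j)\\ &+\sum_{p>h+1,\ a_{h+1,p}\ge1}v^{\beta_p(A,h)}\overline{[\![a_{h,p}+1]\!]}\,(A+E^\theta_{h,p}-E^\theta_{h+1,p})(\mathbf j),\end{aligned}$$ where the second term is present ($\varepsilon=1$) if $a_{h+1,h}\ge1$ and absent ($\varepsilon=0$) otherwise. (3) $$\begin{aligned}E^\theta_{h+1,h}(\mathbf 0)A(\mathbf j)=&\sum_{p<h,\ a_{h,p}\ge1}v^{\beta'_p(A,h)}\overline{[\![a_{h+1,p}+1]\!]}\,(A-E^\theta_{h,p}+E^\theta_{h+1,p})(\mathbf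 j)\\ &+v^{\beta'_h(A,h)+j_h+j_{N+1-h}}\,\overline{[\![a_{h+1,h}+1]\!]}\,(A+E^\theta_{h+1,h})(\mathbf j)\\ &+\varepsilon'\,\frac{v^{\beta'_{h+1}(A,h)-j_{h+1}-j_{N-h}-1}}{1-v^{-2}}\Big(v^{-\delta_{h,n}}(A-E^\theta_{h,h+1})(\mathbf j-\alpha_h)-v^{\delta_{h,n}}(A-E^\theta_{h,h+1})(\mathbf j+\alpha_h^-)\Big)\\ &+\sum_{p>h+1,\ a_{h,p}\ge1}v^{\beta'_p(A,h)}\overline{[\![a_{h+1,p}+1]\!]}\,(A-E^\theta_{h,p}+E^\theta_{h+1,p})(\mathbf j-\alpha_h),\end{aligned}$$ where the third term is present ($\varepsilon'=1$) if $a_{h,h+1}\ge1$ and absent ($\varepsilon'=0$) otherwise. Moreover, for every $r\ge|A|/2$ the same formulas, with every $B(\mathbf k)$ replaced by $B(\mathbf k,r)$ and with the same coefficients (which do not depend on $r$), hold in the $\mathcal Z$-algebra $\mathcal S^\jmath(n,r)$; there the term with denominator $1-v^{-2}$ stands for an element $D\in\mathcal S^\jmath(n,r)$ such that $(1-v^{-2})D$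 is the term without the denominator. -/

import Mathlib

open scoped TensorProduct DirectSum

noncomputable section

namespace TypeBSchur

/-! ### The ground ring and quantum integers -/

/-- The ring `ℤ[v, v⁻¹]`; the Laurent monomial `v ^ k` is `v k`. -/
abbrev Z : Type := LaurentPolynomial ℤ

/-- `v k` is the power `v ^ k` in `ℤ[v, v⁻¹]`, for an integer `k`. -/
def v (k : ℤ) : Z := LaurentPolynomial.T k

/-- The field `ℚ(v)`, as the field of fractions of `ℤ[v, v⁻¹]`. -/
abbrev K : Type := FractionRing Z

/-- `vK k` is the power `v ^ k` in `ℚ(v)`. -/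
def vK (k : ℤ) : K := algebraMap Z K (v k)

/-- The quantum integer `⟦m⟧ = (v ^ (2 m) - 1) / (v ^ 2 - 1)`, written as a geometric sum. -/
def qint (m : ℕ) : Z := ∑ k ∈ Finset.range m, v (2 * (k : ℤ))

/-- The image of `⟦m⟧` under the bar involution `v ↦ v⁻¹`. -/
def qbar (m : ℕ) : Z := LaurentPolynomial.invert (qint m)

/-- The image of `qbar m` in `ℚ(v)`. -/
def qbarK (m : ℕ) : K := algebraMap Z K (qbar m)

/-! ### The Weyl group of type `B` -/

/-- The Weyl group of type `B_r`: all permutations of `2 r + 1` points that commute with the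
order-reversing permutation. Points are numbered from `0` to `2 r`. -/
def W (r : ℕ) : Subgroup (Equiv.Perm (Fin (2 * r + 1))) :=
  Subgroup.centralizer {Fin.revPerm}

instance (r : ℕ) : Fintype (W r) := Fintype.ofFinite _

/-- The Coxeter generators as permutations. In the numbering from `1`, the index `i : Fin r`
stands for `s_{i+1}`, where `s_k = (k, k+1)(2r+2-k, 2r+1-k)` for `k < r` and
`s_r = (r, r+1)(r+1, r+2)(r, r+1) = (r, r+2)`. -/
def sPerm (r : ℕ) (i : Fin r) : Equiv.Perm (Fin (2 * r + 1)) :=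
  if (i : ℕ) + 1 < r then
    Equiv.swap ⟨i, by omega⟩ ⟨i + 1, by omega⟩ *
      Equiv.swap (Fin.rev ⟨i, by omega⟩) (Fin.rev ⟨i + 1, by omega⟩)
  else
    Equiv.swap ⟨i, by omega⟩ (Fin.rev ⟨i, by omega⟩)

lemma conj_rev_swap (m : ℕ) (a b : Fin m) :
    Fin.revPerm * Equiv.swap a b = Equiv.swap (Fin.rev a) (Fin.rev b) * Fin.revPerm := by
  rw [← mul_inv_eq_iff_eq_mul, ← Equiv.swap_apply_apply]
  rfl

lemma sPerm_mem (r : ℕ) (i : Fin r) : sPerm r i ∈ W r := by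
  unfold W
  rw [Subgroup.mem_centralizer_iff]
  intro h hh
  rw [Set.mem_singleton_iff] at hh
  subst hh
  unfold sPerm
  split_ifs with hi
  · rw [← mul_assoc, conj_rev_swap, mul_assoc, conj_rev_swap, Fin.rev_rev, Fin.rev_rev,
      ← mul_assoc]
    congr 1
    apply Equiv.Perm.Disjoint.commute
    intro x
    by_contra hx
    push Not at hx
    obtain ⟨h1, h2⟩ := hx
    have h1' := Equiv.swap_apply_ne_self_iff.1 h1
    have h2' := Equiv.swap_apply_ne_self_iff.1 h2
    simp only [Fin.ext_iff, Fin.val_rev] at h1' h2'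
    omega
  · rw [conj_rev_swap, Fin.rev_rev, Equiv.swap_comm]

/-- The Coxeter generators of `W r`. -/
def s (r : ℕ) (i : Fin r) : W r := ⟨sPerm r i, sPerm_mem r i⟩

/-- `IsReduced r l w`: the word `l` in the generators is a reduced expression of `w`. -/
def IsReduced (r : ℕ) (l : List (Fin r)) (w : W r) : Prop :=
  (l.map (s r)).prod = w ∧
    ∀ l' : List (Fin r), (l'.map (s r)).prod = w → l.length ≤ l'.length

/-! ### The Hecke algebra of type `B` -/

/-- The defining relations of the Hecke algebra of type `B_r` (generators numbered from `0`). -/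
inductive HeckeRel (r : ℕ) : FreeAlgebra Z (Fin r) → FreeAlgebra Z (Fin r) → Prop
  | quad (i : Fin r) :
      HeckeRel r (FreeAlgebra.ι Z i * FreeAlgebra.ι Z i)
        ((v 2 - 1) • FreeAlgebra.ι Z i + algebraMap Z _ (v 2))
  | comm (i j : Fin r) (h : (i : ℕ) + 1 < j) :
      HeckeRel r (FreeAlgebra.ι Z i * FreeAlgebra.ι Z j)
        (FreeAlgebra.ι Z j * FreeAlgebra.ι Z i)
  | braid (i j : Fin r) (h : (i : ℕ) + 1 = j) (hj : (j : ℕ) + 1 < r) :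
      HeckeRel r (FreeAlgebra.ι Z i * FreeAlgebra.ι Z j * FreeAlgebra.ι Z i)
        (FreeAlgebra.ι Z j * FreeAlgebra.ι Z i * FreeAlgebra.ι Z j)
  | braid4 (i j : Fin r) (h : (i : ℕ) + 1 = j) (hj : (j : ℕ) + 1 = r) :
      HeckeRel r
        (FreeAlgebra.ι Z i * FreeAlgebra.ι Z j * FreeAlgebra.ι Z i * FreeAlgebra.ι Z j)
        (FreeAlgebra.ι Z j * FreeAlgebra.ι Z i * FreeAlgebra.ι Z j * FreeAlgebra.ι Z i)

/-- The Hecke algebra `H(B_r)` over `ℤ[v, v⁻¹]`, by generators and relations. -/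
def Hecke (r : ℕ) : Type := RingQuot (HeckeRel r)

instance (r : ℕ) : Ring (Hecke r) := inferInstanceAs (Ring (RingQuot (HeckeRel r)))

instance (r : ℕ) : Algebra Z (Hecke r) :=
  inferInstanceAs (Algebra Z (RingQuot (HeckeRel r)))

/-- The generator `T_i` of the Hecke algebra. -/
def Tgen (r : ℕ) (i : Fin r) : Hecke r :=
  RingQuot.mkAlgHom Z (HeckeRel r) (FreeAlgebra.ι Z i)

open Classical in
/-- The standard basis element `T_w`: the product of the generators along a reduced expression
of `w` (the value does not depend on the reduced expression). -/
def T (r : ℕ) (w : W r) : Hecke r :=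
  ((Classical.epsilon fun l : List (Fin r) => IsReduced r l w).map (Tgen r)).prod

/-! ### Compositions, blocks and double cosets -/

/-- `Λ(n + 1, r)`: the compositions of `r` into `n + 1` parts (zero parts are allowed). -/
abbrev Comp (n r : ℕ) : Type := {l : Fin (n + 1) → ℕ // ∑ i, l i = r}

/-- The tuple `(λ_1, …, λ_n, 2 λ_{n+1} + 1, λ_n, …, λ_1)`. -/
def tilde (n : ℕ) (l : Fin (n + 1) → ℕ) (i : Fin (2 * n + 1)) : ℕ :=
  if h : (i : ℕ) < n then l ⟨i, by omega⟩
  else if (i : ℕ) = n then 2 * l (Fin.last n) + 1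
  else l ⟨2 * n - i, by omega⟩

/-- The parabolic subgroup `W_λ`, generated by all `s_k` with `k` not among the partial sums
`λ_1 + ⋯ + λ_i`, `1 ≤ i ≤ n` (the index `k : Fin r` stands for `s_{k+1}`). -/
def Wpar (n r : ℕ) (l : Comp n r) : Subgroup (W r) :=
  Subgroup.closure {g | ∃ k : Fin r,
    (∀ i : Fin n, (k : ℕ) + 1 ≠ ∑ j with j ≤ i.castSucc, l.1 j) ∧ g = s r k}

open Classical in
/-- `x_λ`, the sum of all `T_w` with `w` in the parabolic subgroup `W_λ`. -/
def x (n r : ℕ) (l : Comp n r) : Hecke r := ∑ w : W r with w ∈ Wpar n r l, T r w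

/-- The `i`-th block of the decomposition of the `2 r + 1` points into consecutive intervals
of sizes given by `tilde n l`. -/
def block (n r : ℕ) (l : Comp n r) (i : Fin (2 * n + 1)) : Finset (Fin (2 * r + 1)) :=
  {y | (∑ k : Fin (2 * n + 1) with k < i, tilde n l.1 k) ≤ (y : ℕ) ∧
    (y : ℕ) < ∑ k : Fin (2 * n + 1) with k ≤ i, tilde n l.1 k}

/-- Square matrices of size `2 n + 1` over `ℕ`, with rows and columns numbered from `0`. -/
abbrev Mat (n : ℕ) : Type := Matrix (Fin (2 * n + 1)) (Fin (2 * n + 1)) ℕ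

/-- The matrix of the double coset of `d`: its `(i, j)` entry is the number of points in
the intersection of the `i`-th `λ`-block with the image under `d` of the `j`-th `μ`-block. -/
def cosetMatrix (n r : ℕ) (l : Comp n r) (d : W r) (m : Comp n r) : Mat n :=
  fun i j => (block n r l i ∩ (block n r m j).image (d : Equiv.Perm (Fin (2 * r + 1)))).card

/-- The double coset `W_λ d W_μ` with matrix `A`; it is empty if `A` is not the matrix of
such a double coset. -/
def cosetOf (n r : ℕ) (l : Comp n r) (A : Mat n) (m : Comp n r) : Set (W r) :=
  {w | ∃ d : W r, cosetMatrix n r l d m = A ∧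
    w ∈ DoubleCoset.doubleCoset d (Wpar n r l : Set (W r)) (Wpar n r m : Set (W r))}

/-! ### The Schur algebra of type `B` -/

/-- The right ideal `x_λ H(B_r)`; right modules are modules over the opposite ring. -/
abbrev RIdeal (n r : ℕ) (l : Comp n r) : Submodule (Hecke r)ᵐᵒᵖ (Hecke r) :=
  Submodule.span (Hecke r)ᵐᵒᵖ {x n r l}

/-- The right `H(B_r)`-module given by the direct sum of the `x_λ H(B_r)`. -/
def TMod (n r : ℕ) : Type := ⨁ l : Comp n r, RIdeal n r l

instance (n r : ℕ) : AddCommGroup (TMod n r) :=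
  inferInstanceAs (AddCommGroup (⨁ l : Comp n r, RIdeal n r l))

instance (n r : ℕ) : Module (Hecke r)ᵐᵒᵖ (TMod n r) :=
  inferInstanceAs (Module (Hecke r)ᵐᵒᵖ (⨁ l : Comp n r, RIdeal n r l))

instance (n r : ℕ) : Module Z (TMod n r) :=
  inferInstanceAs (Module Z (⨁ l : Comp n r, RIdeal n r l))

instance (n r : ℕ) : IsScalarTower Z (Hecke r)ᵐᵒᵖ (TMod n r) :=
  inferInstanceAs (IsScalarTower Z (Hecke r)ᵐᵒᵖ (⨁ l : Comp n r, RIdeal n r l))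

instance (n r : ℕ) : SMulCommClass (Hecke r)ᵐᵒᵖ Z (TMod n r) :=
  inferInstanceAs (SMulCommClass (Hecke r)ᵐᵒᵖ Z (⨁ l : Comp n r, RIdeal n r l))

/-- The Schur algebra of type `B` over `ℤ[v, v⁻¹]`: all endomorphisms of the right
`H(B_r)`-module `TMod n r`, with composition as the product. -/
abbrev S (n r : ℕ) : Type := Module.End (Hecke r)ᵐᵒᵖ (TMod n r)

open Classical in
/-- The generator `x_ν` of the summand `x_ν H(B_r)`, as an element of `TMod n r`. -/
def xgen (n r : ℕ) (m : Comp n r) : TMod n r :=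
  DirectSum.of (fun l : Comp n r => RIdeal n r l) m ⟨x n r m, Submodule.mem_span_singleton_self _⟩

/-- The component of an element of `TMod n r` in the summand `x_λ H(B_r)`. -/
def coord (n r : ℕ) (l : Comp n r) (y : TMod n r) : Hecke r :=
  (DirectSum.component (Hecke r)ᵐᵒᵖ (Comp n r) (fun k => RIdeal n r k) l y : RIdeal n r l)

open Classical in
/-- `IsStd n r A φ`: for every `ν` and `λ`, the component of `φ x_ν` in `x_λ H(B_r)` is the sum
of all `T_w`, where `w` runs over the double coset in `W_λ \ W / W_ν` with matrix `A`.
A matrix `A` determines `λ` and `ν` (by its row and column sums), so that for all other pairs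
the sum is empty and the component is zero. Such a `φ` is unique. -/
def IsStd (n r : ℕ) (A : Mat n) (φ : S n r) : Prop :=
  ∀ m l : Comp n r,
    coord n r l (φ (xgen n r m)) = ∑ w : W r with w ∈ cosetOf n r l A m, T r w

/-- The set of all matrices over `ℕ` of size `2 n + 1` with `a_{i,j} = a_{N+1-i,N+1-j}`,
`N = 2 n + 1`. -/
def Xi (n : ℕ) : Set (Mat n) := {A | ∀ i j, A i j = A i.rev j.rev}

/-- `|A|`, the sum of all entries. -/
def size (n : ℕ) (A : Mat n) : ℕ := ∑ i, ∑ j, A i j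

/-- The matrices in `Xi n` with zero diagonal. -/
def Xi0 (n : ℕ) : Set (Mat n) := {A | A ∈ Xi n ∧ ∀ i, A i i = 0}

/-- The standard basis element `e_A`, the unique endomorphism with `IsStd n r A`. -/
def e (n r : ℕ) (A : Mat n) : S n r := Classical.epsilon (IsStd n r A)

/-- The integer
`d(A) - r(A) = (∑_{i ≥ k, j < l} a_{ij} a_{kl} - ∑_{j < n + 1 ≤ i} a_{ij}) / 2`;
the numerator is even if `A` lies in `Xi n` and `|A|` is odd. -/
def dr (n : ℕ) (A : Mat n) : ℤ :=
  ((∑ i, ∑ j, ∑ k, ∑ l, if k ≤ i ∧ j < l then (A i j : ℤ) * A k l else 0) -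
    ∑ i : Fin (2 * n + 1), ∑ j : Fin (2 * n + 1), if (j : ℕ) < n ∧ n ≤ (i : ℕ) then (A i j : ℤ) else 0) / 2

/-- The normalised basis element `[A] = v ^ (-d(A) + r(A)) e_A`. -/
def br (n r : ℕ) (A : Mat n) : S n r := v (-dr n A) • e n r A

/-- The dot product of a tuple of natural numbers with a tuple of integers. -/
def dot (n : ℕ) (a : Fin (2 * n + 1) → ℕ) (j : Fin (2 * n + 1) → ℤ) : ℤ := ∑ i, (a i : ℤ) * j i

/-- The vector of row sums. -/
def ro (n : ℕ) (A : Mat n) : Fin (2 * n + 1) → ℕ := fun i => ∑ j, A i j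

/-- The vector of column sums. -/
def co (n : ℕ) (A : Mat n) : Fin (2 * n + 1) → ℕ := fun j => ∑ i, A i j

/-- `A(j, r)`: the sum over `λ ∈ Λ(n + 1, r - |A| / 2)` of the elements
`v ^ (λ̃ · j) [A + diag λ̃]`, and zero if `|A| > 2 r`. -/
def Ajr (n r : ℕ) (A : Mat n) (j : Fin (2 * n + 1) → ℤ) : S n r :=
  if size n A ≤ 2 * r then
    ∑ l ∈ Finset.Nat.antidiagonalTuple (n + 1) (r - size n A / 2),
      v (dot n (tilde n l) j) • br n r (A + Matrix.diagonal (tilde n l))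
  else 0

/-- The Schur algebra of type `B` over `ℚ(v)`, by base change. -/
abbrev SK (n r : ℕ) : Type := K ⊗[Z] S n r

/-- The direct product of the algebras `SK n r` over all `r ≥ 0`. -/
abbrev SProd (n : ℕ) : Type := ∀ r : ℕ, SK n r

/-- `A(j) = ∑_r A(j, r)`, the element of the direct product with components `A(j, r)`. -/
def Aj (n : ℕ) (A : Mat n) (j : Fin (2 * n + 1) → ℤ) : SProd n :=
  fun r => (1 : K) ⊗ₜ[Z] Ajr n r A j

/-! ### The remaining notation of the multiplication formulas -/

/-- For `h ∈ [1, n]`, given as an element of `Fin n`: the row index `h`. -/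
def lo (n : ℕ) (h : Fin n) : Fin (2 * n + 1) := ⟨h, by omega⟩

/-- For `h ∈ [1, n]`, given as an element of `Fin n`: the row index `h + 1`. -/
def hi (n : ℕ) (h : Fin n) : Fin (2 * n + 1) := ⟨h + 1, by omega⟩

/-- `E^θ_{i,j} = E_{i,j} + E_{N+1-i,N+1-j}`. -/
def Eth (n : ℕ) (i j : Fin (2 * n + 1)) : Mat n :=
  Matrix.single i j 1 + Matrix.single i.rev j.rev 1

/-- The Kronecker symbol `δ_{h,n}` (for `h` numbered from `1`). -/
def dn (n : ℕ) (h : Fin n) : ℤ := if (h : ℕ) + 1 = n then 1 else 0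

/-- `β_p(A, h) = ∑_{j ≥ p} a_{h,j} - ∑_{j > p} a_{h+1,j} + δ_{h,n} δ^≤_{p,n}`. -/
def beta (n : ℕ) (p : Fin (2 * n + 1)) (A : Mat n) (h : Fin n) : ℤ :=
  (∑ j with p ≤ j, (A (lo n h) j : ℤ)) - (∑ j with p < j, (A (hi n h) j : ℤ)) +
    dn n h * (if (p : ℕ) + 1 ≤ n then 1 else 0)

/-- `β'_p(A, h) = ∑_{j ≤ p} a_{h+1,j} - ∑_{j < p} a_{h,j}`. -/
def beta' (n : ℕ) (p : Fin (2 * n + 1)) (A : Mat n) (h : Fin n) : ℤ :=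
  (∑ j with j ≤ p, (A (hi n h) j : ℤ)) - (∑ j with j < p, (A (lo n h) j : ℤ))

/-- `α_h = e_h - e_{h+1}`. -/
def alpha (n : ℕ) (h : Fin n) : Fin (2 * n + 1) → ℤ :=
  Pi.single (lo n h) 1 - Pi.single (hi n h) 1

/-- `α⁻_h = -e_h - e_{h+1}`. -/
def alphaMinus (n : ℕ) (h : Fin n) : Fin (2 * n + 1) → ℤ :=
  -Pi.single (lo n h) 1 - Pi.single (hi n h) 1

end TypeBSchur

end

open TypeBSchur

/-!
The product with `E^θ_{i+1,i}(0)` describes the move of one point from block `i` to block `i + 1` of a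
composition, together with the move of its mirror image. All multiplication formulas come from this
one operation.

*The Hecke algebra.* The Weyl group is a group of permutations, and `pre w`, the one-line notation of
`w⁻¹`, tells whether a generator lengthens `w` by multiplication from the left. The strong exchange
condition (`exchange`) and Matsumoto's theorem (`T_eq_Tgen_mul`) give the products `T_i T_w`, hence
the action of a generator on the coefficients of `∑ φ(w) T_w` (`Tgen_mul_comb`).

*Double cosets.* The parabolic subgroup of `λ` is the stabiliser of the blocks (`mem_Wpar_iff`), and
the double coset with matrix `A` consists of all elements with matrix `A` (`mem_cosetOf`); no
distinguished representatives are needed. A double coset sum `Y λ A μ` is a left multiple of `x_μ`,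
because sorting a word reduces a coset sum to `x_μ`, and a right multiple of `x_λ` by the
anti-automorphism. So left multiplications give the endomorphism `e_A` (`exists_isStd`), and an
identity in the Schur algebra is an identity between double coset sums (`S_ext_coord`, `coord_mul_e`).

*The move of a point.* Let `λ'` arise from `λ` by moving the last point `y₀` of block `i` to block
`i + 1`, where it becomes the first point. The elements with matrix `A` for `λ` are sorted by the
letter `p` of their word at `y₀`; those with letter `p` have the matrix `A - E^θ_{i,p} + E^θ_{i+1,p}`
for `λ'`. The sum over the chain of generators that shift the position `y₀` through its new block,
stepping over the centre, turns the indicator of "the letter at `y₀` is less than `t`" into the quantum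
integer of the number of positions with this property (`exists_chain`). The difference for `p + 1` and
`p` gives the coefficient `v ^ (2 ∑_{j<p} a_{i+1,j}) ⟦a_{i+1,p} + 1⟧` (`Shift.exists_mul_Y`). The same
formula for a diagonal matrix identifies the multiplier with a standard basis element, which gives the
product of `E^θ_{i+1,i}(0)` with every `e_A` (`sum_e_mul_e`).

*Normalisation and summation.* The exponent of `[A]` changes in a controlled way (`dr_moved`), so that
`v`-powers and bar-conjugate quantum integers appear (`Ajr_Eth_mul_br`). In the sum over all diagonals,
positions off the diagonal give their summands directly. At the diagonal position in row `i` the sum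
over compositions is shifted by one. At the diagonal position in row `i + 1` the quantum integer
depends on the composition, and writing `(1 - v ^ (-2))` times it as a difference of two powers of `v`
gives the summand with the denominator (`stepFormula`). The formulas of the theorem are the cases of the
rows `h`, `h + 1` and, rotated by a half turn, of the rows `N - h`, `N + 1 - h`. For `2 r < |A|`
all summands vanish or cancel, so that the formulas hold for every `r` and pass to the product over all
`r` after base change.
-/

open scoped TensorProduct DirectSum

noncomputable section

namespace TypeBSchur

variable {n r : ℕ}

/-! ### Length and reduced words in the Weyl group -/


/-- The preimage of a point under `w`. The word `y ↦ pre w y` is the one-line notation of `w⁻¹`. -/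
def pre (w : W r) (y : Fin (2 * r + 1)) : Fin (2 * r + 1) := (w : Equiv.Perm _).symm y

lemma pre_mul (a b : W r) (y : Fin (2 * r + 1)) : pre (a * b) y = pre b (pre a y) := rfl

lemma pre_one (y : Fin (2 * r + 1)) : pre 1 y = y := rfl

lemma apply_pre (w : W r) (y : Fin (2 * r + 1)) : (w : Equiv.Perm _) (pre w y) = y :=
  Equiv.apply_symm_apply _ _

lemma pre_apply (w : W r) (y : Fin (2 * r + 1)) : pre w ((w : Equiv.Perm _) y) = y :=
  Equiv.symm_apply_apply _ _

lemma pre_injective (w : W r) : Function.Injective (pre w) := Equiv.injective _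

lemma W_ext {a b : W r} (h : ∀ y, pre a y = pre b y) : a = b := by
  apply Subtype.ext
  rw [← Equiv.symm_bijective.injective.eq_iff]
  exact Equiv.ext h

lemma apply_rev (w : W r) (y : Fin (2 * r + 1)) :
    (w : Equiv.Perm _) y.rev = ((w : Equiv.Perm _) y).rev := by
  have h := Subgroup.mem_centralizer_iff.1 w.2 _ (Set.mem_singleton _)
  exact (congrArg (fun p : Equiv.Perm (Fin (2 * r + 1)) => p y) h).symm

lemma pre_rev (w : W r) (y : Fin (2 * r + 1)) : pre w y.rev = (pre w y).rev := by
  apply (w : Equiv.Perm _).injective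
  rw [apply_pre, apply_rev, apply_pre]

lemma val_sPerm (i : Fin r) (y : Fin (2 * r + 1)) : ((sPerm r i y : Fin (2 * r + 1)) : ℕ) =
    if (i : ℕ) + 1 < r then
      if (y : ℕ) = i then (i : ℕ) + 1 else if (y : ℕ) = i + 1 then (i : ℕ)
      else if (y : ℕ) = 2 * r - i then 2 * r - i - 1
      else if (y : ℕ) = 2 * r - i - 1 then 2 * r - i else (y : ℕ)
    else if (y : ℕ) = i then 2 * r - i else if (y : ℕ) = 2 * r - i then (i : ℕ)
    else (y : ℕ) := by
  have hi := i.2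
  have hy := y.2
  unfold sPerm
  split_ifs <;>
  simp only [Equiv.Perm.mul_apply, Equiv.swap_apply_def, Fin.ext_iff, apply_ite Fin.val,
    Fin.val_rev] <;> split_ifs <;> omega

lemma sPerm_sPerm (i : Fin r) (y : Fin (2 * r + 1)) : sPerm r i (sPerm r i y) = y := by
  have hi := i.2
  have hy := y.2
  apply Fin.ext
  rw [val_sPerm, val_sPerm]
  split_ifs <;> omega

lemma s_mul_s (i : Fin r) : s r i * s r i = 1 :=
  Subtype.ext (Equiv.ext (sPerm_sPerm i))

lemma s_mul_s_mul (i : Fin r) (w : W r) : s r i * (s r i * w) = w := by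
  rw [← mul_assoc, s_mul_s, one_mul]

lemma s_inv (i : Fin r) : (s r i)⁻¹ = s r i :=
  inv_eq_of_mul_eq_one_left (s_mul_s i)

lemma pre_s (i : Fin r) (y : Fin (2 * r + 1)) : pre (s r i) y = sPerm r i y := by
  rw [← sPerm_sPerm i y]
  rw [sPerm_sPerm i y]
  exact Equiv.symm_apply_eq _ |>.2 (sPerm_sPerm i y).symm

lemma pre_s_mul (i : Fin r) (w : W r) (y : Fin (2 * r + 1)) :
    pre (s r i * w) y = pre w (sPerm r i y) := by
  rw [pre_mul, pre_s]

lemma sPerm_rev (i : Fin r) (y : Fin (2 * r + 1)) : sPerm r i y.rev = (sPerm r i y).rev :=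
  apply_rev (s r i) y

/-- The point with number `i`. -/
def pt (i : Fin r) : Fin (2 * r + 1) := ⟨i, by omega⟩

/-- The point after `pt i`. -/
def pt' (i : Fin r) : Fin (2 * r + 1) := ⟨i + 1, by omega⟩

/-- The central point, fixed by all of `W r`. -/
def ctr (r : ℕ) : Fin (2 * r + 1) := ⟨r, by omega⟩

lemma rev_eq_self_iff (y : Fin (2 * r + 1)) : y.rev = y ↔ y = ctr r := by
  simp only [Fin.ext_iff, Fin.val_rev, ctr]; omega

lemma pre_ctr (w : W r) : pre w (ctr r) = ctr r := by
  rw [← rev_eq_self_iff, ← pre_rev]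
  congr 1
  rw [rev_eq_self_iff]

/-- `i` is an ascent of `w`: left multiplication by `s r i` makes `w` longer. For the last
generator, `pt' i` is the central point. -/
def Asc (w : W r) (i : Fin r) : Prop := pre w (pt i) < pre w (pt' i)

lemma pt_ne_pt' (i : Fin r) : pt i ≠ pt' i := by
  simp [pt, pt', Fin.ext_iff]

lemma not_asc_iff (w : W r) (i : Fin r) : ¬ Asc w i ↔ pre w (pt' i) < pre w (pt i) := by
  unfold Asc
  have := (pre_injective w).ne (pt_ne_pt' i)
  omega

lemma val_pre_rev (w : W r) (y : Fin (2 * r + 1)) : (pre w y.rev : ℕ) = 2 * r - pre w y := by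
  rw [pre_rev, Fin.val_rev]; omega

lemma sPerm_pt (i : Fin r) : sPerm r i (pt i) = if (i : ℕ) + 1 < r then pt' i else (pt i).rev := by
  apply Fin.ext
  rw [val_sPerm]
  split_ifs <;> simp_all [pt, pt', Fin.val_rev]

lemma sPerm_pt' (i : Fin r) : sPerm r i (pt' i) = if (i : ℕ) + 1 < r then pt i else pt' i := by
  apply Fin.ext
  rw [val_sPerm]
  have := i.2
  split_ifs <;> simp_all [pt, pt']
  omega

lemma pt'_eq_ctr {i : Fin r} (hi : ¬ (i : ℕ) + 1 < r) : pt' i = ctr r := by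
  have := i.2
  apply Fin.ext
  simp [pt', ctr]; omega

lemma asc_s_mul (w : W r) (i : Fin r) : Asc (s r i * w) i ↔ ¬ Asc w i := by
  rw [not_asc_iff]
  unfold Asc
  rw [pre_s_mul, pre_s_mul, sPerm_pt, sPerm_pt']
  split_ifs with h
  · rfl
  · rw [pt'_eq_ctr h, pre_ctr, Fin.lt_def, Fin.lt_def, val_pre_rev]
    simp only [ctr]
    have := (pre w (pt i)).2
    omega

/-- An element without descents is the identity. -/
lemma eq_one_of_forall_asc (w : W r) (h : ∀ i, Asc w i) : w = 1 := by
  have hlt : ∀ y : Fin (2 * r + 1), ∀ hy : (y : ℕ) + 1 < 2 * r + 1,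
      pre w y < pre w ⟨y + 1, hy⟩ := by
    intro y hy
    rcases lt_or_ge (y : ℕ) r with hr | hr
    · exact h ⟨y, hr⟩
    · have h1 := h ⟨2 * r - y - 1, by omega⟩
      have e1 : pt (r := r) ⟨2 * r - y - 1, by omega⟩ = Fin.rev ⟨y + 1, hy⟩ := by
        apply Fin.ext; simp only [pt, Fin.val_rev]; omega
      have e2 : pt' (r := r) ⟨2 * r - y - 1, by omega⟩ = Fin.rev y := by
        apply Fin.ext; simp only [pt', Fin.val_rev]; omega
      unfold Asc at h1
      rw [e1, e2, pre_rev, pre_rev, Fin.rev_lt_rev] at h1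
      exact h1
  have hmono : StrictMono (pre w) := by
    apply Fin.strictMono_iff_lt_succ.2
    intro i
    exact hlt i.castSucc (by simp)
  apply W_ext
  intro y
  rw [pre_one]
  have h2 := (hmono.range_inj (g := id) strictMono_id).1 (by
    rw [Set.range_id]
    exact (Equiv.surjective w.1.symm).range_eq)
  exact congrFun h2 y

/-- The reflection that interchanges `a` and `b`; unless `a` and `b` are mirror images, it also
interchanges their mirror images. -/
def refl (a b : Fin (2 * r + 1)) : Equiv.Perm (Fin (2 * r + 1)) :=
  if b = a.rev then Equiv.swap a b else Equiv.swap a b * Equiv.swap a.rev b.rev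

lemma sPerm_mul_swap (i : Fin r) (a b : Fin (2 * r + 1)) :
    sPerm r i * Equiv.swap (sPerm r i a) (sPerm r i b) = Equiv.swap a b * sPerm r i := by
  have := Equiv.swap_apply_apply (sPerm r i) (sPerm r i a) (sPerm r i b)
  rw [sPerm_sPerm, sPerm_sPerm] at this
  rw [this, inv_mul_cancel_right]

lemma sPerm_mul_refl (i : Fin r) (a b : Fin (2 * r + 1)) :
    sPerm r i * refl (sPerm r i a) (sPerm r i b) = refl a b * sPerm r i := by
  unfold refl
  by_cases h : b = a.rev
  · rw [if_pos h, if_pos (by rw [h, sPerm_rev])]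
    exact sPerm_mul_swap i a b
  · rw [if_neg h, if_neg (by rwa [← sPerm_rev, (sPerm r i).injective.eq_iff]), ← mul_assoc,
      sPerm_mul_swap, mul_assoc, ← sPerm_rev, ← sPerm_rev, sPerm_mul_swap, mul_assoc]

/-- Only the points next to each other are reversed by a generator (three pairs, with the centre
included, for the last generator, and two pairs for each of the others). -/
lemma reversed_cases {i : Fin r} {a b : Fin (2 * r + 1)} (hab : a < b)
    (h : sPerm r i b < sPerm r i a) :
    ((i : ℕ) + 1 < r ∧ (a : ℕ) = i ∧ (b : ℕ) = i + 1) ∨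
      ((i : ℕ) + 1 < r ∧ (a : ℕ) = 2 * r - i - 1 ∧ (b : ℕ) = 2 * r - i) ∨
      ((i : ℕ) + 1 = r ∧ (a : ℕ) = i ∧ (b : ℕ) = i + 1) ∨
      ((i : ℕ) + 1 = r ∧ (a : ℕ) = i ∧ (b : ℕ) = i + 2) ∨
      ((i : ℕ) + 1 = r ∧ (a : ℕ) = i + 1 ∧ (b : ℕ) = i + 2) := by
  have hi := i.2
  have ha2 := a.2
  have hb2 := b.2
  rw [Fin.lt_def, val_sPerm, val_sPerm] at h
  rw [Fin.lt_def] at hab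
  rcases lt_or_eq_of_le (Nat.succ_le_of_lt hi) with hir | hir
  · rw [if_pos hir, if_pos hir] at h
    have : (((a : ℕ) = i ∧ (b : ℕ) = i + 1) ∨
      ((a : ℕ) = 2 * r - i - 1 ∧ (b : ℕ) = 2 * r - i)) := by
      split_ifs at h <;> omega
    tauto
  · have hir' : (i : ℕ) + 1 = r := hir
    have hn : ¬ (i : ℕ) + 1 < r := by omega
    rw [if_neg hn, if_neg hn] at h
    split_ifs at h <;> omega

/-- Only the pair of points interchanged by a generator is reversed by it. -/
lemma refl_eq_sPerm {i : Fin r} {a b : Fin (2 * r + 1)} (hab : a < b) (ha : a ≠ ctr r)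
    (hb : b ≠ ctr r) (h : sPerm r i b < sPerm r i a) : refl a b = sPerm r i := by
  have hi := i.2
  simp only [Ne, Fin.ext_iff, ctr] at ha hb
  have hcase : ((i : ℕ) + 1 < r ∧ (a : ℕ) = i ∧ (b : ℕ) = i + 1) ∨
      ((i : ℕ) + 1 < r ∧ (a : ℕ) = 2 * r - i - 1 ∧ (b : ℕ) = 2 * r - i) ∨
      ((i : ℕ) + 1 = r ∧ (a : ℕ) = i ∧ (b : ℕ) = 2 * r - i) := by
    have := reversed_cases hab h
    omega
  clear h
  apply Equiv.ext
  intro y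
  have hy := y.2
  apply Fin.ext
  rw [val_sPerm]
  unfold refl
  have hrev : b = a.rev ↔ (b : ℕ) = 2 * r - a := by
    rw [Fin.ext_iff, Fin.val_rev]; omega
  rcases hcase with ⟨h1, h2, h3⟩ | ⟨h1, h2, h3⟩ | ⟨h1, h2, h3⟩
  · rw [if_neg (by rw [hrev]; omega), if_pos h1]
    simp only [Equiv.Perm.mul_apply, Equiv.swap_apply_def, Fin.ext_iff, apply_ite Fin.val,
      Fin.val_rev]
    split_ifs <;> omega
  · rw [if_neg (by rw [hrev]; omega), if_pos h1]
    simp only [Equiv.Perm.mul_apply, Equiv.swap_apply_def, Fin.ext_iff, apply_ite Fin.val,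
      Fin.val_rev]
    split_ifs <;> omega
  · rw [if_pos (by rw [hrev]; omega), if_neg (by omega)]
    simp only [Equiv.swap_apply_def, Fin.ext_iff, apply_ite Fin.val]
    split_ifs <;> omega

/-- The element of the Weyl group represented by a word in the generators. -/
def wprod (l : List (Fin r)) : W r := (l.map (s r)).prod

lemma wprod_nil : wprod ([] : List (Fin r)) = 1 := rfl

lemma wprod_cons (i : Fin r) (l : List (Fin r)) : wprod (i :: l) = s r i * wprod l := by
  simp [wprod]

/-- Strong exchange condition: a reflection that removes an inversion of the element given by a
word yields the element of a shorter word. -/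
lemma exchange (l : List (Fin r)) : ∀ a b : Fin (2 * r + 1), a < b → a ≠ ctr r → b ≠ ctr r →
    pre (wprod l) b < pre (wprod l) a →
    ∃ l' : List (Fin r), l'.length < l.length ∧
      ((wprod l' : W r) : Equiv.Perm _) = refl a b * ((wprod l : W r) : Equiv.Perm _) := by
  induction l with
  | nil =>
    intro a b hab _ _ h
    rw [wprod_nil, pre_one, pre_one] at h
    exact absurd h hab.not_gt
  | cons t l ih =>
    intro a b hab ha hb h
    rw [wprod_cons, pre_s_mul, pre_s_mul] at h
    have hc : ∀ y : Fin (2 * r + 1), y ≠ ctr r → sPerm r t y ≠ ctr r := by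
      intro y hy hy'
      apply hy
      rw [← sPerm_sPerm t y, hy', ← pre_s, pre_ctr]
    rcases lt_trichotomy (sPerm r t a) (sPerm r t b) with h1 | h1 | h1
    · obtain ⟨l', hl, hl'⟩ := ih _ _ h1 (hc a ha) (hc b hb) h
      refine ⟨t :: l', by simpa using hl, ?_⟩
      rw [wprod_cons, wprod_cons, Subgroup.coe_mul, hl', Subgroup.coe_mul, ← mul_assoc,
        ← mul_assoc]
      exact congrArg (· * _) (sPerm_mul_refl t a b)
    · exact absurd ((sPerm r t).injective h1) hab.ne
    · refine ⟨l, by simp, ?_⟩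
      rw [refl_eq_sPerm hab ha hb h1, wprod_cons]
      exact congrArg Subtype.val (s_mul_s_mul t (wprod l)).symm

/-- A descent of an element can be removed from any word for it. -/
lemma exists_shorter (l : List (Fin r)) (i : Fin r) (h : ¬ Asc (wprod l) i) :
    ∃ l' : List (Fin r), l'.length < l.length ∧ wprod l' = s r i * wprod l := by
  rw [not_asc_iff] at h
  have hi := i.2
  by_cases hir : (i : ℕ) + 1 < r
  · obtain ⟨l', h1, h2⟩ := exchange l (pt i) (pt' i) (by simp [pt, pt', Fin.lt_def])
      (by simp [pt, ctr, Fin.ext_iff]; omega) (by simp [pt', ctr, Fin.ext_iff]; omega) h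
    refine ⟨l', h1, Subtype.ext ?_⟩
    rw [h2, refl_eq_sPerm (i := i) (by simp [pt, pt', Fin.lt_def])
      (by simp [pt, ctr, Fin.ext_iff]; omega) (by simp [pt', ctr, Fin.ext_iff]; omega)
      (by rw [sPerm_pt, sPerm_pt', if_pos hir, if_pos hir]; simp [pt, pt', Fin.lt_def])]
    rfl
  · have hlt : pt i < (pt i).rev := by simp only [pt, Fin.lt_def, Fin.val_rev]; omega
    have hc : pt i ≠ ctr r := by simp [pt, ctr, Fin.ext_iff]; omega
    have hc' : (pt i).rev ≠ ctr r := by simp [pt, ctr, Fin.ext_iff]; omega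
    obtain ⟨l', h1, h2⟩ := exchange l (pt i) (pt i).rev hlt hc hc' (by
        rw [pt'_eq_ctr hir, pre_ctr] at h
        rw [Fin.lt_def] at h ⊢
        rw [val_pre_rev]
        simp only [ctr] at h
        omega)
    refine ⟨l', h1, Subtype.ext ?_⟩
    rw [h2, refl_eq_sPerm (i := i) hlt hc hc'
      (by rw [sPerm_rev, sPerm_pt, if_neg hir, Fin.rev_rev]; exact hlt)]
    rfl

/-- The set of inversions of `w⁻¹`. Their number decreases along descents, which shows that the
generators generate. -/
def inversions (w : W r) : Finset (Fin (2 * r + 1) × Fin (2 * r + 1)) :=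
  {p | p.1 < p.2 ∧ pre w p.2 < pre w p.1}

/-- If `i` is a descent of `w`, then a pair of points reversed by the generator is not an inversion
of the product with the generator. -/
lemma pre_lt_of_reversed {i : Fin r} {a b : Fin (2 * r + 1)} (hab : a < b)
    (h : sPerm r i b < sPerm r i a) (w : W r) (hw : ¬ Asc w i) :
    pre (s r i * w) a < pre (s r i * w) b := by
  rw [← not_not (a := Asc w i), ← asc_s_mul, not_not] at hw
  unfold Asc at hw
  generalize s r i * w = u at hw
  have hi := i.2
  have hcase := reversed_cases hab h
  have p1 : (a : ℕ) = i → a = pt i := fun h => Fin.ext h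
  have p2 : ∀ y : Fin (2 * r + 1), (y : ℕ) = i + 1 → y = pt' i := fun _ h => Fin.ext h
  have p3 : (a : ℕ) = 2 * r - i - 1 → a = (pt' i).rev := fun h => by
    apply Fin.ext; simp only [pt', Fin.val_rev]; omega
  have p4 : (b : ℕ) = 2 * r - i → b = (pt i).rev := fun h => by
    apply Fin.ext; simp only [pt, Fin.val_rev]; omega
  have q : (i : ℕ) + 1 = r → pt' i = ctr r := fun h => pt'_eq_ctr (by omega)
  have qq : (i : ℕ) + 1 = r → pre u (pt i) < ctr r := fun h => by
    rw [q h, pre_ctr] at hw; exact hw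
  have qq' : (i : ℕ) + 1 = r → ctr r < pre u (pt i).rev := fun h => by
    have := qq h
    rw [Fin.lt_def] at this ⊢
    rw [val_pre_rev]
    simp only [ctr] at this ⊢
    omega
  rcases hcase with ⟨h1, h2, h3⟩ | ⟨h1, h2, h3⟩ | ⟨h1, h2, h3⟩ | ⟨h1, h2, h3⟩ | ⟨h1, h2, h3⟩
  · rw [p1 h2, p2 b h3]; exact hw
  · rw [p3 h2, p4 h3, pre_rev, pre_rev, Fin.rev_lt_rev]; exact hw
  · rw [p1 h2, p2 b h3]; exact hw
  · rw [p1 h2, p4 (by omega)]; exact (qq h1).trans (qq' h1)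
  · rw [p2 a h2, p4 (by omega), q h1, pre_ctr]; exact qq' h1

lemma card_inversions_lt (w : W r) (i : Fin r) (h : ¬ Asc w i) :
    (inversions (s r i * w)).card < (inversions w).card := by
  have hsub : (inversions (s r i * w)).image (fun p => (sPerm r i p.1, sPerm r i p.2)) ⊂
      inversions w := by
    rw [Finset.ssubset_iff_of_subset]
    · refine ⟨(pt i, pt' i), ?_, ?_⟩
      · simp only [inversions, Finset.mem_filter, Finset.mem_univ, true_and]
        exact ⟨by simp [pt, pt', Fin.lt_def], (not_asc_iff w i).1 h⟩
      · intro hmem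
        simp only [inversions, Finset.mem_image, Finset.mem_filter, Finset.mem_univ, true_and,
          Prod.mk.injEq, Prod.exists] at hmem
        obtain ⟨a, b, ⟨hab, hlt⟩, h1, h2⟩ := hmem
        rw [pre_s_mul, pre_s_mul, h1, h2] at hlt
        rw [← sPerm_sPerm i a, ← sPerm_sPerm i b, h1, h2, sPerm_pt, sPerm_pt'] at hab
        have hi := i.2
        split_ifs at hab with hir
        · simp [pt, pt', Fin.lt_def] at hab
        · simp only [pt, pt', Fin.lt_def, Fin.val_rev] at hab
          omega
    · intro p hp
      simp only [inversions, Finset.mem_image, Finset.mem_filter, Finset.mem_univ, true_and,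
        Prod.exists] at hp ⊢
      obtain ⟨a, b, ⟨hab, hlt⟩, rfl⟩ := hp
      refine ⟨?_, by rwa [pre_s_mul, pre_s_mul] at hlt⟩
      by_contra hcon
      have hne := (sPerm r i).injective.ne hab.ne
      have hba : sPerm r i b < sPerm r i a := lt_of_le_of_ne (not_lt.1 hcon) hne.symm
      exact absurd (pre_lt_of_reversed hab hba w h) hlt.not_gt
  have hinj : Function.Injective
      (fun p : Fin (2 * r + 1) × Fin (2 * r + 1) => (sPerm r i p.1, sPerm r i p.2)) := by
    rintro ⟨a, b⟩ ⟨c, d⟩ h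
    simp only [Prod.mk.injEq, (sPerm r i).injective.eq_iff] at h
    rw [h.1, h.2]
  rw [← Finset.card_image_of_injective _ hinj]
  exact Finset.card_lt_card hsub

lemma exists_wprod_eq (w : W r) : ∃ l : List (Fin r), wprod l = w := by
  induction hn : (inversions w).card using Nat.strong_induction_on generalizing w with
  | _ n ih =>
    by_cases h : ∀ i, Asc w i
    · exact ⟨[], (eq_one_of_forall_asc w h).symm⟩
    · push Not at h
      obtain ⟨i, hi⟩ := h
      obtain ⟨l, hl⟩ := ih _ (hn ▸ card_inversions_lt w i hi) _ rfl
      exact ⟨i :: l, by rw [wprod_cons, hl, s_mul_s_mul]⟩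

lemma exists_length_eq (w : W r) : ∃ k, ∃ l : List (Fin r), wprod l = w ∧ l.length = k := by
  obtain ⟨l, hl⟩ := exists_wprod_eq w
  exact ⟨_, l, hl, rfl⟩

open Classical in
/-- The length of `w`, the least length of a word for `w`. -/
def len (w : W r) : ℕ := Nat.find (exists_length_eq w)

open Classical in
lemma len_le (l : List (Fin r)) : len (wprod l) ≤ l.length :=
  Nat.find_min' _ ⟨l, rfl, rfl⟩

open Classical in
lemma exists_word (w : W r) : ∃ l : List (Fin r), wprod l = w ∧ l.length = len w :=
  Nat.find_spec (exists_length_eq w)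

lemma isReduced_iff {l : List (Fin r)} {w : W r} :
    IsReduced r l w ↔ wprod l = w ∧ l.length = len w := by
  constructor
  · rintro ⟨h1, h2⟩
    have h1' : wprod l = w := h1
    obtain ⟨l', h3, h4⟩ := exists_word w
    exact ⟨h1', le_antisymm (h4 ▸ h2 l' h3) (h1' ▸ len_le l)⟩
  · rintro ⟨h1, h2⟩
    exact ⟨h1, fun l' h3 => by rw [h2, ← (show wprod l' = w from h3)]; exact len_le l'⟩

lemma len_s_mul_le (i : Fin r) (w : W r) : len (s r i * w) ≤ len w + 1 := by
  obtain ⟨l, h1, h2⟩ := exists_word w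
  rw [← h1, ← wprod_cons, h1, ← h2]
  exact len_le (i :: l)

lemma len_of_not_asc {i : Fin r} {w : W r} (h : ¬ Asc w i) : len w = len (s r i * w) + 1 := by
  apply le_antisymm
  · have := len_s_mul_le i (s r i * w)
    rwa [s_mul_s_mul] at this
  · obtain ⟨l, h1, h2⟩ := exists_word w
    rw [← h1] at h
    obtain ⟨l', h3, h4⟩ := exists_shorter l i h
    have := len_le l'
    rw [h4, h1] at this
    omega

lemma len_of_asc {i : Fin r} {w : W r} (h : Asc w i) : len (s r i * w) = len w + 1 := by
  rw [len_of_not_asc (i := i) (w := s r i * w) (by rw [asc_s_mul, not_not]; exact h), s_mul_s_mul]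

lemma not_asc_of_len {i : Fin r} {w : W r} (h : len (s r i * w) < len w) : ¬ Asc w i := by
  intro h1
  have := len_of_asc h1
  omega

/-! ### Multiplication of standard basis elements of the Hecke algebra -/

/-- The product of generators of the Hecke algebra along a word. -/
def tprod (l : List (Fin r)) : Hecke r := (l.map (Tgen r)).prod

lemma tprod_cons (i : Fin r) (l : List (Fin r)) : tprod (i :: l) = Tgen r i * tprod l := by
  simp [tprod]

/-- The element `T r w` is the product along some reduced word, the one chosen in its
definition. -/
lemma exists_T_eq (w : W r) : ∃ l, wprod l = w ∧ l.length = len w ∧ T r w = tprod l := by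
  have h := Classical.epsilon_spec (p := fun l : List (Fin r) => IsReduced r l w)
    ((exists_word w).imp fun l hl => isReduced_iff.2 hl)
  exact ⟨_, (isReduced_iff.1 h).1, (isReduced_iff.1 h).2, rfl⟩

lemma mk_ι (i : Fin r) : RingQuot.mkAlgHom Z (HeckeRel r) (FreeAlgebra.ι Z i) = Tgen r i := rfl

lemma Tgen_mul_self (i : Fin r) :
    Tgen r i * Tgen r i = (v 2 - 1) • Tgen r i + v 2 • (1 : Hecke r) := by
  have := RingQuot.mkAlgHom_rel Z (HeckeRel.quad i)
  rw [map_mul, map_add, map_smul, AlgHom.commutes, mk_ι, Algebra.algebraMap_eq_smul_one] at this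
  exact this

lemma Tgen_comm {i j : Fin r} (h : (i : ℕ) + 1 < j) :
    Tgen r i * Tgen r j = Tgen r j * Tgen r i := by
  have := RingQuot.mkAlgHom_rel Z (HeckeRel.comm i j h)
  simp only [map_mul, mk_ι] at this
  exact this

lemma Tgen_braid {i j : Fin r} (h : (i : ℕ) + 1 = j) (hj : (j : ℕ) + 1 < r) :
    Tgen r i * Tgen r j * Tgen r i = Tgen r j * Tgen r i * Tgen r j := by
  have := RingQuot.mkAlgHom_rel Z (HeckeRel.braid i j h hj)
  simp only [map_mul, mk_ι] at this
  exact this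

lemma Tgen_braid4 {i j : Fin r} (h : (i : ℕ) + 1 = j) (hj : (j : ℕ) + 1 = r) :
    Tgen r i * Tgen r j * Tgen r i * Tgen r j = Tgen r j * Tgen r i * Tgen r j * Tgen r i := by
  have := RingQuot.mkAlgHom_rel Z (HeckeRel.braid4 i j h hj)
  simp only [map_mul, mk_ι] at this
  exact this

lemma sPerm_of_far {i : Fin r} {y : Fin (2 * r + 1)} (hy : (y : ℕ) ≤ r) (h1 : (y : ℕ) ≠ i)
    (h2 : (y : ℕ) ≠ i + 1) : sPerm r i y = y := by
  have hi := i.2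
  apply Fin.ext
  rw [val_sPerm]
  split_ifs <;> omega

lemma sPerm_pt_of_ne {i j : Fin r} (h1 : (j : ℕ) ≠ i) (h2 : (j : ℕ) ≠ i + 1) :
    sPerm r i (pt j) = pt j :=
  sPerm_of_far j.2.le h1 h2

lemma sPerm_pt'_of_ne {i j : Fin r} (h1 : (j : ℕ) ≠ i) (h2 : (j : ℕ) + 1 ≠ i) :
    sPerm r i (pt' j) = pt' j :=
  sPerm_of_far j.2 h2 fun h => h1 (Nat.succ_injective h)

/-- The induction hypothesis of the proof of Matsumoto's theorem: `T` is multiplicative along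
descents for all elements that are shorter than `w`. -/
def MulBelow (w : W r) : Prop :=
  ∀ u : W r, len u < len w → ∀ i, ¬ Asc u i → T r u = Tgen r i * T r (s r i * u)

lemma sPerm_ctr (i : Fin r) : sPerm r i (ctr r) = ctr r := by
  rw [← pre_s, pre_ctr]

/-- Elements of `W r` are determined on the first half of the points. -/
lemma W_ext_half {a b : W r} (h : ∀ y : Fin (2 * r + 1), (y : ℕ) ≤ r → pre a y = pre b y) :
    a = b := by
  apply W_ext
  intro y
  rcases le_total (y : ℕ) r with hy | hy
  · exact h y hy
  · rw [← Fin.rev_rev y, pre_rev a, pre_rev b, h y.rev (by rw [Fin.val_rev]; omega)]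

lemma s_comm {i j : Fin r} (h : (i : ℕ) + 1 < j) : s r i * s r j = s r j * s r i := by
  have hj := j.2
  have e1 : sPerm r i (pt j) = pt j := sPerm_pt_of_ne (by omega) (by omega)
  have e2 : sPerm r i (pt' j) = pt' j := sPerm_pt'_of_ne (by omega) (by omega)
  have e3 : sPerm r j (pt i) = pt i := sPerm_pt_of_ne (by omega) (by omega)
  have e4 : sPerm r j (pt' i) = pt' i := sPerm_pt'_of_ne (by omega) (by omega)
  have g1 : sPerm r i (pt i) = pt' i := by rw [sPerm_pt, if_pos (by omega)]
  have g2 : sPerm r i (pt' i) = pt i := by rw [sPerm_pt', if_pos (by omega)]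
  apply W_ext_half
  intro y hy
  simp only [pre_mul, pre_s]
  by_cases y1 : y = pt i
  · rw [y1, g1, e3, e4, g1]
  by_cases y2 : y = pt' i
  · rw [y2, g2, e4, e3, g2]
  by_cases y3 : y = pt j
  · rw [y3, e1, sPerm_pt]
    split_ifs
    · rw [e2]
    · rw [sPerm_rev, e1]
  by_cases y4 : y = pt' j
  · rw [y4, e2, sPerm_pt']
    split_ifs
    · rw [e1]
    · rw [e2]
  have f1 : sPerm r i y = y :=
    sPerm_of_far hy (fun h => y1 (Fin.ext h)) (fun h => y2 (Fin.ext h))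
  have f2 : sPerm r j y = y :=
    sPerm_of_far hy (fun h => y3 (Fin.ext h)) (fun h => y4 (Fin.ext h))
  rw [f1, f2, f1]

lemma s_braid {i j : Fin r} (h : (i : ℕ) + 1 = j) (hj : (j : ℕ) + 1 < r) :
    s r i * (s r j * s r i) = s r j * (s r i * s r j) := by
  have a1 : pt' i = pt j := Fin.ext h
  have f1 : sPerm r j (pt i) = pt i := sPerm_pt_of_ne (by omega) (by omega)
  have f2 : sPerm r i (pt' j) = pt' j := sPerm_pt'_of_ne (by omega) (by omega)
  have g1 : sPerm r i (pt i) = pt j := by rw [sPerm_pt, if_pos (by omega), a1]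
  have g2 : sPerm r i (pt j) = pt i := by rw [← a1, sPerm_pt', if_pos (by omega)]
  have g3 : sPerm r j (pt j) = pt' j := by rw [sPerm_pt, if_pos (by omega)]
  have g4 : sPerm r j (pt' j) = pt j := by rw [sPerm_pt', if_pos (by omega)]
  apply W_ext_half
  intro y hy
  simp only [pre_mul, pre_s]
  by_cases y1 : y = pt i
  · simp only [y1, f1, f2, g1, g3]
  by_cases y2 : y = pt j
  · simp only [y2, f1, f2, g1, g2, g3, g4]
  by_cases y3 : y = pt' j
  · simp only [y3, f1, f2, g2, g4]
  have f3 : sPerm r i y = y :=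
    sPerm_of_far hy (fun h => y1 (Fin.ext h)) (fun h' => y2 (Fin.ext (h'.trans h)))
  have f4 : sPerm r j y = y :=
    sPerm_of_far hy (fun h => y2 (Fin.ext h)) (fun h => y3 (Fin.ext h))
  simp only [f3, f4]

lemma s_braid4 {i j : Fin r} (h : (i : ℕ) + 1 = j) (hj : (j : ℕ) + 1 = r) :
    s r i * (s r j * (s r i * s r j)) = s r j * (s r i * (s r j * s r i)) := by
  have a1 : pt' i = pt j := Fin.ext h
  have a2 : pt' j = ctr r := pt'_eq_ctr (by omega)
  have f1 : sPerm r j (pt i) = pt i := sPerm_pt_of_ne (by omega) (by omega)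
  have g1 : sPerm r i (pt i) = pt j := by rw [sPerm_pt, if_pos (by omega), a1]
  have g2 : sPerm r i (pt j) = pt i := by rw [← a1, sPerm_pt', if_pos (by omega)]
  have g3 : sPerm r j (pt j) = (pt j).rev := by rw [sPerm_pt, if_neg (by omega)]
  apply W_ext_half
  intro y hy
  simp only [pre_mul, pre_s]
  by_cases y1 : y = pt i
  · simp only [y1, f1, g1, g2, g3, sPerm_rev]
  by_cases y2 : y = pt j
  · simp only [y2, f1, g1, g2, g3, sPerm_rev]
  by_cases y3 : y = ctr r
  · simp only [y3, sPerm_ctr]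
  have f3 : sPerm r i y = y :=
    sPerm_of_far hy (fun h => y1 (Fin.ext h)) (fun h' => y2 (Fin.ext (h'.trans h)))
  have f4 : sPerm r j y = y :=
    sPerm_of_far hy (fun h => y2 (Fin.ext h)) (fun h' => y3 (Fin.ext (h'.trans hj)))
  simp only [f3, f4]

lemma Tgen_mul_eq_of_far {i j : Fin r} (hij : (i : ℕ) + 1 < j) {w : W r} (hw : MulBelow w)
    (hi : ¬ Asc w i) (hj : ¬ Asc w j) :
    Tgen r i * T r (s r i * w) = Tgen r j * T r (s r j * w) := by
  have e1 : sPerm r i (pt j) = pt j := sPerm_pt_of_ne (by omega) (by omega)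
  have e2 : sPerm r i (pt' j) = pt' j := sPerm_pt'_of_ne (by omega) (by omega)
  have e3 : sPerm r j (pt i) = pt i := sPerm_pt_of_ne (by omega) (by omega)
  have e4 : sPerm r j (pt' i) = pt' i := sPerm_pt'_of_ne (by omega) (by omega)
  rw [hw (s r i * w) (by have := len_of_not_asc hi; omega) j
      (by unfold Asc; rw [pre_s_mul, pre_s_mul, e1, e2]; exact hj),
    hw (s r j * w) (by have := len_of_not_asc hj; omega) i
      (by unfold Asc; rw [pre_s_mul, pre_s_mul, e3, e4]; exact hi),
    ← mul_assoc, ← mul_assoc, Tgen_comm hij, ← mul_assoc, ← mul_assoc, s_comm hij]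

lemma Tgen_mul_eq_of_braid {i j : Fin r} (hij : (i : ℕ) + 1 = j) (hjr : (j : ℕ) + 1 < r) {w : W r}
    (hw : MulBelow w) (hi : ¬ Asc w i) (hj : ¬ Asc w j) :
    Tgen r i * T r (s r i * w) = Tgen r j * T r (s r j * w) := by
  have a1 : pt' i = pt j := Fin.ext hij
  have f1 : sPerm r j (pt i) = pt i := sPerm_pt_of_ne (by omega) (by omega)
  have f2 : sPerm r i (pt' j) = pt' j := sPerm_pt'_of_ne (by omega) (by omega)
  have g1 : sPerm r i (pt i) = pt j := by rw [sPerm_pt, if_pos (by omega), a1]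
  have g2 : sPerm r i (pt j) = pt i := by rw [← a1, sPerm_pt', if_pos (by omega)]
  have g3 : sPerm r j (pt j) = pt' j := by rw [sPerm_pt, if_pos (by omega)]
  have g4 : sPerm r j (pt' j) = pt j := by rw [sPerm_pt', if_pos (by omega)]
  have hi2 := hi
  have hj2 := hj
  rw [not_asc_iff] at hi2 hj2
  rw [a1] at hi2
  have k1 : ¬ Asc (s r i * w) j := by
    rw [not_asc_iff, pre_s_mul, pre_s_mul, g2, f2]; exact hj2.trans hi2
  have k2 : ¬ Asc (s r j * (s r i * w)) i := by
    rw [not_asc_iff, pre_s_mul, pre_s_mul, pre_s_mul, pre_s_mul, a1, f1, g1, g3, f2]; exact hj2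
  have k3 : ¬ Asc (s r j * w) i := by
    rw [not_asc_iff, pre_s_mul, pre_s_mul, a1, f1, g3]; exact hj2.trans hi2
  have k4 : ¬ Asc (s r i * (s r j * w)) j := by
    rw [not_asc_iff, pre_s_mul, pre_s_mul, pre_s_mul, pre_s_mul, f2, g2, g4, f1]; exact hi2
  have l1 := len_of_not_asc hi
  have l2 := len_of_not_asc hj
  have l3 := len_of_not_asc k1
  have l4 := len_of_not_asc k3
  rw [hw _ (by omega) j k1, hw _ (by omega) i k2, hw _ (by omega) i k3, hw _ (by omega) j k4]
  simp only [← mul_assoc]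
  rw [Tgen_braid hij hjr]
  simp only [mul_assoc]
  have := s_braid hij hjr
  have h2 : s r i * (s r j * (s r i * w)) = s r j * (s r i * (s r j * w)) := by
    simpa only [mul_assoc] using congrArg (· * w) this
  rw [h2]

lemma Tgen_mul_eq_of_braid4 {i j : Fin r} (hij : (i : ℕ) + 1 = j) (hjr : (j : ℕ) + 1 = r) {w : W r}
    (hw : MulBelow w) (hi : ¬ Asc w i) (hj : ¬ Asc w j) :
    Tgen r i * T r (s r i * w) = Tgen r j * T r (s r j * w) := by
  have a1 : pt' i = pt j := Fin.ext hij
  have a2 : pt' j = ctr r := pt'_eq_ctr (by omega)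
  have f1 : sPerm r j (pt i) = pt i := sPerm_pt_of_ne (by omega) (by omega)
  have g1 : sPerm r i (pt i) = pt j := by rw [sPerm_pt, if_pos (by omega), a1]
  have g2 : sPerm r i (pt j) = pt i := by rw [← a1, sPerm_pt', if_pos (by omega)]
  have g3 : sPerm r j (pt j) = (pt j).rev := by rw [sPerm_pt, if_neg (by omega)]
  have hi2 := hi
  have hj2 := hj
  rw [not_asc_iff] at hi2 hj2
  rw [a1] at hi2
  rw [a2, pre_ctr] at hj2
  have hj3 : pre w (pt j).rev < ctr r := by
    rw [Fin.lt_def] at hj2 ⊢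
    rw [val_pre_rev]
    simp only [ctr] at hj2 ⊢
    omega
  have hi3 : pre w (pt i).rev < pre w (pt j).rev := by
    rw [pre_rev, pre_rev, Fin.rev_lt_rev]; exact hi2
  have k1 : ¬ Asc (s r i * w) j := by
    rw [not_asc_iff, a2, pre_ctr, pre_s_mul, g2]; exact hj2.trans hi2
  have k2 : ¬ Asc (s r j * (s r i * w)) i := by
    rw [not_asc_iff, pre_s_mul, pre_s_mul, pre_s_mul, pre_s_mul, a1, f1, g1, g3, sPerm_rev, g2]
    exact (hi3.trans hj3).trans hj2
  have k3 : ¬ Asc (s r i * (s r j * (s r i * w))) j := by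
    rw [not_asc_iff, a2, pre_ctr, pre_s_mul, pre_s_mul, pre_s_mul, g2, f1, g1]; exact hj2
  have k4 : ¬ Asc (s r j * w) i := by
    rw [not_asc_iff, pre_s_mul, pre_s_mul, a1, f1, g3]; exact hj3.trans (hj2.trans hi2)
  have k5 : ¬ Asc (s r i * (s r j * w)) j := by
    rw [not_asc_iff, a2, pre_ctr, pre_s_mul, pre_s_mul, g2, f1]; exact hj2.trans hi2
  have k6 : ¬ Asc (s r j * (s r i * (s r j * w))) i := by
    rw [not_asc_iff, pre_s_mul, pre_s_mul, pre_s_mul, pre_s_mul, pre_s_mul, pre_s_mul, a1, f1, g1,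
      g3, sPerm_rev, g2, sPerm_rev, f1]
    exact hi3
  have l1 := len_of_not_asc hi
  have l2 := len_of_not_asc hj
  have l3 := len_of_not_asc k1
  have l4 := len_of_not_asc k2
  have l5 := len_of_not_asc k4
  have l6 := len_of_not_asc k5
  rw [hw _ (by omega) j k1, hw _ (by omega) i k2, hw _ (by omega) j k3, hw _ (by omega) i k4,
    hw _ (by omega) j k5, hw _ (by omega) i k6]
  simp only [← mul_assoc]
  rw [Tgen_braid4 hij hjr]
  simp only [mul_assoc]
  have := s_braid4 hij hjr
  have h2 : s r i * (s r j * (s r i * (s r j * w))) = s r j * (s r i * (s r j * (s r i * w))) := by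
    simpa only [mul_assoc] using congrArg (· * w) this
  rw [h2]

/-- The value obtained by splitting off a descent does not depend on the descent. For two
descents `i` and `j` both values are products that start with the longest word in `i` and `j`. -/
lemma Tgen_mul_eq {w : W r} (hw : MulBelow w) {i j : Fin r} (hi : ¬ Asc w i) (hj : ¬ Asc w j) :
    Tgen r i * T r (s r i * w) = Tgen r j * T r (s r j * w) := by
  wlog hij : i ≤ j generalizing i j
  · exact (this hj hi (le_of_not_ge hij)).symm
  rcases eq_or_lt_of_le hij with rfl | h
  · rfl
  · have hj' := j.2
    rw [Fin.lt_def] at h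
    rcases eq_or_lt_of_le (Nat.succ_le_of_lt h) with h1 | h1
    · rcases eq_or_lt_of_le (Nat.succ_le_of_lt hj') with h2 | h2
      · exact Tgen_mul_eq_of_braid4 h1 h2 hw hi hj
      · exact Tgen_mul_eq_of_braid h1 h2 hw hi hj
    · exact Tgen_mul_eq_of_far h1 hw hi hj

lemma word_tail {i : Fin r} {l : List (Fin r)} {w : W r} (h1 : wprod (i :: l) = w)
    (h2 : (i :: l).length = len w) :
    wprod l = s r i * w ∧ l.length = len (s r i * w) ∧ ¬ Asc w i := by
  rw [wprod_cons] at h1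
  have h3 : wprod l = s r i * w := by rw [← h1, s_mul_s_mul]
  have h4 := len_le l
  rw [h3] at h4
  have h5 := len_s_mul_le i (s r i * w)
  rw [s_mul_s_mul] at h5
  simp only [List.length_cons] at h2
  exact ⟨h3, by omega, not_asc_of_len (by omega)⟩

/-- Matsumoto's theorem: `T r w` is the product along every reduced word, in the form that a
descent splits off. -/
lemma T_eq_Tgen_mul : ∀ (w : W r) (i : Fin r), ¬ Asc w i → T r w = Tgen r i * T r (s r i * w) := by
  intro w
  induction hn : len w using Nat.strong_induction_on generalizing w with
  | _ n ih =>
    have hw : MulBelow w := fun u hu => ih _ (hn ▸ hu) u rfl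
    have hword : ∀ l : List (Fin r), ∀ u : W r, len u < len w → wprod l = u → l.length = len u →
        tprod l = T r u := by
      intro l
      induction l with
      | nil =>
        intro u hu h1 h2
        obtain ⟨l, h3, h4, h5⟩ := exists_T_eq u
        rw [← h2] at h4
        rw [h5, List.length_eq_zero_iff.1 h4]
      | cons i l ihl =>
        intro u hu h1 h2
        obtain ⟨h3, h4, h5⟩ := word_tail h1 h2
        rw [tprod_cons, ihl _ ((by have := len_of_not_asc h5; omega)) h3 h4, hw u hu i h5]
    intro i hi
    obtain ⟨l, h1, h2, h3⟩ := exists_T_eq w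
    cases l with
    | nil =>
      have := len_of_not_asc hi
      simp only [List.length_nil] at h2
      omega
    | cons j l =>
      obtain ⟨h4, h5, h6⟩ := word_tail h1 h2
      rw [h3, tprod_cons, hword l _ (by have := len_of_not_asc h6; omega) h4 h5]
      exact Tgen_mul_eq hw h6 hi

lemma tprod_eq_T {l : List (Fin r)} {w : W r} (h1 : wprod l = w) (h2 : l.length = len w) :
    tprod l = T r w := by
  induction l generalizing w with
  | nil =>
    obtain ⟨l, h3, h4, h5⟩ := exists_T_eq w
    rw [← h2] at h4
    rw [h5, List.length_eq_zero_iff.1 h4]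
  | cons i l ih =>
    obtain ⟨h3, h4, h5⟩ := word_tail h1 h2
    rw [tprod_cons, ih h3 h4, T_eq_Tgen_mul w i h5]

lemma Tgen_mul_T_of_asc {w : W r} {i : Fin r} (h : Asc w i) :
    Tgen r i * T r w = T r (s r i * w) := by
  rw [T_eq_Tgen_mul (s r i * w) i (by rw [asc_s_mul, not_not]; exact h), s_mul_s_mul]

lemma Tgen_mul_T_of_not_asc {w : W r} {i : Fin r} (h : ¬ Asc w i) :
    Tgen r i * T r w = (v 2 - 1) • T r w + v 2 • T r (s r i * w) := by
  rw [T_eq_Tgen_mul w i h, ← mul_assoc, Tgen_mul_self, add_mul, smul_mul_assoc, smul_mul_assoc,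
    one_mul]

/-! ### The anti-automorphism of the Hecke algebra -/

/-- The anti-automorphism of the Hecke algebra that fixes the generators. -/
def antiHom (r : ℕ) : Hecke r →ₐ[Z] (Hecke r)ᵐᵒᵖ :=
  RingQuot.liftAlgHom Z ⟨FreeAlgebra.lift Z fun i => MulOpposite.op (Tgen r i), by
    intro a b h
    induction h with
    | quad i =>
      simp only [map_mul, map_add, map_smul, map_one, FreeAlgebra.lift_ι_apply,
        ← MulOpposite.op_mul, Tgen_mul_self, Algebra.algebraMap_eq_smul_one, MulOpposite.op_add,
        MulOpposite.op_smul, MulOpposite.op_one]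
    | comm i j h =>
      simp only [map_mul, FreeAlgebra.lift_ι_apply, ← MulOpposite.op_mul, Tgen_comm h]
    | braid i j h hj =>
      simp only [map_mul, FreeAlgebra.lift_ι_apply, ← MulOpposite.op_mul, ← mul_assoc,
        Tgen_braid h hj]
    | braid4 i j h hj =>
      simp only [map_mul, FreeAlgebra.lift_ι_apply, ← MulOpposite.op_mul, ← mul_assoc,
        Tgen_braid4 h hj]⟩

lemma antiHom_Tgen (i : Fin r) : antiHom r (Tgen r i) = MulOpposite.op (Tgen r i) := by
  unfold antiHom Tgen
  erw [RingQuot.liftAlgHom_mkAlgHom_apply]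
  rw [FreeAlgebra.lift_ι_apply]

lemma antiHom_tprod (l : List (Fin r)) : antiHom r (tprod l) = MulOpposite.op (tprod l.reverse) := by
  induction l with
  | nil => simp [tprod]
  | cons i l ih =>
    rw [tprod_cons, map_mul, ih, antiHom_Tgen, ← MulOpposite.op_mul]
    simp [tprod]

lemma wprod_reverse (l : List (Fin r)) : wprod l.reverse = (wprod l)⁻¹ := by
  induction l with
  | nil => simp [wprod]
  | cons i l ih =>
    rw [wprod_cons, mul_inv_rev, ← ih, s_inv]
    simp [wprod]

lemma len_inv (w : W r) : len w⁻¹ = len w := by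
  have h : ∀ w : W r, len w⁻¹ ≤ len w := by
    intro w
    obtain ⟨l, h1, h2⟩ := exists_word w
    rw [← h2, ← List.length_reverse, ← h1, ← wprod_reverse]
    exact len_le _
  exact le_antisymm (h w) (by simpa using h w⁻¹)

lemma antiHom_T (w : W r) : antiHom r (T r w) = MulOpposite.op (T r w⁻¹) := by
  obtain ⟨l, h1, h2⟩ := exists_word w
  rw [← tprod_eq_T h1 h2, antiHom_tprod, tprod_eq_T (w := w⁻¹)]
  · rw [wprod_reverse, h1]
  · rw [List.length_reverse, h2, len_inv]

/-! ### Blocks and parabolic subgroups -/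

lemma tilde_rev (n : ℕ) (l : Fin (n + 1) → ℕ) (i : Fin (2 * n + 1)) :
    tilde n l i.rev = tilde n l i := by
  have hi := i.2
  unfold tilde
  rcases lt_trichotomy (i : ℕ) n with h | h | h
  · rw [dif_neg (by rw [Fin.val_rev]; omega), if_neg (by rw [Fin.val_rev]; omega), dif_pos h]
    congr 1; apply Fin.ext; simp only [Fin.val_rev]; omega
  · rw [dif_neg (by rw [Fin.val_rev]; omega), if_pos (by rw [Fin.val_rev]; omega),
      dif_neg (by omega), if_pos h]
  · rw [dif_pos (by rw [Fin.val_rev]; omega), dif_neg (by omega), if_neg (by omega)]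
    congr 1; apply Fin.ext; simp only [Fin.val_rev]; omega

/-- The sum of the first `t` entries of `tilde n l`. -/
def psum (n : ℕ) (l : Fin (n + 1) → ℕ) (t : ℕ) : ℕ :=
  ∑ k ∈ Finset.univ.filter fun k : Fin (2 * n + 1) => (k : ℕ) < t, tilde n l k

lemma psum_zero (l : Fin (n + 1) → ℕ) : psum n l 0 = 0 := by simp [psum]

lemma psum_succ (l : Fin (n + 1) → ℕ) (i : Fin (2 * n + 1)) :
    psum n l (i + 1) = psum n l i + tilde n l i := by
  unfold psum
  have : Finset.univ.filter (fun k : Fin (2 * n + 1) => (k : ℕ) < i + 1) =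
      insert i (Finset.univ.filter fun k : Fin (2 * n + 1) => (k : ℕ) < i) := by
    ext k; simp [Fin.ext_iff]; omega
  rw [this, Finset.sum_insert (by simp), add_comm]

lemma psum_mono (l : Fin (n + 1) → ℕ) : Monotone (psum n l) := by
  intro a b hab
  unfold psum
  apply Finset.sum_le_sum_of_subset
  intro k hk
  simp only [Finset.mem_filter, Finset.mem_univ, true_and] at hk ⊢
  omega

lemma psum_half (l : Fin (n + 1) → ℕ) {i : ℕ} (hi : i < n) :
    psum n l (i + 1) = ∑ j with j ≤ (⟨i, hi⟩ : Fin n).castSucc, l j := by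
  unfold psum
  symm
  apply Finset.sum_bij (fun (j : Fin (n + 1)) _ => (⟨j, by omega⟩ : Fin (2 * n + 1)))
  · intro j hj
    simp only [Finset.mem_filter, Finset.mem_univ, true_and, Fin.le_def] at hj ⊢
    simp at hj
    omega
  · intro a _ b _ h
    simpa [Fin.ext_iff] using h
  · intro b hb
    simp only [Finset.mem_filter, Finset.mem_univ, true_and] at hb
    refine ⟨⟨b, by omega⟩, ?_, rfl⟩
    simp only [Finset.mem_filter, Finset.mem_univ, true_and, Fin.le_def]
    simp
    omega
  · intro j hj
    simp only [Finset.mem_filter, Finset.mem_univ, true_and, Fin.le_def] at hj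
    simp at hj
    unfold tilde
    rw [dif_pos (by simp only; omega)]

lemma psum_n (l : Comp n r) : psum n l.1 n + l.1 (Fin.last n) = r := by
  have h := l.2
  rw [Fin.sum_univ_castSucc] at h
  refine Eq.trans (congrArg (· + _) ?_) h
  unfold psum
  symm
  apply Finset.sum_bij (fun (j : Fin n) _ => (⟨j, by omega⟩ : Fin (2 * n + 1)))
  · intro j hj
    simp
  · intro a _ b _ h
    simpa [Fin.ext_iff] using h
  · intro b hb
    simp only [Finset.mem_filter, Finset.mem_univ, true_and] at hb
    exact ⟨⟨b, hb⟩, Finset.mem_univ _, rfl⟩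
  · intro j hj
    unfold tilde
    rw [dif_pos (by simp)]
    rfl

lemma psum_n_succ (l : Comp n r) : psum n l.1 (n + 1) = r + 1 + l.1 (Fin.last n) := by
  have h1 := psum_succ l.1 (⟨n, by omega⟩ : Fin (2 * n + 1))
  have h2 := psum_n l
  have h3 : tilde n l.1 ⟨n, by omega⟩ = 2 * l.1 (Fin.last n) + 1 := by
    unfold tilde
    rw [dif_neg (by simp), if_pos rfl]
  simp only at h1
  omega

lemma psum_rev_aux (l : Comp n r) : ∀ t : ℕ, t ≤ n →
    psum n l.1 (n + 1 + t) + psum n l.1 (n - t) = 2 * r + 1 := by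
  intro t
  induction t with
  | zero =>
    intro _
    have := psum_n_succ l
    have := psum_n l
    simp only [add_zero, tsub_zero]
    omega
  | succ t ih =>
    intro ht
    have h1 := ih (by omega)
    have h2 := psum_succ l.1 (⟨n + 1 + t, by omega⟩ : Fin (2 * n + 1))
    have h3 := psum_succ l.1 (⟨n - (t + 1), by omega⟩ : Fin (2 * n + 1))
    rw [← tilde_rev] at h3
    have h4 : Fin.rev (⟨n - (t + 1), by omega⟩ : Fin (2 * n + 1)) = ⟨n + 1 + t, by omega⟩ := by
      apply Fin.ext; simp only [Fin.val_rev]; omega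
    rw [h4] at h3
    simp only at h2 h3
    rw [show n - (t + 1) + 1 = n - t by omega] at h3
    rw [show n + 1 + (t + 1) = n + 1 + t + 1 by omega]
    omega

lemma psum_rev (l : Comp n r) {t : ℕ} (ht : t ≤ 2 * n + 1) :
    psum n l.1 (2 * n + 1 - t) + psum n l.1 t = 2 * r + 1 := by
  rcases le_or_gt t n with h | h
  · have := psum_rev_aux l (n - t) (by omega)
    rwa [show n + 1 + (n - t) = 2 * n + 1 - t by omega, show n - (n - t) = t by omega] at this
  · have := psum_rev_aux l (t - (n + 1)) (by omega)
    rwa [show n + 1 + (t - (n + 1)) = t by omega, show n - (t - (n + 1)) = 2 * n + 1 - t by omega,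
      add_comm] at this

lemma psum_top (l : Comp n r) : psum n l.1 (2 * n + 1) = 2 * r + 1 := by
  have := psum_rev l (Nat.zero_le _)
  simpa [psum_zero] using this

lemma mem_block (l : Comp n r) (i : Fin (2 * n + 1)) (y : Fin (2 * r + 1)) :
    y ∈ block n r l i ↔ psum n l.1 i ≤ y ∧ (y : ℕ) < psum n l.1 (i + 1) := by
  unfold block psum
  simp only [Finset.mem_filter, Finset.mem_univ, true_and, Fin.lt_def, Fin.le_def, Nat.lt_succ_iff]

lemma exists_mem_block (l : Comp n r) (y : Fin (2 * r + 1)) : ∃ i, y ∈ block n r l i := by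
  have h1 : ∃ t, (y : ℕ) < psum n l.1 t := ⟨2 * n + 1, by rw [psum_top]; exact y.2⟩
  classical
  have h2 := Nat.find_spec h1
  have h3 : Nat.find h1 ≤ 2 * n + 1 := Nat.find_min' h1 (by rw [psum_top]; exact y.2)
  rcases Nat.eq_zero_or_pos (Nat.find h1) with h0 | h0
  · rw [h0, psum_zero] at h2
    omega
  · refine ⟨⟨Nat.find h1 - 1, by omega⟩, ?_⟩
    rw [mem_block]
    have h4 := Nat.find_min h1 (Nat.sub_lt h0 one_pos)
    simp only
    rw [Nat.sub_add_cancel h0]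
    exact ⟨not_lt.1 h4, h2⟩

/-- The index of the block that contains a point. -/
def bl (l : Comp n r) (y : Fin (2 * r + 1)) : Fin (2 * n + 1) := (exists_mem_block l y).choose

lemma bl_spec (l : Comp n r) (y : Fin (2 * r + 1)) :
    psum n l.1 (bl l y) ≤ y ∧ (y : ℕ) < psum n l.1 (bl l y + 1) :=
  (mem_block l _ y).1 (exists_mem_block l y).choose_spec

lemma bl_lt_iff (l : Comp n r) (y : Fin (2 * r + 1)) (t : ℕ) :
    (bl l y : ℕ) < t ↔ (y : ℕ) < psum n l.1 t := by
  have h := bl_spec l y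
  constructor
  · intro h1
    exact h.2.trans_le (psum_mono l.1 h1)
  · intro h1
    by_contra h2
    exact absurd (h.1.trans_lt h1) (not_lt.2 (psum_mono l.1 (not_lt.1 h2)))

lemma bl_mono (l : Comp n r) : Monotone (bl l) := by
  intro y z hyz
  have := (bl_lt_iff l y (bl l z + 1)).2 (lt_of_le_of_lt hyz ((bl_lt_iff l z _).1 (Nat.lt_succ_self _)))
  exact Nat.lt_succ_iff.1 this

lemma mem_block_iff (l : Comp n r) (i : Fin (2 * n + 1)) (y : Fin (2 * r + 1)) :
    y ∈ block n r l i ↔ bl l y = i := by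
  rw [mem_block, ← bl_lt_iff, ← not_lt, ← bl_lt_iff, Fin.ext_iff]
  omega

lemma bl_rev (l : Comp n r) (y : Fin (2 * r + 1)) : bl l y.rev = (bl l y).rev := by
  rw [← mem_block_iff, mem_block]
  have h := bl_spec l y
  have h1 := psum_rev l (t := bl l y) (by omega)
  have h2 := psum_rev l (t := bl l y + 1) (by omega)
  have h3 : ((bl l y).rev : ℕ) = 2 * n + 1 - (bl l y + 1) := by rw [Fin.val_rev]
  have h4 : ((bl l y).rev : ℕ) + 1 = 2 * n + 1 - bl l y := by rw [Fin.val_rev]; omega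
  rw [h4, h3, Fin.val_rev]
  omega

lemma bl_ctr (l : Comp n r) : bl l (ctr r) = ctr n := by
  rw [← rev_eq_self_iff, ← bl_rev]
  congr 1
  rw [rev_eq_self_iff]

lemma card_bl (l : Comp n r) (i : Fin (2 * n + 1)) :
    (Finset.univ.filter fun y => bl l y = i).card = tilde n l.1 i := by
  have h1 : (Finset.univ.filter fun y => bl l y = i).map Fin.valEmbedding =
      Finset.Ico (psum n l.1 i) (psum n l.1 (i + 1)) := by
    ext k
    simp only [Finset.mem_map, Finset.mem_filter, Finset.mem_univ, true_and, Finset.mem_Ico,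
      Fin.valEmbedding_apply]
    constructor
    · rintro ⟨y, rfl, rfl⟩
      exact bl_spec l y
    · intro hk
      have h2 : psum n l.1 (i + 1) ≤ psum n l.1 (2 * n + 1) := psum_mono l.1 (by omega)
      rw [psum_top] at h2
      refine ⟨⟨k, by omega⟩, ?_, rfl⟩
      rw [← mem_block_iff, mem_block]
      exact hk
  rw [← Finset.card_map Fin.valEmbedding, h1, Nat.card_Ico, psum_succ]
  omega

/-- A word that is symmetric under reversal and has equal letters at the positions interchanged by
a generator is invariant under the generator. -/
lemma comp_sPerm {f : Fin (2 * r + 1) → Fin (2 * n + 1)} (hf : ∀ y, f y.rev = (f y).rev) {k : Fin r}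
    (h : f (pt k) = f (pt' k)) (y : Fin (2 * r + 1)) : f (sPerm r k y) = f y := by
  have half : ∀ y : Fin (2 * r + 1), (y : ℕ) ≤ r → f (sPerm r k y) = f y := by
    intro y hy
    by_cases y1 : y = pt k
    · rw [y1, sPerm_pt]
      split_ifs with hk
      · exact h.symm
      · rw [hf, h, pt'_eq_ctr hk, rev_eq_self_iff, ← rev_eq_self_iff, ← hf]
        congr 1
        rw [rev_eq_self_iff]
    by_cases y2 : y = pt' k
    · rw [y2, sPerm_pt']
      split_ifs
      · exact h
      · rfl
    · rw [sPerm_of_far hy (fun h => y1 (Fin.ext h)) (fun h => y2 (Fin.ext h))]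
  rcases le_total (y : ℕ) r with hy | hy
  · exact half y hy
  · rw [← Fin.rev_rev y, sPerm_rev, hf, half y.rev (by rw [Fin.val_rev]; omega), ← hf]

/-- The generator `s r k` preserves the blocks of `l` if it moves points within a block. -/
lemma bl_sPerm {l : Comp n r} {k : Fin r} (h : bl l (pt k) = bl l (pt' k)) (y : Fin (2 * r + 1)) :
    bl l (sPerm r k y) = bl l y :=
  comp_sPerm (bl_rev l) h y

lemma s_mem_Wpar {l : Comp n r} {k : Fin r} (h : bl l (pt k) = bl l (pt' k)) :
    s r k ∈ Wpar n r l := by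
  apply Subgroup.subset_closure
  refine ⟨k, fun i hi => ?_, rfl⟩
  rw [← psum_half l.1 i.2] at hi
  have h1 := (bl_lt_iff l (pt k) (i + 1)).2 (by simp only [pt]; omega)
  have h2 := (bl_lt_iff l (pt' k) (i + 1)).not.2 (by simp only [pt']; omega)
  omega

lemma bl_eq_of_generator {l : Comp n r} {k : Fin r}
    (h : ∀ i : Fin n, (k : ℕ) + 1 ≠ ∑ j with j ≤ i.castSucc, l.1 j) :
    bl l (pt k) = bl l (pt' k) := by
  have hk := k.2
  apply le_antisymm (bl_mono l (by simp [pt, pt', Fin.le_def]))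
  rw [Fin.le_def, ← not_lt]
  intro hlt
  have h1 := (bl_spec l (pt k)).2
  have h2 := (bl_spec l (pt' k)).1
  have h3 := psum_mono l.1 (Nat.succ_le_of_lt hlt)
  have v1 : ((pt k : Fin (2 * r + 1)) : ℕ) = k := rfl
  have v2 : ((pt' k : Fin (2 * r + 1)) : ℕ) = k + 1 := rfl
  rw [Nat.succ_eq_add_one] at h3
  by_cases hn : (bl l (pt k) : ℕ) < n
  · apply h ⟨bl l (pt k), hn⟩
    rw [← psum_half l.1 hn]
    omega
  · have h5 := psum_n_succ l
    have h6 := psum_mono l.1 (show n + 1 ≤ bl l (pt k) + 1 by omega)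
    omega

/-- The parabolic subgroup consists of all elements that preserve the blocks. -/
lemma mem_Wpar_iff (l : Comp n r) (w : W r) : w ∈ Wpar n r l ↔ ∀ y, bl l (pre w y) = bl l y := by
  constructor
  · intro hw
    unfold Wpar at hw
    induction hw using Subgroup.closure_induction with
    | mem g hg =>
      obtain ⟨k, hk, rfl⟩ := hg
      intro y
      rw [pre_s, bl_sPerm (bl_eq_of_generator hk)]
    | one => intro y; rfl
    | mul a b _ _ ha hb => intro y; rw [pre_mul, hb, ha]
    | inv a _ ha =>
      intro y
      conv_rhs => rw [show y = pre a (pre a⁻¹ y) by rw [← pre_mul, inv_mul_cancel, pre_one]]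
      rw [ha]
  · induction hn : len w using Nat.strong_induction_on generalizing w with
    | _ k ih =>
      intro h
      by_cases hall : ∀ i, Asc w i
      · rw [eq_one_of_forall_asc w hall]
        exact one_mem _
      · push Not at hall
        obtain ⟨i, hi⟩ := hall
        have h1 := (not_asc_iff w i).1 hi
        have h2 : bl l (pt i) = bl l (pt' i) := by
          apply le_antisymm (bl_mono l (by simp [pt, pt', Fin.le_def]))
          rw [← h, ← h (pt i)]
          exact bl_mono l h1.le
        rw [← s_mul_s_mul i w]
        apply mul_mem (s_mem_Wpar h2)
        apply ih _ _ _ rfl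
        · intro y
          rw [pre_s_mul, h, bl_sPerm h2]
        · have := len_of_not_asc hi
          omega

lemma cosetMatrix_apply (l m : Comp n r) (w : W r) (i j : Fin (2 * n + 1)) :
    cosetMatrix n r l w m i j =
      (Finset.univ.filter fun y => bl l y = i ∧ bl m (pre w y) = j).card := by
  unfold cosetMatrix
  congr 1
  ext y
  simp only [Finset.mem_inter, mem_block_iff, Finset.mem_image, Finset.mem_filter,
    Finset.mem_univ, true_and]
  apply and_congr_right
  intro _
  constructor
  · rintro ⟨z, hz, rfl⟩
    rw [pre_apply]; exact hz
  · intro h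
    exact ⟨pre w y, h, apply_pre w y⟩

lemma cosetMatrix_mul_left {l m : Comp n r} {g w : W r} (hg : ∀ y, bl l (pre g y) = bl l y) :
    cosetMatrix n r l (g * w) m = cosetMatrix n r l w m := by
  ext i j
  rw [cosetMatrix_apply, cosetMatrix_apply]
  apply Finset.card_bij (fun y _ => pre g y)
  · intro y hy
    rw [Finset.mem_filter] at hy ⊢
    rw [hg y, ← pre_mul]
    exact ⟨Finset.mem_univ _, hy.2⟩
  · intro a _ b _ h
    exact pre_injective g h
  · intro b hb
    refine ⟨(g : Equiv.Perm _) b, ?_, pre_apply g b⟩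
    rw [Finset.mem_filter] at hb ⊢
    rw [← hg ((g : Equiv.Perm _) b), pre_mul, pre_apply]
    exact ⟨Finset.mem_univ _, hb.2⟩

lemma cosetMatrix_mul_right {l m : Comp n r} {g w : W r} (hg : ∀ y, bl m (pre g y) = bl m y) :
    cosetMatrix n r l (w * g) m = cosetMatrix n r l w m := by
  ext i j
  rw [cosetMatrix_apply, cosetMatrix_apply]
  simp only [pre_mul, hg]

/-- The double coset with matrix `A` consists of all elements with matrix `A`. -/
lemma mem_cosetOf (l m : Comp n r) (A : Mat n) (w : W r) :
    w ∈ cosetOf n r l A m ↔ cosetMatrix n r l w m = A := by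
  constructor
  · rintro ⟨d, rfl, hd⟩
    obtain ⟨a, ha, b, hb, rfl⟩ := DoubleCoset.mem_doubleCoset.1 hd
    rw [cosetMatrix_mul_right ((mem_Wpar_iff m b).1 hb),
      cosetMatrix_mul_left ((mem_Wpar_iff l a).1 ha)]
  · intro h
    exact ⟨w, h, DoubleCoset.mem_doubleCoset.2 ⟨1, one_mem _, 1, one_mem _, by simp⟩⟩

lemma sum_cosetMatrix_row (l m : Comp n r) (w : W r) (i : Fin (2 * n + 1)) :
    ∑ j, cosetMatrix n r l w m i j = tilde n l.1 i := by
  simp only [cosetMatrix_apply]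
  rw [← card_bl, Finset.card_eq_sum_card_fiberwise (t := Finset.univ)
    (f := fun y => bl m (pre w y)) (by intro _ _; simp)]
  simp only [Finset.filter_filter]

lemma cosetMatrix_inv (l m : Comp n r) (w : W r) :
    cosetMatrix n r m w⁻¹ l = (cosetMatrix n r l w m).transpose := by
  ext i j
  rw [Matrix.transpose_apply, cosetMatrix_apply, cosetMatrix_apply]
  have h1 : ∀ y, pre w (pre w⁻¹ y) = y := fun y => by rw [← pre_mul, inv_mul_cancel, pre_one]
  have h2 : ∀ y, pre w⁻¹ (pre w y) = y := fun y => by rw [← pre_mul, mul_inv_cancel, pre_one]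
  apply Finset.card_bij (fun y _ => pre w⁻¹ y)
  · intro y hy
    simpa [h1, and_comm] using hy
  · intro a _ b _ h
    exact pre_injective _ h
  · intro b hb
    refine ⟨pre w b, ?_, h2 b⟩
    simpa [h2, and_comm] using hb

lemma sum_cosetMatrix_col (l m : Comp n r) (w : W r) (j : Fin (2 * n + 1)) :
    ∑ i, cosetMatrix n r l w m i j = tilde n m.1 j := by
  rw [← sum_cosetMatrix_row m l w⁻¹ j, cosetMatrix_inv]
  rfl

lemma cosetMatrix_self_iff (l : Comp n r) (w : W r) :
    cosetMatrix n r l w l = Matrix.diagonal (tilde n l.1) ↔ w ∈ Wpar n r l := by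
  rw [mem_Wpar_iff]
  constructor
  · intro h y
    by_contra hne
    have h1 := congrFun (congrFun h (bl l y)) (bl l (pre w y))
    rw [cosetMatrix_apply, Matrix.diagonal_apply_ne' _ hne, Finset.card_eq_zero] at h1
    have : y ∈ (∅ : Finset (Fin (2 * r + 1))) := by
      rw [← h1]; simp
    simp at this
  · intro h
    ext i j
    rw [cosetMatrix_apply, Matrix.diagonal_apply]
    simp only [h]
    split_ifs with hij
    · subst hij
      simp only [and_self, card_bl]
    · rw [Finset.card_eq_zero, Finset.filter_eq_empty_iff]
      rintro y - ⟨rfl, h2⟩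
      exact hij h2

/-! ### Double coset sums -/

/-- The linear combination of the `T r w` with coefficients `φ`. -/
def comb (φ : W r → Z) : Hecke r := ∑ w, φ w • T r w

open Classical in
/-- The coefficients of `Tgen r i * comb φ`. -/
def gact (i : Fin r) (φ : W r → Z) (w : W r) : Z :=
  if Asc w i then v 2 * φ (s r i * w) else φ (s r i * w) + (v 2 - 1) * φ w

lemma sum_s_mul (i : Fin r) {M : Type*} [AddCommMonoid M] (f : W r → M) :
    ∑ w, f (s r i * w) = ∑ w, f w :=
  Fintype.sum_equiv (Equiv.mulLeft (s r i)) _ _ fun _ => rfl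

lemma Tgen_mul_comb (i : Fin r) (φ : W r → Z) : Tgen r i * comb φ = comb (gact i φ) := by
  classical
  unfold comb
  rw [Finset.mul_sum]
  have h1 : ∀ w : W r, Tgen r i * (φ w • T r w) =
      (if Asc w i then 0 else ((v 2 - 1) * φ w) • T r w) +
        (if Asc w i then φ w else v 2 * φ w) • T r (s r i * w) := by
    intro w
    rw [mul_smul_comm]
    split_ifs with h
    · rw [Tgen_mul_T_of_asc h, zero_add]
    · rw [Tgen_mul_T_of_not_asc h, smul_add, smul_smul, smul_smul, mul_comm (φ w), mul_comm (φ w)]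
  simp only [h1]
  rw [Finset.sum_add_distrib,
    ← sum_s_mul i (fun w => (if Asc w i then φ w else v 2 * φ w) • T r (s r i * w)),
    ← Finset.sum_add_distrib]
  apply Finset.sum_congr rfl
  intro w _
  unfold gact
  rw [s_mul_s_mul]
  simp only [asc_s_mul]
  by_cases h : Asc w i
  · simp [h]
  · simp [h, add_smul, add_comm]

open Classical in
/-- The sum of all `T r w`, where `w` has matrix `A` with respect to `l` and `m`. -/
def Y (l : Comp n r) (A : Mat n) (m : Comp n r) : Hecke r :=
  ∑ w with cosetMatrix n r l w m = A, T r w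

open Classical in
lemma sum_cosetOf (l : Comp n r) (A : Mat n) (m : Comp n r) :
    ∑ w : W r with w ∈ cosetOf n r l A m, T r w = Y l A m := by
  unfold Y
  simp only [mem_cosetOf]

open Classical in
lemma Y_diagonal (l : Comp n r) : Y l (Matrix.diagonal (tilde n l.1)) l = x n r l := by
  unfold Y x
  simp only [cosetMatrix_self_iff]

lemma Y_eq_comb (l : Comp n r) (A : Mat n) (m : Comp n r) :
    Y l A m = comb (open Classical in fun w => if cosetMatrix n r l w m = A then 1 else 0) := by
  unfold Y comb
  rw [Finset.sum_filter]
  apply Finset.sum_congr rfl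
  intro w _
  by_cases h : cosetMatrix n r l w m = A <;> simp [h]

lemma Y_eq_zero_of_row {l : Comp n r} {A : Mat n} {m : Comp n r} {i : Fin (2 * n + 1)}
    (h : ∑ j, A i j ≠ tilde n l.1 i) : Y l A m = 0 := by
  unfold Y
  apply Finset.sum_eq_zero
  intro w hw
  rw [Finset.mem_filter] at hw
  rw [← hw.2, sum_cosetMatrix_row] at h
  exact absurd rfl h

lemma Y_eq_zero_of_col {l : Comp n r} {A : Mat n} {m : Comp n r} {j : Fin (2 * n + 1)}
    (h : ∑ i, A i j ≠ tilde n m.1 j) : Y l A m = 0 := by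
  unfold Y
  apply Finset.sum_eq_zero
  intro w hw
  rw [Finset.mem_filter] at hw
  rw [← hw.2, sum_cosetMatrix_col] at h
  exact absurd rfl h

open Classical in
/-- The sum of `T r w` over all `w` with a given word `y ↦ bl m (pre w y)`, that is, over a coset
`u W_m`. -/
def cosetSum (m : Comp n r) (f : Fin (2 * r + 1) → Fin (2 * n + 1)) : Hecke r :=
  ∑ w with (fun y => bl m (pre w y)) = f, T r w

/-- Every coset sum is a left multiple of `x n r m`: it arises from `x n r m` by successive
multiplications with generators that sort the word of the coset. -/
lemma cosetSum_mem (m : Comp n r) (u : W r) :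
    cosetSum m (fun y => bl m (pre u y)) ∈ Submodule.span (Hecke r) {x n r m} := by
  classical
  induction hn : len u using Nat.strong_induction_on generalizing u with
  | _ k ih =>
    by_cases hall : ∀ i, Asc u i
    · rw [eq_one_of_forall_asc u hall]
      convert Submodule.mem_span_singleton_self (x n r m)
      unfold cosetSum x
      simp only [mem_Wpar_iff, pre_one, funext_iff]
    · push Not at hall
      obtain ⟨i, hi⟩ := hall
      have hlen := len_of_not_asc hi
      have hmem := ih _ (by omega) (s r i * u) rfl
      have hu : ∀ y, pre u y = pre (s r i * u) (sPerm r i y) := by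
        intro y; rw [pre_s_mul, sPerm_sPerm]
      have hasc : Asc (s r i * u) i := (asc_s_mul u i).2 hi
      generalize s r i * u = u' at *
      have hrev : ∀ y, bl m (pre u' y.rev) = (bl m (pre u' y)).rev := by
        intro y; rw [pre_rev, bl_rev]
      by_cases heq : bl m (pre u' (pt i)) = bl m (pre u' (pt' i))
      · simp only [hu]
        have h2 : ∀ y, bl m (pre u' (sPerm r i y)) = bl m (pre u' y) :=
          comp_sPerm (f := fun y => bl m (pre u' y)) hrev heq
        simp only [h2]
        exact hmem
      · have h1 : cosetSum m (fun y => bl m (pre u y)) =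
            Tgen r i * cosetSum m (fun y => bl m (pre u' y)) := by
          unfold cosetSum
          rw [Finset.mul_sum, Finset.sum_filter, Finset.sum_filter,
            ← sum_s_mul i]
          apply Finset.sum_congr rfl
          intro w _
          have e1 : ((fun y => bl m (pre (s r i * w) y)) = fun y => bl m (pre u y)) ↔
              ((fun y => bl m (pre w y)) = fun y => bl m (pre u' y)) := by
            simp only [hu, pre_s_mul, funext_iff]
            constructor
            · intro h y
              have := h (sPerm r i y)
              rwa [sPerm_sPerm] at this
            · intro h y
              exact h _
          simp only [e1]
          split_ifs with h
          · rw [Tgen_mul_T_of_asc]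
            have h3 := congrFun h (pt i)
            have h4 := congrFun h (pt' i)
            by_contra hna
            have h5 := bl_mono m ((not_asc_iff w i).1 hna).le
            rw [h3, h4] at h5
            exact heq (le_antisymm (bl_mono m hasc.le) h5)
          · rfl
        rw [h1, ← smul_eq_mul]
        exact Submodule.smul_mem _ _ hmem

lemma cosetMatrix_congr {l m : Comp n r} {u w : W r}
    (h : (fun y => bl m (pre u y)) = fun y => bl m (pre w y)) :
    cosetMatrix n r l u m = cosetMatrix n r l w m := by
  ext i j
  rw [cosetMatrix_apply, cosetMatrix_apply]
  simp only [funext_iff] at h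
  simp only [h]

/-- A double coset is a union of cosets `u W_m`, hence its sum is a left multiple of `x n r m`. -/
lemma exists_Y_eq_mul_x (l : Comp n r) (A : Mat n) (m : Comp n r) : ∃ h, Y l A m = h * x n r m := by
  classical
  suffices h : Y l A m ∈ Submodule.span (Hecke r) {x n r m} by
    obtain ⟨a, ha⟩ := Submodule.mem_span_singleton.1 h
    exact ⟨a, ha.symm⟩
  unfold Y
  rw [← Finset.sum_fiberwise _ (fun w y => bl m (pre w y))]
  apply Submodule.sum_mem
  intro f _
  by_cases hf : ∃ u : W r, cosetMatrix n r l u m = A ∧ (fun y => bl m (pre u y)) = f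
  · obtain ⟨u, hu, rfl⟩ := hf
    convert cosetSum_mem m u using 1
    unfold cosetSum
    congr 1
    ext w
    simp only [Finset.mem_filter, Finset.mem_univ, true_and, and_iff_right_iff_imp]
    intro h
    rw [cosetMatrix_congr h, hu]
  · push Not at hf
    rw [Finset.sum_eq_zero]
    · exact Submodule.zero_mem _
    · intro w hw
      simp only [Finset.mem_filter, Finset.mem_univ, true_and] at hw
      exact absurd hw.2 (hf w hw.1)

lemma antiHom_Y (l : Comp n r) (A : Mat n) (m : Comp n r) :
    antiHom r (Y l A m) = MulOpposite.op (Y m A.transpose l) := by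
  classical
  unfold Y
  rw [map_sum, Finset.sum_filter, Finset.op_sum, Finset.sum_filter]
  apply Fintype.sum_equiv (Equiv.inv (W r))
  intro w
  simp only [Equiv.inv_apply, cosetMatrix_inv, Matrix.transpose_inj, antiHom_T]

/-- The mirror image of `exists_Y_eq_mul_x` under the anti-automorphism. -/
lemma exists_Y_eq_x_mul (l : Comp n r) (A : Mat n) (m : Comp n r) : ∃ g, Y l A m = x n r l * g := by
  obtain ⟨h, hh⟩ := exists_Y_eq_mul_x m A.transpose l
  have h1 := congrArg (antiHom r) hh
  rw [map_mul, antiHom_Y, Matrix.transpose_transpose, ← Y_diagonal, antiHom_Y,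
    Matrix.diagonal_transpose, Y_diagonal] at h1
  refine ⟨(antiHom r h).unop, ?_⟩
  have h2 := congrArg MulOpposite.unop h1
  simpa using h2

/-! ### Standard basis elements of the Schur algebra -/

lemma mem_RIdeal {l : Comp n r} {y : Hecke r} : y ∈ RIdeal n r l ↔ ∃ g, y = x n r l * g := by
  rw [Submodule.mem_span_singleton]
  constructor
  · rintro ⟨a, rfl⟩
    exact ⟨a.unop, rfl⟩
  · rintro ⟨g, rfl⟩
    exact ⟨MulOpposite.op g, rfl⟩

/-- Left multiplication by `h` as a map between right ideals. -/
def mulMap (l m : Comp n r) (h : Hecke r) (hh : h * x n r m ∈ RIdeal n r l) :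
    RIdeal n r m →ₗ[(Hecke r)ᵐᵒᵖ] RIdeal n r l :=
  (LinearMap.mulLeft (Hecke r)ᵐᵒᵖ h).restrict fun y hy => by
    obtain ⟨g, rfl⟩ := mem_RIdeal.1 hy
    obtain ⟨g', hg'⟩ := mem_RIdeal.1 hh
    rw [LinearMap.mulLeft_apply, ← mul_assoc, hg', mul_assoc]
    exact mem_RIdeal.2 ⟨_, rfl⟩

lemma mulMap_apply (l m : Comp n r) (h : Hecke r) (hh : h * x n r m ∈ RIdeal n r l)
    (y : RIdeal n r m) : (mulMap l m h hh y : Hecke r) = h * y := rfl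

instance : Fintype (Comp n r) :=
  Fintype.subtype (Finset.Nat.antidiagonalTuple (n + 1) r) fun _ =>
    Finset.Nat.mem_antidiagonalTuple

open Classical in
/-- The endomorphism with given components. -/
def ofMaps (f : ∀ l m : Comp n r, RIdeal n r m →ₗ[(Hecke r)ᵐᵒᵖ] RIdeal n r l) : S n r :=
  DirectSum.toModule (Hecke r)ᵐᵒᵖ (Comp n r) (⨁ l : Comp n r, RIdeal n r l) fun m =>
    ∑ l, DirectSum.lof (Hecke r)ᵐᵒᵖ (Comp n r) (fun l => RIdeal n r l) l ∘ₗ f l m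

lemma coord_ofMaps (f : ∀ l m : Comp n r, RIdeal n r m →ₗ[(Hecke r)ᵐᵒᵖ] RIdeal n r l)
    (l m : Comp n r) :
    coord n r l (ofMaps f (xgen n r m)) =
      (f l m ⟨x n r m, Submodule.mem_span_singleton_self _⟩ : RIdeal n r l) := by
  classical
  unfold coord
  congr 1
  have h1 : ofMaps f (xgen n r m) = ∑ l, DirectSum.lof (Hecke r)ᵐᵒᵖ (Comp n r)
      (fun l => RIdeal n r l) l (f l m ⟨x n r m, Submodule.mem_span_singleton_self _⟩) := by
    unfold ofMaps xgen
    have := DirectSum.toModule_lof (Hecke r)ᵐᵒᵖ (φ := fun m =>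
      ∑ l, DirectSum.lof (Hecke r)ᵐᵒᵖ (Comp n r) (fun l => RIdeal n r l) l ∘ₗ f l m) m
      ⟨x n r m, Submodule.mem_span_singleton_self _⟩
    rw [LinearMap.sum_apply] at this
    exact this
  rw [h1, map_sum, Finset.sum_eq_single l]
  · exact DirectSum.component.lof_self _ _ _
  · intro b _ hb
    rw [DirectSum.component.of, dif_neg hb]
  · intro h
    exact absurd (Finset.mem_univ l) h

/-- The endomorphism exists for every matrix: its components are the left multiplications with the
elements `h` such that `Y l A m = h * x n r m`. -/
lemma exists_isStd (A : Mat n) : ∃ φ : S n r, IsStd n r A φ := by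
  choose h hh using fun l m : Comp n r => exists_Y_eq_mul_x l A m
  refine ⟨ofMaps fun l m => mulMap l m (h l m) ?_, fun m l => ?_⟩
  · rw [← hh]
    exact mem_RIdeal.2 (exists_Y_eq_x_mul l A m)
  · rw [coord_ofMaps, sum_cosetOf, mulMap_apply, hh]

/-- The standard basis element `e n r A` has the components `Y l A m`. -/
lemma coord_e (A : Mat n) (l m : Comp n r) : coord n r l (e n r A (xgen n r m)) = Y l A m := by
  rw [← sum_cosetOf]
  exact Classical.epsilon_spec (exists_isStd A) m l

/-! ### Products in the Schur algebra -/

/-- The coordinate as a linear map. -/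
def coordHom (l : Comp n r) : TMod n r →ₗ[(Hecke r)ᵐᵒᵖ] Hecke r :=
  (RIdeal n r l).subtype ∘ₗ
    (DirectSum.component (Hecke r)ᵐᵒᵖ (Comp n r) (fun k => RIdeal n r k) l)

lemma coordHom_apply (l : Comp n r) (y : TMod n r) : coordHom l y = coord n r l y := rfl

lemma coord_smul (l : Comp n r) (c : Z) (y : TMod n r) :
    coord n r l (c • y) = c • coord n r l y := rfl

lemma TMod_ext {a b : TMod n r} (h : ∀ l, coord n r l a = coord n r l b) : a = b := by
  apply DirectSum.ext_component (Hecke r)ᵐᵒᵖ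
  intro l
  exact Subtype.ext (h l)

open Classical in
lemma coord_xgen (l m : Comp n r) : coord n r l (xgen n r m) = if l = m then x n r m else 0 := by
  unfold coord xgen
  erw [DirectSum.component.of]
  split_ifs with h1 h2 h2
  · subst h1; rfl
  · exact absurd h1.symm h2
  · exact absurd h2.symm h1
  · rfl

/-- The generators `xgen n r m` generate the module, so that an endomorphism is determined by its
values on them. -/
lemma S_ext {φ ψ : S n r} (h : ∀ m, φ (xgen n r m) = ψ (xgen n r m)) : φ = ψ := by
  classical
  apply DirectSum.linearMap_ext
  intro m
  apply LinearMap.ext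
  rintro ⟨y, hy⟩
  obtain ⟨g, rfl⟩ := mem_RIdeal.1 hy
  have h1 : (⟨x n r m * g, hy⟩ : RIdeal n r m) =
      MulOpposite.op g • ⟨x n r m, Submodule.mem_span_singleton_self _⟩ := rfl
  rw [h1, map_smul, map_smul]
  congr 1
  have := h m
  unfold xgen at this
  exact this

lemma e_xgen {A : Mat n} {m : Comp n r} {g : Comp n r → Hecke r}
    (hg : ∀ l, Y l A m = x n r l * g l) :
    e n r A (xgen n r m) = ∑ l, MulOpposite.op (g l) • xgen n r l := by
  apply TMod_ext
  intro l
  rw [coord_e, ← coordHom_apply, map_sum]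
  simp only [map_smul, coordHom_apply, coord_xgen]
  rw [Finset.sum_eq_single l]
  · rw [if_pos rfl, hg]; rfl
  · intro b _ hb
    rw [if_neg hb.symm, smul_zero]
  · intro h
    exact absurd (Finset.mem_univ l) h

/-- The components of a product with a standard basis element on the right. -/
lemma coord_mul_e (φ : S n r) {A : Mat n} {m : Comp n r} {g : Comp n r → Hecke r}
    (hg : ∀ l, Y l A m = x n r l * g l) (l : Comp n r) :
    coord n r l ((φ * e n r A) (xgen n r m)) = ∑ k, coord n r l (φ (xgen n r k)) * g k := by
  rw [Module.End.mul_apply, e_xgen hg, map_sum, ← coordHom_apply, map_sum]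
  apply Finset.sum_congr rfl
  intro k _
  rw [map_smul, map_smul]
  rfl

lemma S_ext_coord {φ ψ : S n r}
    (h : ∀ l m, coord n r l (φ (xgen n r m)) = coord n r l (ψ (xgen n r m))) : φ = ψ :=
  S_ext fun m => TMod_ext fun l => h l m

lemma coord_sum_smul_e {ι : Type*} (t : Finset ι) (c : ι → Z) (B : ι → Mat n) (l m : Comp n r) :
    coord n r l ((∑ i ∈ t, c i • e n r (B i)) (xgen n r m)) = ∑ i ∈ t, c i • Y l (B i) m := by
  rw [LinearMap.sum_apply, ← coordHom_apply, map_sum]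
  apply Finset.sum_congr rfl
  intro i _
  rw [← coord_e]
  rfl

/-! ### The chain of coset representatives -/

lemma v_add (a b : ℤ) : v (a + b) = v a * v b := LaurentPolynomial.T_add a b

lemma v_zero : v 0 = 1 := LaurentPolynomial.T_zero

lemma qint_zero : qint 0 = 0 := rfl

lemma qint_succ (m : ℕ) : qint (m + 1) = qint m + v (2 * (m : ℤ)) := Finset.sum_range_succ _ _

lemma qint_add (a b : ℕ) : qint (a + b) = qint a + v (2 * (a : ℤ)) * qint b := by
  induction b with
  | zero => simp [qint_zero]
  | succ b ih =>
    rw [← add_assoc, qint_succ, ih, qint_succ, mul_add, ← v_add, add_assoc]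
    congr 3
    push_cast
    ring

open Classical in
/-- The function that agrees with `φ` on `X` and vanishes elsewhere. -/
def mask (X : W r → Prop) (φ : W r → Z) (w : W r) : Z := if X w then φ w else 0

lemma gact_mask {i : Fin r} {X : W r → Prop} (hX : ∀ w, X (s r i * w) ↔ X w) (φ : W r → Z) :
    gact i (mask X φ) = mask X (gact i φ) := by
  funext w
  unfold gact mask
  by_cases h : X w
  · simp [h, (hX w).2 h]
  · simp [h, (hX w).not.2 h]

/-- The number of points in `[y₀, b)`, without the central one, whose preimage is less than `t`. -/
def cnt (y₀ : Fin (2 * r + 1)) (t b : ℕ) (w : W r) : ℕ :=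
  (Finset.univ.filter fun z : Fin (2 * r + 1) =>
    (y₀ ≤ z ∧ (z : ℕ) < b ∧ z ≠ ctr r) ∧ (pre w z : ℕ) < t).card

/-- The coefficients obtained from those of the indicator of `pre w y₀ < t` by pushing the
threshold condition from `y₀` to `b` along generators. -/
def chainFun (y₀ : Fin (2 * r + 1)) (t : ℕ) (b : Fin (2 * r + 1)) (w : W r) : Z :=
  if (pre w b : ℕ) < t then v (2 * (cnt y₀ t b w : ℤ)) else 0

lemma cnt_self (y₀ : Fin (2 * r + 1)) (t : ℕ) (w : W r) : cnt y₀ t y₀ w = 0 := by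
  unfold cnt
  rw [Finset.card_eq_zero, Finset.filter_eq_empty_iff]
  rintro z - ⟨⟨h1, h2, -⟩, -⟩
  exact absurd h1 (not_le.2 h2)

lemma cnt_succ {y₀ b : Fin (2 * r + 1)} (hb : y₀ ≤ b) (hc : b ≠ ctr r) (t : ℕ) (w : W r) :
    cnt y₀ t (b + 1) w = cnt y₀ t b w + if (pre w b : ℕ) < t then 1 else 0 := by
  classical
  unfold cnt
  split_ifs with h
  · rw [← Finset.card_insert_of_notMem (a := b) (by simp)]
    congr 1
    ext z
    simp only [Finset.mem_filter, Finset.mem_univ, true_and, Finset.mem_insert]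
    constructor
    · rintro ⟨⟨h1, h2, h3⟩, h4⟩
      rcases Nat.lt_succ_iff_lt_or_eq.1 h2 with h5 | h5
      · exact Or.inr ⟨⟨h1, h5, h3⟩, h4⟩
      · exact Or.inl (Fin.ext h5)
    · rintro (rfl | ⟨⟨h1, h2, h3⟩, h4⟩)
      · exact ⟨⟨hb, Nat.lt_succ_self _, hc⟩, h⟩
      · exact ⟨⟨h1, h2.trans (Nat.lt_succ_self _), h3⟩, h4⟩
  · rw [add_zero]
    congr 1
    ext z
    simp only [Finset.mem_filter, Finset.mem_univ, true_and]
    constructor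
    · rintro ⟨⟨h1, h2, h3⟩, h4⟩
      rcases Nat.lt_succ_iff_lt_or_eq.1 h2 with h5 | h5
      · exact ⟨⟨h1, h5, h3⟩, h4⟩
      · rw [Fin.ext h5] at h4
        exact absurd h4 h
    · rintro ⟨⟨h1, h2, h3⟩, h4⟩
      exact ⟨⟨h1, h2.trans (Nat.lt_succ_self _), h3⟩, h4⟩

lemma cnt_ctr_succ (y₀ : Fin (2 * r + 1)) (t : ℕ) (w : W r) :
    cnt y₀ t (r + 1) w = cnt y₀ t r w := by
  unfold cnt
  congr 1
  ext z
  simp only [Finset.mem_filter, Finset.mem_univ, true_and, Ne, Fin.ext_iff, ctr]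
  constructor
  · rintro ⟨⟨h1, h2, h3⟩, h4⟩
    exact ⟨⟨h1, by omega, h3⟩, h4⟩
  · rintro ⟨⟨h1, h2, h3⟩, h4⟩
    exact ⟨⟨h1, by omega, h3⟩, h4⟩

lemma cnt_s_mul {i : Fin r} {y₀ a : Fin (2 * r + 1)}
    (h : ∀ z : Fin (2 * r + 1), y₀ ≤ z → z < a → y₀ ≤ sPerm r i z ∧ sPerm r i z < a)
    (t : ℕ) (w : W r) : cnt y₀ t a (s r i * w) = cnt y₀ t a w := by
  have hc : ∀ z, sPerm r i z ≠ ctr r ↔ z ≠ ctr r := by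
    intro z
    rw [not_iff_not]
    constructor
    · intro hz
      rw [← sPerm_sPerm i z, hz, sPerm_ctr]
    · rintro rfl
      rw [sPerm_ctr]
  unfold cnt
  apply Finset.card_bij (fun z _ => sPerm r i z)
  · intro z hz
    simp only [Finset.mem_filter, Finset.mem_univ, true_and, pre_s_mul] at hz ⊢
    exact ⟨⟨(h z hz.1.1 hz.1.2.1).1, (h z hz.1.1 hz.1.2.1).2, (hc z).2 hz.1.2.2⟩, hz.2⟩
  · intro a _ b _ hab
    exact (sPerm r i).injective hab
  · intro z hz
    simp only [Finset.mem_filter, Finset.mem_univ, true_and, pre_s_mul] at hz ⊢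
    refine ⟨sPerm r i z, ?_, sPerm_sPerm i z⟩
    rw [sPerm_sPerm]
    exact ⟨⟨(h z hz.1.1 hz.1.2.1).1, (h z hz.1.1 hz.1.2.1).2, (hc z).2 hz.1.2.2⟩, hz.2⟩

/-- One generator moves the threshold condition from a point `a` to the next point `b`. -/
lemma gact_chainFun {i : Fin r} {y₀ a b : Fin (2 * r + 1)} (hab : sPerm r i a = b)
    (hasc : ∀ w, Asc w i ↔ pre w a < pre w b) (hya : y₀ ≤ a) (hac : a ≠ ctr r)
    (hcnt : ∀ t w, cnt y₀ t b w = cnt y₀ t (a + 1) w)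
    (h : ∀ z : Fin (2 * r + 1), y₀ ≤ z → z < a → y₀ ≤ sPerm r i z ∧ sPerm r i z < a) (t : ℕ) :
    gact i (chainFun y₀ t a) = chainFun y₀ t b := by
  funext w
  unfold gact chainFun
  have hne : pre w a ≠ pre w b := by
    intro h1
    have h2 := pre_injective w h1
    rw [← h2] at hab
    have h3 := (hasc w).not.2 (by rw [h1]; exact lt_irrefl _)
    rw [← asc_s_mul, hasc, pre_s_mul, pre_s_mul, ← h2, hab] at h3
    exact absurd h3 (lt_irrefl _)
  rw [cnt_s_mul h, pre_s_mul, hab, hcnt, cnt_succ hya hac, hasc]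
  generalize cnt y₀ t a w = G
  have hv : v 2 * v (2 * (G : ℤ)) = v (2 * ((G + 1 : ℕ) : ℤ)) := by
    rw [← v_add]; congr 1; push_cast; ring
  rw [Ne, Fin.ext_iff] at hne
  rw [Fin.lt_def]
  by_cases h1 : (pre w a : ℕ) < pre w b
  · rw [if_pos h1]
    by_cases h2 : (pre w b : ℕ) < t
    · rw [if_pos h2, if_pos h2, if_pos (h1.trans h2), hv]
    · rw [if_neg h2, if_neg h2, mul_zero]
  · rw [if_neg h1]
    by_cases h2 : (pre w a : ℕ) < t
    · rw [if_pos h2, if_pos h2, if_pos (by omega), if_pos (by omega), ← hv]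
      ring
    · rw [if_neg h2, if_neg h2, mul_zero, add_zero, add_zero]

lemma val_sPerm_of_lt {i : Fin r} (hi : (i : ℕ) + 1 < r) (z : Fin (2 * r + 1)) :
    ((sPerm r i z : Fin (2 * r + 1)) : ℕ) = if (z : ℕ) = i then (i : ℕ) + 1
      else if (z : ℕ) = i + 1 then (i : ℕ)
      else if (z : ℕ) = 2 * r - i then 2 * r - i - 1
      else if (z : ℕ) = 2 * r - i - 1 then 2 * r - i else (z : ℕ) := by
  rw [val_sPerm, if_pos hi]

lemma val_sPerm_last {i : Fin r} (hi : (i : ℕ) + 1 = r) (z : Fin (2 * r + 1)) :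
    ((sPerm r i z : Fin (2 * r + 1)) : ℕ) = if (z : ℕ) = i then 2 * r - i
      else if (z : ℕ) = 2 * r - i then (i : ℕ) else (z : ℕ) := by
  rw [val_sPerm, if_neg (by omega)]

/-- The step from a non-central point to the next one is made by a generator that preserves the
block of these points. -/
lemma exists_step {l : Comp n r} {y₀ b : Fin (2 * r + 1)} (hfirst : ∀ z, bl l z = bl l y₀ → y₀ ≤ z)
    (hy₀ : y₀ ≠ ctr r) (hb : b ≠ ctr r) (hlt : y₀ < b) (hbl : bl l b = bl l y₀) :
    ∃ (a : Fin (2 * r + 1)) (i : Fin r), y₀ ≤ a ∧ a < b ∧ a ≠ ctr r ∧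
      bl l (pt i) = bl l (pt' i) ∧ (∀ t, gact i (chainFun y₀ t a) = chainFun y₀ t b) ∧
      (∀ t w, cnt y₀ t b w = cnt y₀ t (a + 1) w) := by
  have hb2 := b.2
  have hy2 := y₀.2
  have hrb := hfirst b.rev
  rw [bl_rev, hbl] at hrb
  have hbt : ∀ z, y₀ ≤ z → z ≤ b → bl l z = bl l y₀ := fun z h1 h2 =>
    le_antisymm (hbl ▸ bl_mono l h2) (bl_mono l h1)
  have hmid : (y₀ : ℕ) < r → r < (b : ℕ) → (y₀ : ℕ) + b ≤ 2 * r := by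
    intro h1 h2
    have h3 := hbt (ctr r) (by simp [Fin.le_def, ctr]; omega) (by simp [Fin.le_def, ctr]; omega)
    have h4 := hrb (by rw [← h3, bl_ctr, rev_eq_self_iff])
    rw [Fin.le_def, Fin.val_rev] at h4
    omega
  rw [Ne, Fin.ext_iff] at hb hy₀
  simp only [ctr] at hb hy₀
  rw [Fin.lt_def] at hlt
  rcases lt_or_ge (b : ℕ) r with hbr | hbr
  · -- both points are in the first half
    refine ⟨⟨b - 1, by omega⟩, ⟨b - 1, by omega⟩, by simp only [Fin.le_def]; omega,
      by simp only [Fin.lt_def]; omega, by simp only [Ne, Fin.ext_iff, ctr]; omega, ?_, ?_, ?_⟩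
    · have e1 : pt' (r := r) ⟨b - 1, by omega⟩ = b := by
        apply Fin.ext; simp only [pt']; omega
      rw [e1, hbl]
      exact hbt _ (by simp only [Fin.le_def, pt]; omega) (by simp only [Fin.le_def, pt]; omega)
    · intro t
      have e1 : pt' (r := r) ⟨b - 1, by omega⟩ = b := by
        apply Fin.ext; simp only [pt']; omega
      apply gact_chainFun
      · apply Fin.ext; rw [val_sPerm_of_lt (by simp only; omega), if_pos rfl]; simp only; omega
      · intro w; unfold Asc; rw [e1]; rfl
      · simp only [Fin.le_def]; omega
      · simp only [Ne, Fin.ext_iff, ctr]; omega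
      · intro t w; congr 1; simp only; omega
      · intro z h1 h2
        rw [Fin.lt_def] at h2
        simp only at h2
        rw [sPerm_of_far (by omega) (by simp only; omega) (by simp only; omega)]
        exact ⟨h1, h2⟩
    · intro t w; congr 1; simp only; omega
  rcases eq_or_lt_of_le (Nat.succ_le_of_lt (lt_of_le_of_ne hbr (Ne.symm hb))) with hbr1 | hbr1
  · -- the step across the centre
    have hbr2 : (b : ℕ) = r + 1 := hbr1.symm
    have hm := hmid (by omega) (by omega)
    refine ⟨⟨r - 1, by omega⟩, ⟨r - 1, by omega⟩, by simp only [Fin.le_def]; omega,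
      by simp only [Fin.lt_def]; omega, by simp only [Ne, Fin.ext_iff, ctr]; omega, ?_, ?_, ?_⟩
    · rw [hbt _ (by simp only [Fin.le_def, pt]; omega) (by simp only [Fin.le_def, pt]; omega)]
      exact (hbt _ (by simp only [Fin.le_def, pt']; omega)
        (by simp only [Fin.le_def, pt']; omega)).symm
    · intro t
      have e1 : b = (pt (r := r) ⟨r - 1, by omega⟩).rev := by
        apply Fin.ext; simp only [pt, Fin.val_rev]; omega
      apply gact_chainFun
      · apply Fin.ext; rw [val_sPerm_last (by simp only; omega), if_pos rfl]; simp only; omega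
      · intro w
        unfold Asc
        rw [pt'_eq_ctr (by simp only; omega), pre_ctr, congrArg (pre w) e1, Fin.lt_def, Fin.lt_def,
          val_pre_rev]
        have e3 : (⟨r - 1, by omega⟩ : Fin (2 * r + 1)) = pt (r := r) ⟨r - 1, by omega⟩ := rfl
        rw [e3]
        simp only [ctr]
        omega
      · simp only [Fin.le_def]; omega
      · simp only [Ne, Fin.ext_iff, ctr]; omega
      · intro t w; rw [hbr2, cnt_ctr_succ]; congr 1; simp only; omega
      · intro z h1 h2
        rw [Fin.lt_def] at h2
        simp only at h2
        rw [sPerm_of_far (by omega) (by simp only; omega) (by simp only; omega)]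
        exact ⟨h1, h2⟩
    · intro t w; rw [hbr2, cnt_ctr_succ]; congr 1; simp only; omega
  · -- both points are in the second half
    have hbr2 : r + 1 < (b : ℕ) := hbr1
    have e1 : (pt (r := r) ⟨2 * r - b, by omega⟩).rev = b := by
      apply Fin.ext; simp only [pt, Fin.val_rev]; omega
    have e2 : (pt' (r := r) ⟨2 * r - b, by omega⟩).rev = ⟨b - 1, by omega⟩ := by
      apply Fin.ext; simp only [pt', Fin.val_rev]; omega
    refine ⟨⟨b - 1, by omega⟩, ⟨2 * r - b, by omega⟩, by simp only [Fin.le_def]; omega,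
      by simp only [Fin.lt_def]; omega, by simp only [Ne, Fin.ext_iff, ctr]; omega, ?_, ?_, ?_⟩
    · rw [← Fin.rev_inj, ← bl_rev, ← bl_rev, e1, e2, hbl]
      exact (hbt _ (by simp only [Fin.le_def]; omega) (by simp only [Fin.le_def]; omega)).symm
    · intro t
      apply gact_chainFun
      · apply Fin.ext
        rw [val_sPerm_of_lt (by simp only; omega)]
        simp only
        split_ifs <;> omega
      · intro w
        unfold Asc
        rw [← Fin.rev_lt_rev, ← pre_rev, ← pre_rev, e1, e2]
      · simp only [Fin.le_def]; omega
      · simp only [Ne, Fin.ext_iff, ctr]; omega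
      · intro t w; congr 1; simp only; omega
      · intro z h1 h2
        rw [Fin.lt_def] at h2 ⊢
        rw [Fin.le_def] at h1 ⊢
        simp only at h2
        rw [val_sPerm_of_lt (by simp only; omega)]
        simp only
        rcases lt_or_gt_of_ne hy₀ with hyr | hyr
        · have := hmid hyr (by omega)
          split_ifs <;> omega
        · split_ifs <;> omega
    · intro t w; congr 1; simp only; omega

/-- Here `g` is the product of the generators along the chain of points from `y₀` to `b`, and `h` is
the sum of all such products up to a point between `y₀` and `b`, that is, the sum over minimal coset
representatives. Applied to the indicator of `pre w y₀ < t`, the element `h` counts the points of the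
chain that satisfy this condition, by a quantum integer. -/
lemma exists_chain {l : Comp n r} {y₀ : Fin (2 * r + 1)} (hfirst : ∀ z, bl l z = bl l y₀ → y₀ ≤ z)
    (hy₀ : y₀ ≠ ctr r) (b : Fin (2 * r + 1)) (hyb : y₀ ≤ b) (hb : b ≠ ctr r)
    (hbl : bl l b = bl l y₀) :
    ∃ g h : Hecke r, ∀ X : W r → Prop,
      (∀ i, bl l (pt i) = bl l (pt' i) → ∀ w, X (s r i * w) ↔ X w) → ∀ t,
      g * comb (mask X fun w => if (pre w y₀ : ℕ) < t then 1 else 0) =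
        comb (mask X (chainFun y₀ t b)) ∧
      h * comb (mask X fun w => if (pre w y₀ : ℕ) < t then 1 else 0) =
        comb (mask X fun w => qint (cnt y₀ t (b + 1) w)) := by
  induction hk : (b : ℕ) using Nat.strong_induction_on generalizing b with
  | _ k ih =>
    rcases eq_or_lt_of_le hyb with rfl | hlt
    · refine ⟨1, 1, fun X _ t => ⟨?_, ?_⟩⟩
      · rw [one_mul]
        congr 2
        funext w
        unfold chainFun
        rw [cnt_self]
        simp [v_zero]
      · rw [one_mul]
        congr 2
        funext w
        rw [← hk, cnt_succ le_rfl hb, cnt_self]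
        split_ifs <;> simp [qint, v_zero]
    · obtain ⟨a, i, h1, h2, h3, h4, h5, h6⟩ := exists_step hfirst hy₀ hb hlt hbl
      have hbla : bl l a = bl l y₀ := le_antisymm (hbl ▸ bl_mono l h2.le) (bl_mono l h1)
      obtain ⟨g, h, hgh⟩ := ih a (hk ▸ h2) a h1 h3 hbla rfl
      refine ⟨Tgen r i * g, h + Tgen r i * g, fun X hX t => ?_⟩
      obtain ⟨hg, hh⟩ := hgh X hX t
      have hg' : Tgen r i * g * comb (mask X fun w => if (pre w y₀ : ℕ) < t then 1 else 0) =
        comb (mask X (chainFun y₀ t b)) := by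
        rw [mul_assoc, hg, Tgen_mul_comb, gact_mask (hX i h4), h5]
      refine ⟨hg', ?_⟩
      rw [add_mul, hg', hh]
      unfold comb
      rw [← Finset.sum_add_distrib]
      apply Finset.sum_congr rfl
      intro w _
      rw [← add_smul]
      congr 1
      unfold mask chainFun
      beta_reduce
      rw [← hk, cnt_succ hyb hb, ← h6]
      by_cases hXw : X w
      · simp only [if_pos hXw]
        split_ifs
        · rw [qint_succ]
        · rw [add_zero, add_zero]
      · simp only [if_neg hXw, add_zero]

/-! ### Moving a point to the next block -/

/-- `Shift l l' i i'`: the tuple of `l'` arises from that of `l` by moving a point from the block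
`i` to the next block `i'`, and its mirror image from `i.rev` to `i'.rev`. -/
structure Shift (l l' : Comp n r) (i i' : Fin (2 * n + 1)) : Prop where
  succ : (i' : ℕ) = i + 1
  tilde_add : ∀ k, tilde n l.1 k + ((if k = i' then 1 else 0) + (if k = i'.rev then 1 else 0)) =
    tilde n l'.1 k + ((if k = i then 1 else 0) + (if k = i.rev then 1 else 0))

lemma Shift.psum_add {l l' : Comp n r} {i i' : Fin (2 * n + 1)} (h : Shift l l' i i') (t : ℕ) :
    psum n l.1 t + ((if (i' : ℕ) < t then 1 else 0) + (if (i'.rev : ℕ) < t then 1 else 0)) =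
    psum n l'.1 t + ((if (i : ℕ) < t then 1 else 0) + (if (i.rev : ℕ) < t then 1 else 0)) := by
  have key : ∀ j : Fin (2 * n + 1), (∑ k ∈ Finset.univ.filter fun k : Fin (2 * n + 1) => (k : ℕ) < t,
      if k = j then 1 else 0) = if (j : ℕ) < t then 1 else 0 := by
    intro j
    rw [Finset.sum_ite_eq']
    simp
  unfold psum
  rw [← key i', ← key i'.rev, ← key i, ← key i.rev, ← Finset.sum_add_distrib,
    ← Finset.sum_add_distrib, ← Finset.sum_add_distrib, ← Finset.sum_add_distrib]
  exact Finset.sum_congr rfl fun k _ => h.tilde_add k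

/-- The point `y₀` that changes its block is the last one of block `i` for `l` and the first one of
block `i'` for `l'`. -/
lemma Shift.exists_point {l l' : Comp n r} {i i' : Fin (2 * n + 1)} (h : Shift l l' i i') :
    ∃ y₀ : Fin (2 * r + 1), bl l y₀ = i ∧ bl l' y₀ = i' ∧ (∀ z, bl l' z = i' → y₀ ≤ z) ∧
      ∀ y, y ≠ y₀ → y ≠ y₀.rev → bl l y = bl l' y := by
  have hs := h.succ
  have hi := i.2
  have hi' := i'.2
  have e1 := h.psum_add (i + 1)
  have e2 := psum_succ l.1 i
  have e3 := psum_succ l'.1 i'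
  have e4 := h.tilde_add i
  have e5 := h.tilde_add i'
  have e6 : psum n l.1 (i + 1) ≤ 2 * r + 1 := by
    rw [← psum_top l]; exact psum_mono l.1 (by omega)
  simp only [Fin.ext_iff, Fin.val_rev] at e1 e4 e5
  have e8 : psum n l.1 (i + 1) = psum n l'.1 (i + 1) + 1 := by
    clear e2 e3 e4 e5
    split_ifs at e1 <;> omega
  have e9 : 1 ≤ tilde n l.1 i := by
    clear e1 e2 e3 e5 e8
    split_ifs at e4 <;> omega
  have e10 : 1 ≤ tilde n l'.1 i' := by
    clear e1 e2 e3 e4 e8 e9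
    split_ifs at e5 <;> omega
  clear e1 e4 e5
  have hy : psum n l'.1 (i + 1) < 2 * r + 1 := by omega
  refine ⟨⟨psum n l'.1 (i + 1), hy⟩, ?_, ?_, ?_, ?_⟩
  · rw [← mem_block_iff, mem_block]
    simp only
    omega
  · rw [← mem_block_iff, mem_block]
    simp only
    rw [e3, hs]
    omega
  · intro z hz
    rw [← mem_block_iff, mem_block, hs] at hz
    exact hz.1
  · intro y h1 h2
    simp only [Ne, Fin.ext_iff, Fin.val_rev] at h1 h2
    have key : ∀ t : ℕ, t ≤ 2 * n + 1 → ((y : ℕ) < psum n l.1 t ↔ (y : ℕ) < psum n l'.1 t) := by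
      intro t ht
      have k1 := h.psum_add t
      simp only [Fin.val_rev] at k1
      by_cases t1 : t = i + 1
      · rw [t1, e8]; omega
      by_cases t2 : t = 2 * n + 1 - (i + 1)
      · have k2 := psum_rev l (t := t) ht
        have k3 := psum_rev l' (t := t) ht
        rw [show 2 * n + 1 - t = i + 1 by omega] at k2 k3
        omega
      · have k4 : (if (i' : ℕ) < t then 1 else 0) +
            (if 2 * n + 1 - ((i' : ℕ) + 1) < t then 1 else 0) =
            (if (i : ℕ) < t then 1 else 0) + (if 2 * n + 1 - ((i : ℕ) + 1) < t then 1 else 0) := by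
          split_ifs <;> omega
        omega
    apply le_antisymm
    · have := (key (bl l' y + 1) (by omega)).2 ((bl_lt_iff l' y _).1 (Nat.lt_succ_self _))
      rw [← bl_lt_iff] at this
      exact Nat.lt_succ_iff.1 this
    · have := (key (bl l y + 1) (by omega)).1 ((bl_lt_iff l y _).1 (Nat.lt_succ_self _))
      rw [← bl_lt_iff] at this
      exact Nat.lt_succ_iff.1 this

lemma Eth_apply (i j a b : Fin (2 * n + 1)) :
    Eth n i j a b = (if i = a ∧ j = b then 1 else 0) +
      (if i.rev = a ∧ j.rev = b then 1 else 0) := by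
  unfold Eth
  rw [Matrix.add_apply, Matrix.single_apply, Matrix.single_apply]

lemma Shift.cosetMatrix_add {l l' : Comp n r} {i i' : Fin (2 * n + 1)} (h : Shift l l' i i')
    {y₀ : Fin (2 * r + 1)} (h1 : bl l y₀ = i) (h2 : bl l' y₀ = i')
    (h3 : ∀ y, y ≠ y₀ → y ≠ y₀.rev → bl l y = bl l' y) (m : Comp n r) (w : W r) :
    cosetMatrix n r l' w m + Eth n i (bl m (pre w y₀)) =
      cosetMatrix n r l w m + Eth n i' (bl m (pre w y₀)) := by
  have hne : y₀ ≠ y₀.rev := by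
    intro heq
    have := (rev_eq_self_iff y₀).1 heq.symm
    rw [this, bl_ctr] at h1 h2
    have hs := h.succ
    rw [← h1, ← h2] at hs
    omega
  ext a b
  rw [Matrix.add_apply, Matrix.add_apply, Eth_apply, Eth_apply, cosetMatrix_apply,
    cosetMatrix_apply, Finset.card_filter, Finset.card_filter,
    ← Finset.add_sum_erase _ _ (Finset.mem_univ y₀),
    ← Finset.add_sum_erase (Finset.univ.erase y₀) _
      (Finset.mem_erase.2 ⟨hne.symm, Finset.mem_univ y₀.rev⟩),
    ← Finset.add_sum_erase _ (fun y => if bl l y = a ∧ bl m (pre w y) = b then 1 else 0)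
      (Finset.mem_univ y₀),
    ← Finset.add_sum_erase (Finset.univ.erase y₀)
      (fun y => if bl l y = a ∧ bl m (pre w y) = b then 1 else 0)
      (Finset.mem_erase.2 ⟨hne.symm, Finset.mem_univ y₀.rev⟩)]
  have hsum : ∑ y ∈ (Finset.univ.erase y₀).erase y₀.rev,
      (if bl l' y = a ∧ bl m (pre w y) = b then 1 else 0) =
      ∑ y ∈ (Finset.univ.erase y₀).erase y₀.rev,
      (if bl l y = a ∧ bl m (pre w y) = b then 1 else 0) := by
    apply Finset.sum_congr rfl
    intro y hy
    rw [Finset.mem_erase, Finset.mem_erase] at hy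
    rw [h3 y hy.2.1 hy.1]
  rw [hsum]
  simp only [pre_rev, bl_rev, h1, h2]
  ring

/-- The matrix obtained from `A` by moving an entry one from position `(i, p)` to `(i', p)`, and
its mirror image. -/
def moved (A : Mat n) (i i' p : Fin (2 * n + 1)) : Mat n := A - Eth n i p + Eth n i' p

/-- The condition that the entry one can be taken from position `(i, p)` and its mirror image. -/
def Movable (A : Mat n) (i p : Fin (2 * n + 1)) : Prop := ∀ a b, Eth n i p a b ≤ A a b

instance (A : Mat n) (i p : Fin (2 * n + 1)) : Decidable (Movable A i p) := Classical.dec _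

lemma moved_add {A : Mat n} {i i' p : Fin (2 * n + 1)} (h : Movable A i p) :
    moved A i i' p + Eth n i p = A + Eth n i' p := by
  ext a b
  have := h a b
  simp only [moved, Matrix.add_apply, Matrix.sub_apply]
  omega

/-- The double coset with matrix `A` is the disjoint union, over the letter `p` at the point `y₀`, of
parts of the double cosets with matrix `moved A i i' p`. -/
lemma Shift.cosetMatrix_eq_iff {l l' : Comp n r} {i i' : Fin (2 * n + 1)} (h : Shift l l' i i')
    {y₀ : Fin (2 * r + 1)} (h1 : bl l y₀ = i) (h2 : bl l' y₀ = i')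
    (h3 : ∀ y, y ≠ y₀ → y ≠ y₀.rev → bl l y = bl l' y) (m : Comp n r) (w : W r) (A : Mat n) :
    cosetMatrix n r l w m = A ↔ Movable A i (bl m (pre w y₀)) ∧
      cosetMatrix n r l' w m = moved A i i' (bl m (pre w y₀)) := by
  have hadd := h.cosetMatrix_add h1 h2 h3 m w
  have hs := h.succ
  have hle : Movable (cosetMatrix n r l w m) i (bl m (pre w y₀)) := by
    intro a b
    have hab := congrFun (congrFun hadd a) b
    rw [Matrix.add_apply, Matrix.add_apply] at hab
    have hzero : a = i ∨ a = i.rev → Eth n i' (bl m (pre w y₀)) a b = 0 := by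
      intro ha
      rw [Eth_apply, if_neg, if_neg]
      · rintro ⟨h5, -⟩
        rw [Fin.ext_iff, Fin.val_rev] at h5
        rcases ha with rfl | rfl
        · omega
        · rw [Fin.val_rev] at h5; omega
      · rintro ⟨h5, -⟩
        rw [Fin.ext_iff] at h5
        rcases ha with rfl | rfl
        · omega
        · rw [Fin.val_rev] at h5; omega
    by_cases ha : a = i ∨ a = i.rev
    · rw [hzero ha] at hab
      omega
    · push Not at ha
      rw [Eth_apply, if_neg (fun h => ha.1 h.1.symm), if_neg (fun h => ha.2 h.1.symm)]
      exact Nat.zero_le _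
  constructor
  · rintro rfl
    refine ⟨hle, ?_⟩
    rw [← moved_add (i' := i') hle] at hadd
    exact add_right_cancel hadd
  · rintro ⟨h4, h5⟩
    rw [h5, moved_add h4] at hadd
    exact (add_right_cancel hadd).symm

lemma moved_row {A : Mat n} {i i' p : Fin (2 * n + 1)} (hs : (i' : ℕ) = i + 1) (h : Movable A i p)
    (j : Fin (2 * n + 1)) : moved A i i' p i' j =
      A i' j + (if j = p then 1 else 0) + if i' = ctr n ∧ j = p.rev then 1 else 0 := by
  have h1 := congrFun (congrFun (moved_add (i' := i') h) i') j
  rw [Matrix.add_apply, Matrix.add_apply, Eth_apply, Eth_apply, if_neg, if_neg] at h1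
  · rw [add_zero, add_zero] at h1
    have h2 : (i'.rev = i' ∧ p.rev = j) ↔ (i' = ctr n ∧ j = p.rev) :=
      and_congr (rev_eq_self_iff i') eq_comm
    have h3 : (i' = i' ∧ p = j) ↔ j = p := by rw [eq_comm (a := p)]; simp
    rw [h1, ← add_assoc, if_congr h2 rfl rfl, if_congr h3 rfl rfl]
  · rintro ⟨h5, -⟩
    rw [Fin.ext_iff, Fin.val_rev] at h5
    omega
  · rintro ⟨h5, -⟩
    rw [Fin.ext_iff] at h5
    omega

/-- The number of non-central points of the block `i'` with a letter before `t`, in terms of the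
matrix of `w`. -/
lemma card_block_lt (l' m : Comp n r) (w : W r) (i' : Fin (2 * n + 1)) (t : ℕ) :
    (Finset.univ.filter fun z : Fin (2 * r + 1) =>
      (bl l' z = i' ∧ z ≠ ctr r) ∧ (bl m (pre w z) : ℕ) < t).card +
      (if i' = ctr n ∧ n < t then 1 else 0) =
    ∑ j ∈ Finset.univ.filter fun j : Fin (2 * n + 1) => (j : ℕ) < t,
      cosetMatrix n r l' w m i' j := by
  have h1 : ∑ j ∈ Finset.univ.filter fun j : Fin (2 * n + 1) => (j : ℕ) < t,
      cosetMatrix n r l' w m i' j = (Finset.univ.filter fun z : Fin (2 * r + 1) =>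
        bl l' z = i' ∧ (bl m (pre w z) : ℕ) < t).card := by
    rw [Finset.card_eq_sum_card_fiberwise (f := fun y => bl m (pre w y))
      (t := Finset.univ.filter fun j : Fin (2 * n + 1) => (j : ℕ) < t)
      (by intro z hz; simpa using (Finset.mem_filter.1 hz).2.2)]
    apply Finset.sum_congr rfl
    intro j hj
    rw [cosetMatrix_apply, Finset.filter_filter]
    congr 1
    ext z
    simp only [Finset.mem_filter, Finset.mem_univ, true_and] at hj ⊢
    constructor
    · rintro ⟨h1, h2⟩
      exact ⟨⟨h1, h2 ▸ hj⟩, h2⟩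
    · rintro ⟨⟨h1, -⟩, h2⟩
      exact ⟨h1, h2⟩
  rw [h1]
  have hc : (bl l' (ctr r) = i' ∧ (bl m (pre w (ctr r)) : ℕ) < t) ↔ (i' = ctr n ∧ n < t) := by
    rw [pre_ctr, bl_ctr, bl_ctr]
    exact and_congr_left fun _ => eq_comm
  classical
  split_ifs with h
  · rw [← Finset.card_insert_of_notMem (a := ctr r) (by simp)]
    congr 1
    ext z
    simp only [Finset.mem_filter, Finset.mem_univ, true_and, Finset.mem_insert]
    constructor
    · rintro (rfl | h2)
      · exact hc.2 h
      · exact ⟨h2.1.1, h2.2⟩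
    · intro h2
      by_cases hz : z = ctr r
      · exact Or.inl hz
      · exact Or.inr ⟨⟨h2.1, hz⟩, h2.2⟩
  · rw [add_zero]
    congr 1
    ext z
    simp only [Finset.mem_filter, Finset.mem_univ, true_and]
    constructor
    · intro h2
      exact ⟨h2.1.1, h2.2⟩
    · intro h2
      refine ⟨⟨h2.1, ?_⟩, h2.2⟩
      rintro rfl
      exact h (hc.1 h2)

lemma sum_lt_succ (f : Fin (2 * n + 1) → ℕ) (p : Fin (2 * n + 1)) :
    ∑ j ∈ Finset.univ.filter fun j : Fin (2 * n + 1) => (j : ℕ) < p + 1, f j =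
      ∑ j with j < p, f j + f p := by
  have : (Finset.univ.filter fun j : Fin (2 * n + 1) => (j : ℕ) < p + 1) =
      insert p (Finset.univ.filter fun j : Fin (2 * n + 1) => j < p) := by
    ext k
    simp only [Finset.mem_filter, Finset.mem_univ, true_and, Finset.mem_insert, Fin.ext_iff,
      Fin.lt_def]
    omega
  rw [this, Finset.sum_insert (by simp), add_comm]

/-- One element `c`, which depends only on `l` and `l'`, describes the move of a point from block `i`
to block `i'` for all double coset sums. For the diagonal matrix `A` of `l` the formula says that
`c * x n r l` is itself a double coset sum; this is how `c` is related to a standard basis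
element. -/
theorem Shift.exists_mul_Y {l l' : Comp n r} {i i' : Fin (2 * n + 1)} (h : Shift l l' i i') :
    ∃ c : Hecke r, ∀ (m : Comp n r) (A : Mat n), c * Y l A m =
      ∑ p with Movable A i p,
        (v (2 * ∑ j with j < p, (A i' j : ℤ)) * qint (A i' p + 1)) • Y l' (moved A i i' p) m := by
  classical
  obtain ⟨y₀, h1, h2, hfirst, h3⟩ := h.exists_point
  have hs := h.succ
  rw [← h2] at hfirst
  have hy₀ : y₀ ≠ ctr r := by
    rintro rfl
    rw [bl_ctr] at h1 h2
    rw [← h1, ← h2] at hs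
    omega
  -- the last point of the block
  obtain ⟨b, hb, hbmax⟩ := Finset.exists_max_image
    (Finset.univ.filter fun z => bl l' z = i') id ⟨y₀, by simp [h2]⟩
  simp only [Finset.mem_filter, Finset.mem_univ, true_and, id] at hb hbmax
  have hbc : b ≠ ctr r := by
    rintro rfl
    have h4 := hfirst (ctr r) (by rw [hb, h2])
    have h5 := hbmax y₀.rev (by rw [bl_rev, h2, ← hb, bl_ctr, rev_eq_self_iff])
    apply hy₀
    apply le_antisymm h4
    rw [← Fin.rev_le_rev]
    rwa [(rev_eq_self_iff _).2 rfl]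
  have hyb : y₀ ≤ b := hfirst b (by rw [hb, h2])
  obtain ⟨_, c, hc'⟩ := exists_chain hfirst hy₀ b hyb hbc (by rw [hb, h2])
  have hc := fun X hX t => (hc' X hX t).2
  refine ⟨c, fun m A => ?_⟩
  let X : Fin (2 * n + 1) → W r → Prop := fun p w => cosetMatrix n r l' w m = moved A i i' p
  have hX : ∀ p i, bl l' (pt i) = bl l' (pt' i) → ∀ w, X p (s r i * w) ↔ X p w := by
    intro p k hk w
    simp only [X]
    rw [cosetMatrix_mul_left]
    intro y
    rw [pre_s, bl_sPerm hk]
  let F : Fin (2 * n + 1) → ℕ → Hecke r := fun p t =>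
    comb (mask (X p) fun w => if (pre w y₀ : ℕ) < t then 1 else 0)
  -- the decomposition of the double coset sum by the letter at the moved point
  have hdec : Y l A m = ∑ p with Movable A i p, (F p (psum n m.1 (p + 1)) - F p (psum n m.1 p)) := by
    simp only [F]
    rw [Y_eq_comb]
    unfold comb
    simp only [← Finset.sum_sub_distrib, ← sub_smul]
    rw [Finset.sum_comm]
    apply Finset.sum_congr rfl
    intro w _
    rw [← Finset.sum_smul]
    congr 1
    have hterm : ∀ p, (mask (X p) (fun w => if (pre w y₀ : ℕ) < psum n m.1 (p + 1) then 1 else 0) w -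
        mask (X p) (fun w => if (pre w y₀ : ℕ) < psum n m.1 p then 1 else 0) w) =
        if p = bl m (pre w y₀) then (if X p w then (1 : Z) else 0) else 0 := by
      intro p
      unfold mask
      simp only [← bl_lt_iff, Fin.ext_iff]
      by_cases hXp : X p w
      · simp only [if_pos hXp]
        split_ifs <;> first | omega | simp
      · simp [hXp]
    simp only [hterm]
    rw [Finset.sum_ite_eq']
    simp only [Finset.mem_filter, Finset.mem_univ, true_and]
    rw [if_congr (h.cosetMatrix_eq_iff h1 h2 h3 m w A) rfl rfl, ite_and]
  rw [hdec, Finset.mul_sum]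
  apply Finset.sum_congr rfl
  intro p hp
  rw [Finset.mem_filter] at hp
  simp only [F]
  have hc1 := hc (X p) (hX p) (psum n m.1 (p + 1))
  have hc2 := hc (X p) (hX p) (psum n m.1 p)
  rw [mul_sub, hc1, hc2, Y_eq_comb]
  unfold comb
  rw [← Finset.sum_sub_distrib, Finset.smul_sum]
  apply Finset.sum_congr rfl
  intro w _
  rw [← sub_smul, smul_smul]
  congr 1
  unfold mask
  by_cases hXp : X p w
  · have hXp' : cosetMatrix n r l' w m = moved A i i' p := hXp
    rw [if_pos hXp, if_pos hXp]
    beta_reduce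
    rw [if_pos hXp', mul_one]
    -- the counts are sums of entries in the row `i'` of `A`
    have hcnt : ∀ t : ℕ, cnt y₀ (psum n m.1 t) (b + 1) w +
        (if i' = ctr n ∧ n < t then 1 else 0) =
        ∑ j ∈ Finset.univ.filter fun j : Fin (2 * n + 1) => (j : ℕ) < t, moved A i i' p i' j := by
      intro t
      rw [← hXp', ← card_block_lt]
      congr 1
      unfold cnt
      congr 1
      ext z
      simp only [Finset.mem_filter, Finset.mem_univ, true_and, bl_lt_iff]
      apply and_congr_left
      intro _
      constructor
      · rintro ⟨h4, h5, h6⟩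
        refine ⟨le_antisymm ?_ ?_, h6⟩
        · rw [← hb]; exact bl_mono l' (Nat.lt_succ_iff.1 h5)
        · rw [← h2]; exact bl_mono l' h4
      · rintro ⟨h4, h5⟩
        exact ⟨hfirst z (by rw [h4, h2]), Nat.lt_succ_iff.2 (hbmax z h4), h5⟩
    simp only [moved_row hs hp.2] at hcnt
    have hc1 := hcnt p
    have hc2 := hcnt (p + 1)
    rw [sum_lt_succ] at hc2
    have hlt : (Finset.univ.filter fun j : Fin (2 * n + 1) => (j : ℕ) < p) =
      Finset.univ.filter fun j : Fin (2 * n + 1) => j < p := rfl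
    have hsum : ∑ j with j < p, (A i' j + (if j = p then 1 else 0) +
        if i' = ctr n ∧ j = p.rev then 1 else 0) =
        ∑ j with j < p, A i' j + if i' = ctr n ∧ n < (p : ℕ) then 1 else 0 := by
      rw [Finset.sum_add_distrib, Finset.sum_add_distrib, Finset.sum_ite_eq' _ p]
      rw [if_neg (by simp), add_zero]
      congr 1
      by_cases hin : i' = ctr n
      · simp only [hin, true_and]
        rw [Finset.sum_ite_eq']
        have hp2 := p.2
        simp only [Finset.mem_filter, Finset.mem_univ, true_and, Fin.lt_def, Fin.val_rev]
        congr 1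
        rw [eq_iff_iff]
        omega
      · simp [hin]
    rw [hlt, hsum] at hc1
    rw [hsum, if_pos rfl] at hc2
    have hpe : (if i' = ctr n ∧ n < (p : ℕ) + 1 then 1 else 0) =
        (if i' = ctr n ∧ n < (p : ℕ) then 1 else 0) +
          if i' = ctr n ∧ p = p.rev then 1 else 0 := by
      have hp2 := p.2
      simp only [Fin.ext_iff (a := p), Fin.val_rev]
      split_ifs <;> omega
    have hA : cnt y₀ (psum n m.1 p) (b + 1) w = ∑ j with j < p, A i' j := by omega
    have hB : cnt y₀ (psum n m.1 (p + 1)) (b + 1) w =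
        ∑ j with j < p, A i' j + (A i' p + 1) := by omega
    rw [hA, hB, qint_add, add_sub_cancel_left]
    push_cast
    rfl
  · have hXp' : ¬cosetMatrix n r l' w m = moved A i i' p := hXp
    rw [if_neg hXp, if_neg hXp]
    beta_reduce
    rw [if_neg hXp', mul_zero, sub_zero]

/-! ### Products with the generators -/

/-- The index of the part of a composition that determines the entry `i` of the symmetric tuple. -/
def fold (i : Fin (2 * n + 1)) : Fin (n + 1) := ⟨min i (2 * n - i), by omega⟩

lemma tilde_eq (l : Fin (n + 1) → ℕ) (i : Fin (2 * n + 1)) :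
    tilde n l i = l (fold i) + if i = ctr n then l (fold i) + 1 else 0 := by
  have hi := i.2
  unfold tilde fold
  by_cases h : i = ctr n
  · subst h
    have hl : (⟨min (ctr n : ℕ) (2 * n - (ctr n : ℕ)), by omega⟩ : Fin (n + 1)) = Fin.last n := by
      ext
      simp only [ctr, Fin.val_last]
      omega
    rw [hl, if_pos rfl, dif_neg (by simp [ctr]), if_pos (by simp [ctr])]
    ring
  · have h' : (i : ℕ) ≠ n := fun h2 => h (Fin.ext h2)
    rw [if_neg h, add_zero]
    split_ifs with h1
    · congr 1; ext; simp only; omega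
    · congr 1; ext; simp only; omega

lemma fold_eq_iff (i k : Fin (2 * n + 1)) : fold k = fold i ↔ k = i ∨ k = i.rev := by
  have hi := i.2
  have hk := k.2
  simp only [fold, Fin.ext_iff, Fin.val_rev]
  omega

lemma tilde_add_single (l : Fin (n + 1) → ℕ) (i k : Fin (2 * n + 1)) :
    tilde n (l + Pi.single (fold i) 1) k =
      tilde n l k + ((if k = i then 1 else 0) + (if k = i.rev then 1 else 0)) := by
  rw [tilde_eq, tilde_eq, Pi.add_apply, Pi.single_apply, if_congr (fold_eq_iff i k) rfl rfl]
  have hc : i.rev = i ↔ i = ctr n := rev_eq_self_iff i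
  by_cases h1 : k = i
  · subst h1
    have hc' : k = k.rev ↔ k = ctr n := eq_comm.trans hc
    rw [if_congr hc' rfl rfl]
    by_cases h2 : k = ctr n
    · simp only [h2, if_true, true_or]; ring
    · simp [h2]
  · by_cases h2 : k = i.rev
    · have h3 : k ≠ ctr n := by
        rintro rfl
        have h4 : (ctr n).rev = ctr n := (rev_eq_self_iff _).2 rfl
        rw [h2, Fin.rev_rev] at h4
        exact h1 (h2.trans h4.symm)
      rw [if_pos (Or.inr h2), if_neg h1, if_pos h2, if_neg h3, if_neg h3]
    · simp [h1, h2]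

lemma tilde_injective {l m : Fin (n + 1) → ℕ} (h : tilde n l = tilde n m) : l = m := by
  funext a
  have ha : fold (⟨a, by omega⟩ : Fin (2 * n + 1)) = a := by
    ext; simp only [fold]; omega
  have h1 := congrFun h ⟨a, by omega⟩
  rw [tilde_eq, tilde_eq, ha] at h1
  split_ifs at h1 <;> omega

lemma sum_add_single (l : Fin (n + 1) → ℕ) (a : Fin (n + 1)) :
    ∑ i, (l + Pi.single a 1 : Fin (n + 1) → ℕ) i = ∑ i, l i + 1 := by
  simp only [Pi.add_apply, Finset.sum_add_distrib, Finset.sum_pi_single', Finset.mem_univ, if_true]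

/-- A sum over the compositions with positive part `a` is a sum over the compositions of the
preceding number. -/
lemma sum_antidiagonalTuple_pos {M : Type*} [AddCommMonoid M] (t : ℕ) (a : Fin (n + 1))
    (f : (Fin (n + 1) → ℕ) → M) :
    ∑ l ∈ Finset.Nat.antidiagonalTuple (n + 1) (t + 1) with 1 ≤ l a, f l =
      ∑ l ∈ Finset.Nat.antidiagonalTuple (n + 1) t, f (l + Pi.single a 1) := by
  symm
  apply Finset.sum_nbij' (fun l => l + Pi.single a 1) (fun l => l - Pi.single a 1)
  · intro l hl
    rw [Finset.Nat.mem_antidiagonalTuple] at hl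
    rw [Finset.mem_filter, Finset.Nat.mem_antidiagonalTuple, sum_add_single, hl]
    exact ⟨rfl, by simp⟩
  · intro l hl
    rw [Finset.mem_filter, Finset.Nat.mem_antidiagonalTuple] at hl
    rw [Finset.Nat.mem_antidiagonalTuple]
    have h1 : l - Pi.single a 1 + Pi.single a 1 = l := by
      funext k
      by_cases hk : k = a
      · subst hk; simp [hl.2]
      · simp [hk]
    have h2 := sum_add_single (l - Pi.single a 1) a
    rw [h1, hl.1] at h2
    omega
  · intro l _
    simp
  · intro l hl
    rw [Finset.mem_filter] at hl
    funext k
    by_cases hk : k = a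
    · subst hk; simp [hl.2]
    · simp [hk]
  · intro l _
    rfl

lemma size_add (A B : Mat n) : size n (A + B) = size n A + size n B := by
  simp only [size, Matrix.add_apply, Finset.sum_add_distrib]

lemma size_Eth (i j : Fin (2 * n + 1)) : size n (Eth n i j) = 2 := by
  unfold Eth
  rw [size_add]
  simp [size, Matrix.single_apply, ite_and]

lemma row_Eth_add_diagonal (i i' : Fin (2 * n + 1)) (l : Fin (n + 1) → ℕ) (k : Fin (2 * n + 1)) :
    ∑ j, (Eth n i' i + Matrix.diagonal (tilde n l)) k j =
      tilde n (l + Pi.single (fold i') 1) k := by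
  simp only [Matrix.add_apply, Eth_apply, Finset.sum_add_distrib, tilde_add_single, ite_and,
    Matrix.diagonal_apply, Finset.sum_ite_eq, Finset.mem_univ, if_true]
  simp only [Finset.sum_ite_irrel, Finset.sum_const_zero, Finset.sum_ite_eq, Finset.mem_univ,
    if_true, eq_comm (b := k)]
  ring

lemma col_Eth_add_diagonal (i i' : Fin (2 * n + 1)) (l : Fin (n + 1) → ℕ) (k : Fin (2 * n + 1)) :
    ∑ j, (Eth n i' i + Matrix.diagonal (tilde n l)) j k =
      tilde n (l + Pi.single (fold i) 1) k := by
  simp only [Matrix.add_apply, Eth_apply, Finset.sum_add_distrib, tilde_add_single, ite_and,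
    Matrix.diagonal_apply, Finset.sum_ite_eq, Finset.mem_univ, if_true, eq_comm (b := k)]
  ring

/-- A double coset sum vanishes unless the row and column sums of the matrix fit. -/
lemma Y_Eth_eq_zero {l k : Comp n r} {i i' : Fin (2 * n + 1)} {m : Fin (n + 1) → ℕ}
    (h : ¬(m + Pi.single (fold i') 1 = l.1 ∧ m + Pi.single (fold i) 1 = k.1)) :
    Y l (Eth n i' i + Matrix.diagonal (tilde n m)) k = 0 := by
  by_contra hY
  apply h
  constructor
  · apply tilde_injective
    funext a
    by_contra ha
    exact hY (Y_eq_zero_of_row (i := a) (by rwa [row_Eth_add_diagonal]))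
  · apply tilde_injective
    funext a
    by_contra ha
    exact hY (Y_eq_zero_of_col (j := a) (by rwa [col_Eth_add_diagonal]))

lemma moved_diagonal (m : Fin (n + 1) → ℕ) (i i' : Fin (2 * n + 1)) :
    Movable (Matrix.diagonal (tilde n (m + Pi.single (fold i) 1))) i i ∧
    moved (Matrix.diagonal (tilde n (m + Pi.single (fold i) 1))) i i' i =
      Eth n i' i + Matrix.diagonal (tilde n m) := by
  have hd : Matrix.diagonal (tilde n (m + Pi.single (fold i) 1)) =
      Matrix.diagonal (tilde n m) + Eth n i i := by
    ext a b
    rw [Matrix.add_apply, Eth_apply, Matrix.diagonal_apply, Matrix.diagonal_apply, tilde_add_single]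
    by_cases hab : a = b
    · subst hab
      simp [eq_comm (a := a)]
    · rw [if_neg hab, if_neg hab, if_neg (fun h : i = a ∧ i = b => hab (h.1.symm.trans h.2)),
        if_neg (fun h : i.rev = a ∧ i.rev = b => hab (h.1.symm.trans h.2)), add_zero, add_zero]
  constructor
  · intro a b
    rw [hd, Matrix.add_apply]
    omega
  · unfold moved
    rw [hd, add_comm (Eth n i' i)]
    congr 1
    ext a b
    simp

lemma Ajr_Eth (r : ℕ) (i i' : Fin (2 * n + 1)) : Ajr n (r + 1) (Eth n i' i) 0 =
    ∑ m ∈ Finset.Nat.antidiagonalTuple (n + 1) r,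
      v (-dr n (Eth n i' i + Matrix.diagonal (tilde n m))) •
        e n (r + 1) (Eth n i' i + Matrix.diagonal (tilde n m)) := by
  unfold Ajr
  rw [size_Eth, if_pos (by omega)]
  simp [br, dot, v_zero]

lemma Ajr_of_lt {A : Mat n} (h : 2 * r < size n A) (j : Fin (2 * n + 1) → ℤ) :
    Ajr n r A j = 0 := if_neg (by omega)

lemma ne_rev_of_succ {i i' : Fin (2 * n + 1)} (hs : (i' : ℕ) = i + 1) : i ≠ i'.rev := by
  intro h
  rw [Fin.ext_iff, Fin.val_rev] at h
  omega

lemma sum_moved_row {A : Mat n} {i i' p : Fin (2 * n + 1)} (hs : (i' : ℕ) = i + 1)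
    (h : Movable A i p) :
    ∑ j, moved A i i' p i' j = ∑ j, A i' j + 1 + if i' = ctr n then 1 else 0 := by
  simp only [moved_row hs h, Finset.sum_add_distrib, ite_and, Finset.sum_ite_irrel,
    Finset.sum_ite_eq', Finset.mem_univ, if_true, Finset.sum_const_zero]

/-- The multiplication formula for the standard basis elements. The matrix `C` is arbitrary: if it
belongs to no double coset, then both sides are zero. The factors `c m` on the left are the ones that
occur in `E^θ_{i',i}(0)`; for the summand that contributes, `tilde n m i'` is the row sum of `C`. -/
theorem sum_e_mul_e (c : (Fin (n + 1) → ℕ) → Z) {i i' : Fin (2 * n + 1)} (hs : (i' : ℕ) = i + 1)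
    (hc : ∀ m, c m = v (-tilde n m i')) (C : Mat n) :
    (∑ m ∈ Finset.Nat.antidiagonalTuple (n + 1) r,
      c m • e n (r + 1) (Eth n i' i + Matrix.diagonal (tilde n m))) * e n (r + 1) C =
    ∑ p with Movable C i p, (v (-∑ j, (C i' j : ℤ)) *
      (v (2 * ∑ j with j < p, (C i' j : ℤ)) * qint (C i' p + 1))) •
        e n (r + 1) (moved C i i' p) := by
  classical
  apply S_ext_coord
  intro l' m
  choose g hg using fun l : Comp n (r + 1) => exists_Y_eq_x_mul l C m
  rw [coord_mul_e _ hg, coord_sum_smul_e]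
  simp only [coord_sum_smul_e]
  by_cases hl : 1 ≤ l'.1 (fold i')
  · -- the only summand that contributes is the one with `ν` the tuple of `l'` without one point
    let ν : Fin (n + 1) → ℕ := l'.1 - Pi.single (fold i') 1
    have hν : ν + Pi.single (fold i') 1 = l'.1 := by
      funext a
      by_cases ha : a = fold i'
      · subst ha; simp [ν, hl]
      · simp [ν, ha]
    have hνr : ∑ a, ν a = r := by
      have h1 := sum_add_single ν (fold i')
      rw [hν, l'.2] at h1
      omega
    let k : Comp n (r + 1) := ⟨ν + Pi.single (fold i) 1, by rw [sum_add_single, hνr]⟩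
    have hshift : Shift k l' i i' := by
      refine ⟨hs, fun a => ?_⟩
      rw [← hν]
      simp only [k, tilde_add_single]
      ring
    obtain ⟨d, hd⟩ := hshift.exists_mul_Y
    have hdx : Y l' (Eth n i' i + Matrix.diagonal (tilde n ν)) k = d * x n (r + 1) k := by
      rw [← Y_diagonal, hd k, Finset.sum_eq_single i]
      · rw [(moved_diagonal ν i i').2, Matrix.diagonal_apply_ne _
          (by intro h; rw [Fin.ext_iff] at h; omega), Finset.sum_eq_zero]
        · simp [qint_succ, qint_zero, v_zero]
        · intro j hj
          rw [Finset.mem_filter] at hj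
          rw [Matrix.diagonal_apply_ne, Nat.cast_zero]
          intro h
          rw [Fin.ext_iff] at h
          have := Fin.lt_def.1 hj.2
          omega
      · intro p hp hpi
        exfalso
        rw [Finset.mem_filter] at hp
        have h1 := hp.2 i p
        rw [Matrix.diagonal_apply_ne _ (Ne.symm hpi), Eth_apply] at h1
        simp at h1
      · intro h
        exact absurd (Finset.mem_filter.2 ⟨Finset.mem_univ _, (moved_diagonal ν i i').1⟩) h
    rw [Finset.sum_eq_single k, Finset.sum_eq_single ν, hdx, smul_mul_assoc, mul_assoc, ← hg, hd]
    · simp only [mul_smul (v (-∑ j, (C i' j : ℤ)))]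
      rw [← Finset.smul_sum, ← hd]
      by_cases hrow : ∑ j, C i' j = tilde n k.1 i'
      · rw [hc, ← Nat.cast_sum, hrow]
        congr 4
        simp only [k, tilde_add_single]
        rw [if_neg (by intro h; rw [Fin.ext_iff] at h; omega), if_neg, add_zero, add_zero]
        intro h
        apply ne_rev_of_succ hs
        rw [h, Fin.rev_rev]
      · rw [Y_eq_zero_of_row hrow, mul_zero, smul_zero, smul_zero]
    · intro ν' _ hne
      rw [Y_Eth_eq_zero, smul_zero]
      rintro ⟨h1, -⟩
      exact hne (add_right_cancel (h1.trans hν.symm))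
    · intro h
      exact absurd (Finset.Nat.mem_antidiagonalTuple.2 hνr) h
    · intro k' _ hne
      rw [Finset.sum_eq_zero, zero_mul]
      intro ν' _
      rw [Y_Eth_eq_zero, smul_zero]
      rintro ⟨h1, h2⟩
      apply hne
      apply Subtype.ext
      rw [← h2, add_right_cancel (h1.trans hν.symm)]
    · intro h
      exact absurd (Finset.mem_univ _) h
  · rw [Finset.sum_eq_zero, Finset.sum_eq_zero]
    · intro p hp
      rw [Finset.mem_filter] at hp
      rw [Y_eq_zero_of_row (i := i'), smul_zero]
      rw [sum_moved_row hs hp.2, tilde_eq]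
      split_ifs <;> omega
    · intro k _
      rw [Finset.sum_eq_zero, zero_mul]
      intro ν _
      rw [Y_Eth_eq_zero, smul_zero]
      rintro ⟨h1, -⟩
      apply hl
      rw [← h1]
      simp

/-! ### The elements `O(j)` -/

lemma Ajr_zero (r : ℕ) (j : Fin (2 * n + 1) → ℤ) : Ajr n r 0 j =
    ∑ m ∈ Finset.Nat.antidiagonalTuple (n + 1) r,
      (v (dot n (tilde n m) j) * v (-dr n (Matrix.diagonal (tilde n m)))) •
        e n r (Matrix.diagonal (tilde n m)) := by
  unfold Ajr
  have h : size n 0 = 0 := by simp [size]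
  rw [h, if_pos (by omega)]
  simp [br, smul_smul]

lemma Y_diagonal_eq_zero {l k : Comp n r} {m : Fin (n + 1) → ℕ}
    (h : ¬(m = l.1 ∧ m = k.1)) : Y l (Matrix.diagonal (tilde n m)) k = 0 := by
  by_contra hY
  apply h
  constructor
  · apply tilde_injective
    funext a
    by_contra ha
    refine hY (Y_eq_zero_of_row (i := a) ?_)
    simpa [Matrix.diagonal_apply] using ha
  · apply tilde_injective
    funext a
    by_contra ha
    refine hY (Y_eq_zero_of_col (j := a) ?_)
    simpa [Matrix.diagonal_apply] using ha

lemma dr_diagonal (t : Fin (2 * n + 1) → ℕ) : dr n (Matrix.diagonal t) = 0 := by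
  unfold dr
  rw [Finset.sum_eq_zero, Finset.sum_eq_zero]
  · rfl
  · intro i _
    apply Finset.sum_eq_zero
    intro j _
    split_ifs with h
    · rw [Matrix.diagonal_apply_ne _ (by intro h'; rw [Fin.ext_iff] at h'; omega), Nat.cast_zero]
    · rfl
  · intro i _
    refine Finset.sum_eq_zero fun j _ => Finset.sum_eq_zero fun k _ => Finset.sum_eq_zero fun l _ => ?_
    split_ifs with h
    · by_cases hij : i = j
      · rw [Matrix.diagonal_apply_ne _ (i := k), Nat.cast_zero, mul_zero]
        rintro rfl
        exact absurd (lt_of_lt_of_le (hij ▸ h.2) h.1) (lt_irrefl _)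
      · rw [Matrix.diagonal_apply_ne _ hij, Nat.cast_zero, zero_mul]
    · rfl

lemma coord_Ajr_zero (j : Fin (2 * n + 1) → ℤ) (l m : Comp n r) :
    coord n r l (Ajr n r 0 j (xgen n r m)) =
      v (dot n (tilde n m.1) j) • coord n r l (xgen n r m) := by
  classical
  rw [Ajr_zero, coord_sum_smul_e, coord_xgen]
  simp only [dr_diagonal, neg_zero, v_zero, mul_one]
  by_cases h : l = m
  · subst h
    rw [if_pos rfl, Finset.sum_eq_single l.1, Y_diagonal]
    · intro k _ hk
      rw [Y_diagonal_eq_zero (fun h => hk h.1), smul_zero]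
    · intro h
      exact absurd (Finset.Nat.mem_antidiagonalTuple.2 l.2) h
  · rw [if_neg h, smul_zero, Finset.sum_eq_zero]
    intro k _
    rw [Y_diagonal_eq_zero, smul_zero]
    rintro ⟨h1, h2⟩
    exact h (Subtype.ext (h1.symm.trans h2))

lemma Ajr_zero_mul_e (j : Fin (2 * n + 1) → ℤ) (C : Mat n) :
    Ajr n r 0 j * e n r C = v (dot n (ro n C) j) • e n r C := by
  classical
  apply S_ext_coord
  intro l m
  choose g hg using fun l : Comp n r => exists_Y_eq_x_mul l C m
  rw [coord_mul_e _ hg, Finset.sum_eq_single l]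
  · rw [coord_Ajr_zero, coord_xgen, if_pos rfl, LinearMap.smul_apply, coord_smul, coord_e,
      smul_mul_assoc, ← hg]
    by_cases h : ro n C = tilde n l.1
    · rw [h]
    · have : ∃ a, ∑ j, C a j ≠ tilde n l.1 a := by
        by_contra! h'
        exact h (funext h')
      obtain ⟨a, ha⟩ := this
      rw [Y_eq_zero_of_row ha, smul_zero, smul_zero]
  · intro k _ hk
    rw [coord_Ajr_zero, coord_xgen, if_neg (Ne.symm hk), smul_zero, zero_mul]
  · intro h
    exact absurd (Finset.mem_univ _) h

lemma Ajr_zero_xgen (j : Fin (2 * n + 1) → ℤ) (m : Comp n r) :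
    Ajr n r 0 j (xgen n r m) = v (dot n (tilde n m.1) j) • xgen n r m :=
  TMod_ext fun l => by rw [coord_Ajr_zero, coord_smul]

lemma smul_eq_op_smul (c : Z) (y : TMod n r) :
    c • y = MulOpposite.op (algebraMap Z (Hecke r) c) • y := by
  have h : MulOpposite.op (algebraMap Z (Hecke r) c) = c • (1 : (Hecke r)ᵐᵒᵖ) := by
    rw [Algebra.smul_def, mul_one]; rfl
  rw [h, smul_assoc, one_smul]

lemma S_map_smul (φ : S n r) (c : Z) (y : TMod n r) : φ (c • y) = c • φ y := by
  rw [smul_eq_op_smul, map_smul, ← smul_eq_op_smul]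

lemma e_mul_Ajr_zero (j : Fin (2 * n + 1) → ℤ) (C : Mat n) :
    e n r C * Ajr n r 0 j = v (dot n (co n C) j) • e n r C := by
  apply S_ext_coord
  intro l m
  rw [Module.End.mul_apply, Ajr_zero_xgen, S_map_smul, LinearMap.smul_apply, coord_smul, coord_smul,
    coord_e]
  by_cases h : co n C = tilde n m.1
  · rw [h]
  · have : ∃ a, ∑ i, C i a ≠ tilde n m.1 a := by
      by_contra! h'
      exact h (funext h')
    obtain ⟨a, ha⟩ := this
    rw [Y_eq_zero_of_col ha, smul_zero, smul_zero]

lemma dot_add (a b : Fin (2 * n + 1) → ℕ) (j : Fin (2 * n + 1) → ℤ) :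
    dot n (a + b) j = dot n a j + dot n b j := by
  simp only [dot, Pi.add_apply, Nat.cast_add, add_mul, Finset.sum_add_distrib]

lemma dot_add_right (a : Fin (2 * n + 1) → ℕ) (j j' : Fin (2 * n + 1) → ℤ) :
    dot n a (j + j') = dot n a j + dot n a j' := by
  simp only [dot, Pi.add_apply, mul_add, Finset.sum_add_distrib]

lemma ro_add_diagonal (A : Mat n) (t : Fin (2 * n + 1) → ℕ) :
    ro n (A + Matrix.diagonal t) = ro n A + t := by
  funext i
  simp [ro, Finset.sum_add_distrib, Matrix.diagonal_apply]

lemma co_add_diagonal (A : Mat n) (t : Fin (2 * n + 1) → ℕ) :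
    co n (A + Matrix.diagonal t) = co n A + t := by
  funext i
  simp [co, Finset.sum_add_distrib, Matrix.diagonal_apply]

theorem Ajr_zero_mul_Ajr (A : Mat n) (j j' : Fin (2 * n + 1) → ℤ) :
    Ajr n r 0 j * Ajr n r A j' = v (dot n (ro n A) j) • Ajr n r A (j + j') := by
  by_cases hA : size n A ≤ 2 * r
  · rw [Ajr.eq_1 n r A, Ajr.eq_1 n r A, if_pos hA, if_pos hA, Finset.mul_sum, Finset.smul_sum]
    apply Finset.sum_congr rfl
    intro l _
    rw [br, mul_smul_comm, mul_smul_comm, Ajr_zero_mul_e, smul_smul, smul_smul, smul_smul,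
      smul_smul, ← v_add, ← v_add, ← v_add, ← v_add, ro_add_diagonal, dot_add, dot_add_right]
    congr 2
    ring
  · rw [Ajr_of_lt (A := A) (by omega), Ajr_of_lt (A := A) (by omega), mul_zero, smul_zero]

theorem Ajr_mul_Ajr_zero (A : Mat n) (j j' : Fin (2 * n + 1) → ℤ) :
    Ajr n r A j' * Ajr n r 0 j = v (dot n (co n A) j) • Ajr n r A (j + j') := by
  by_cases hA : size n A ≤ 2 * r
  · rw [Ajr.eq_1 n r A, Ajr.eq_1 n r A, if_pos hA, if_pos hA, Finset.sum_mul, Finset.smul_sum]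
    apply Finset.sum_congr rfl
    intro l _
    rw [br, smul_mul_assoc, smul_mul_assoc, e_mul_Ajr_zero, smul_smul, smul_smul, smul_smul,
      smul_smul, ← v_add, ← v_add, ← v_add, ← v_add, co_add_diagonal, dot_add, dot_add_right]
    congr 2
    ring
  · rw [Ajr_of_lt (A := A) (by omega), Ajr_of_lt (A := A) (by omega), zero_mul, smul_zero]

/-! ### The exponents of the normalised basis elements -/

/-- The bilinear form `∑ a_{ij} x_{kl}`, summed over `i ≥ k` and `j < l`. -/
def form (A X : Matrix (Fin (2 * n + 1)) (Fin (2 * n + 1)) ℤ) : ℤ :=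
  ∑ i, ∑ j, ∑ k, ∑ l, if k ≤ i ∧ j < l then A i j * X k l else 0

lemma form_add_left (A B X : Matrix (Fin (2 * n + 1)) (Fin (2 * n + 1)) ℤ) :
    form (A + B) X = form A X + form B X := by
  simp only [form, ← Finset.sum_add_distrib]
  refine Finset.sum_congr rfl fun i _ => Finset.sum_congr rfl fun j _ => Finset.sum_congr rfl
    fun k _ => Finset.sum_congr rfl fun l _ => ?_
  split_ifs
  · rw [Matrix.add_apply, add_mul]
  · rfl

lemma form_add_right (A X Y : Matrix (Fin (2 * n + 1)) (Fin (2 * n + 1)) ℤ) :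
    form A (X + Y) = form A X + form A Y := by
  simp only [form, ← Finset.sum_add_distrib]
  refine Finset.sum_congr rfl fun i _ => Finset.sum_congr rfl fun j _ => Finset.sum_congr rfl
    fun k _ => Finset.sum_congr rfl fun l _ => ?_
  split_ifs
  · rw [Matrix.add_apply, mul_add]
  · rfl

/-- The form is symmetric on matrices that are invariant under the rotation by a half turn. -/
lemma form_comm {A X : Matrix (Fin (2 * n + 1)) (Fin (2 * n + 1)) ℤ}
    (hA : ∀ i j, A i j = A i.rev j.rev) (hX : ∀ i j, X i j = X i.rev j.rev) :
    form A X = form X A := by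
  have hs : ∀ (f : Fin (2 * n + 1) → ℤ), ∑ i, f i = ∑ i, f (Fin.rev i) := fun f =>
    (Fintype.sum_equiv Fin.revPerm _ _ fun _ => rfl).symm
  have h1 : form A X = ∑ i, ∑ j, ∑ k, ∑ l, if i ≤ k ∧ l < j then A i j * X k l else 0 := by
    unfold form
    rw [hs]
    refine Finset.sum_congr rfl fun i _ => ?_
    rw [hs]
    refine Finset.sum_congr rfl fun j _ => ?_
    rw [hs]
    refine Finset.sum_congr rfl fun k _ => ?_
    rw [hs]
    refine Finset.sum_congr rfl fun l _ => ?_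
    simp only [Fin.rev_le_rev, Fin.rev_lt_rev, ← hA, ← hX]
  rw [h1]
  unfold form
  have h2 : ∀ f : Fin (2 * n + 1) → Fin (2 * n + 1) → Fin (2 * n + 1) → Fin (2 * n + 1) → ℤ,
      ∑ i, ∑ j, ∑ k, ∑ l, f i j k l = ∑ k, ∑ l, ∑ i, ∑ j, f i j k l := by
    intro f
    calc ∑ i, ∑ j, ∑ k, ∑ l, f i j k l = ∑ i, ∑ k, ∑ j, ∑ l, f i j k l :=
          Finset.sum_congr rfl fun i _ => Finset.sum_comm
      _ = ∑ k, ∑ i, ∑ j, ∑ l, f i j k l := Finset.sum_comm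
      _ = ∑ k, ∑ i, ∑ l, ∑ j, f i j k l :=
          Finset.sum_congr rfl fun k _ => Finset.sum_congr rfl fun i _ => Finset.sum_comm
      _ = _ := Finset.sum_congr rfl fun k _ => Finset.sum_comm
  rw [h2]
  refine Finset.sum_congr rfl fun i _ => Finset.sum_congr rfl fun j _ => Finset.sum_congr rfl
    fun k _ => Finset.sum_congr rfl fun l _ => ?_
  rw [mul_comm (A k l)]

/-- The linear form `∑ a_{ij}`, summed over the rows from the central one on and the columns before
the central one (the numbering starts from `0`, so that the central index is `n`). -/
def lowerLeft (A : Matrix (Fin (2 * n + 1)) (Fin (2 * n + 1)) ℤ) : ℤ :=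
  ∑ i : Fin (2 * n + 1), ∑ j : Fin (2 * n + 1), if (j : ℕ) < n ∧ n ≤ (i : ℕ) then A i j else 0

lemma lowerLeft_add (A B : Matrix (Fin (2 * n + 1)) (Fin (2 * n + 1)) ℤ) :
    lowerLeft (A + B) = lowerLeft A + lowerLeft B := by
  simp only [lowerLeft, ← Finset.sum_add_distrib]
  refine Finset.sum_congr rfl fun i _ => Finset.sum_congr rfl fun j _ => ?_
  split_ifs
  · rfl
  · rfl

lemma form_single (A : Matrix (Fin (2 * n + 1)) (Fin (2 * n + 1)) ℤ) (a b : Fin (2 * n + 1)) :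
    form A (Matrix.single a b 1) = ∑ i with a ≤ i, ∑ j with j < b, A i j := by
  unfold form
  rw [Finset.sum_filter]
  refine Finset.sum_congr rfl fun i _ => ?_
  have : ∀ j, ∑ k, ∑ l, (if k ≤ i ∧ j < l then A i j * Matrix.single a b 1 k l else 0) =
      if a ≤ i then if j < b then A i j else 0 else 0 := by
    intro j
    rw [Finset.sum_eq_single a, Finset.sum_eq_single b]
    · simp [ite_and]
    · intro l _ hl
      rw [Matrix.single_apply, if_neg (fun h : _ ∧ b = l => hl h.2.symm), mul_zero, ite_self]
    · simp
    · intro k _ hk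
      apply Finset.sum_eq_zero
      intro l _
      rw [Matrix.single_apply, if_neg (fun h : a = k ∧ _ => hk h.1.symm), mul_zero, ite_self]
    · simp
  simp only [this]
  split_ifs
  · rw [Finset.sum_filter]
  · simp

lemma lowerLeft_single (a b : Fin (2 * n + 1)) :
    lowerLeft (Matrix.single a b 1) = if (b : ℕ) < n ∧ n ≤ (a : ℕ) then 1 else 0 := by
  unfold lowerLeft
  rw [Finset.sum_eq_single a, Finset.sum_eq_single b]
  · simp
  · intro l _ hl
    rw [Matrix.single_apply, if_neg (fun h : _ ∧ b = l => hl h.2.symm), ite_self]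
  · simp
  · intro k _ hk
    apply Finset.sum_eq_zero
    intro l _
    rw [Matrix.single_apply, if_neg (fun h : a = k ∧ _ => hk h.1.symm), ite_self]
  · simp

/-- The integral version of `Eth`. -/
def EthZ (i j : Fin (2 * n + 1)) : Matrix (Fin (2 * n + 1)) (Fin (2 * n + 1)) ℤ :=
  Matrix.single i j 1 + Matrix.single i.rev j.rev 1

lemma EthZ_rev (i j a b : Fin (2 * n + 1)) : EthZ i j a b = EthZ i j a.rev b.rev := by
  simp only [EthZ, Matrix.add_apply, Matrix.single_apply, Fin.rev_eq_iff, Fin.rev_rev]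
  rw [add_comm]

lemma Eth_map (i j : Fin (2 * n + 1)) : (Eth n i j).map (Nat.cast : ℕ → ℤ) = EthZ i j := by
  ext a b
  rw [Matrix.map_apply, Eth_apply]
  simp [EthZ, Matrix.single_apply]

lemma form_step {i i' : Fin (2 * n + 1)} (hs : (i' : ℕ) = i + 1)
    (A : Matrix (Fin (2 * n + 1)) (Fin (2 * n + 1)) ℤ) (p : Fin (2 * n + 1)) :
    form A (Matrix.single i p 1) = form A (Matrix.single i' p 1) + ∑ j with j < p, A i j := by
  rw [form_single, form_single]
  have : (Finset.univ.filter fun k => i ≤ k) = insert i (Finset.univ.filter fun k => i' ≤ k) := by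
    ext k
    simp only [Finset.mem_filter, Finset.mem_univ, true_and, Finset.mem_insert, Fin.le_def,
      Fin.ext_iff]
    omega
  rw [this, Finset.sum_insert, add_comm]
  simp only [Finset.mem_filter, Finset.mem_univ, true_and, Fin.le_def]
  omega

lemma sum_lt_rev {A : Matrix (Fin (2 * n + 1)) (Fin (2 * n + 1)) ℤ}
    (hA : ∀ i j, A i j = A i.rev j.rev) (i p : Fin (2 * n + 1)) :
    ∑ j with j < p.rev, A i.rev j = ∑ j with p < j, A i j := by
  rw [Finset.sum_filter, Finset.sum_filter]
  refine Fintype.sum_equiv Fin.revPerm _ _ fun j => ?_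
  rw [Fin.revPerm_apply, hA i, Fin.rev_rev, if_congr Fin.lt_rev_iff rfl rfl]

lemma form_EthZ_step {i i' : Fin (2 * n + 1)} (hs : (i' : ℕ) = i + 1)
    {A : Matrix (Fin (2 * n + 1)) (Fin (2 * n + 1)) ℤ}
    (hA : ∀ i j, A i j = A i.rev j.rev) (p : Fin (2 * n + 1)) :
    form A (EthZ i' p) + ∑ j with j < p, A i j = form A (EthZ i p) + ∑ j with p < j, A i' j := by
  unfold EthZ
  have hs' : (i.rev : ℕ) = i'.rev + 1 := by
    have := i'.2
    rw [Fin.val_rev, Fin.val_rev]; omega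
  rw [form_add_right, form_add_right, form_step hs, form_step hs', sum_lt_rev hA]
  ring

/-- The change of the exponent when an entry is moved to the next row. The numerator of `dr` is a
quadratic minus a linear form. The symmetry of the bilinear form makes the change of the numerator
exactly twice the expression below, so that the division by two is harmless. -/
lemma dr_moved {C C' : Mat n} {i i' p : Fin (2 * n + 1)} (hs : (i' : ℕ) = i + 1)
    (hC : C ∈ Xi n) (h : C' + Eth n i p = C + Eth n i' p) :
    dr n C' = dr n C - ∑ j with j < p, (C i j : ℤ) + ∑ j with p < j, (C i' j : ℤ) +
      if i = ctr n ∧ ctr n < p then 1 else 0 := by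
  set c : Matrix (Fin (2 * n + 1)) (Fin (2 * n + 1)) ℤ := C.map Nat.cast with hc
  set c' : Matrix (Fin (2 * n + 1)) (Fin (2 * n + 1)) ℤ := C'.map Nat.cast with hc'
  have hcr : ∀ a b, c a b = c a.rev b.rev := fun a b => by
    rw [hc, Matrix.map_apply, Matrix.map_apply, hC a b]
  have hmap : c' + EthZ i p = c + EthZ i' p := by
    rw [← Eth_map, ← Eth_map, hc, hc']
    have := congrArg (fun X : Mat n => X.map (Nat.cast : ℕ → ℤ)) h
    simpa [Matrix.map_add] using this
  have hd : dr n C = (form c c - lowerLeft c) / 2 := rfl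
  have hd' : dr n C' = (form c' c' - lowerLeft c') / 2 := rfl
  have hl := congrArg lowerLeft hmap
  have hrel : ∀ X, form c' X + form (EthZ i p) X = form c X + form (EthZ i' p) X := fun X => by
    rw [← form_add_left, ← form_add_left, hmap]
  have hrel' : ∀ X, form X c' + form X (EthZ i p) = form X c + form X (EthZ i' p) := fun X => by
    rw [← form_add_right, ← form_add_right, hmap]
  have k1 := hrel c'
  have k2 := hrel' c
  have k3 := hrel' (EthZ i p)
  have k4 := hrel' (EthZ i' p)
  have k5 := form_comm hcr (EthZ_rev i p)
  have k6 := form_comm hcr (EthZ_rev i' p)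
  have k7 := form_EthZ_step hs hcr p
  have k8 := form_EthZ_step hs (EthZ_rev i p) p
  have k9 := form_EthZ_step hs (EthZ_rev i' p) p
  have hp := p.2
  have hi' := i'.2
  -- the sums over the step matrices themselves
  have m1 : ∑ j with j < p, EthZ i p i j = if i = ctr n ∧ ctr n < p then 1 else 0 := by
    simp only [EthZ, Matrix.add_apply, Matrix.single_apply, Finset.sum_add_distrib, ite_and,
      Finset.sum_ite_irrel, Finset.sum_ite_eq, Finset.sum_const_zero, Finset.mem_filter,
      Finset.mem_univ, true_and, lt_self_iff_false, if_false, zero_add]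
    simp only [Fin.ext_iff, Fin.lt_def, Fin.val_rev, ctr]
    split_ifs <;> omega
  have m2 : ∑ j with p < j, EthZ i p i' j = 0 := by
    simp only [EthZ, Matrix.add_apply, Matrix.single_apply, Finset.sum_add_distrib, ite_and,
      Finset.sum_ite_irrel, Finset.sum_ite_eq, Finset.sum_const_zero, Finset.mem_filter,
      Finset.mem_univ, true_and, lt_self_iff_false, if_false, ite_self, zero_add]
    simp only [Fin.ext_iff, Fin.lt_def, Fin.val_rev]
    split_ifs <;> omega
  have m3 : ∑ j with j < p, EthZ i' p i j = 0 := by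
    simp only [EthZ, Matrix.add_apply, Matrix.single_apply, Finset.sum_add_distrib, ite_and,
      Finset.sum_ite_irrel, Finset.sum_ite_eq, Finset.sum_const_zero, Finset.mem_filter,
      Finset.mem_univ, true_and, lt_self_iff_false, if_false, ite_self, zero_add]
    simp only [Fin.ext_iff, Fin.lt_def, Fin.val_rev]
    split_ifs <;> omega
  have m4 : ∑ j with p < j, EthZ i' p i' j = if i' = ctr n ∧ p < ctr n then 1 else 0 := by
    simp only [EthZ, Matrix.add_apply, Matrix.single_apply, Finset.sum_add_distrib, ite_and,
      Finset.sum_ite_irrel, Finset.sum_ite_eq, Finset.sum_const_zero, Finset.mem_filter,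
      Finset.mem_univ, true_and, lt_self_iff_false, if_false, zero_add]
    simp only [Fin.ext_iff, Fin.lt_def, Fin.val_rev, ctr]
    split_ifs <;> omega
  have m5 : lowerLeft (EthZ i' p) + (if i = ctr n ∧ ctr n < p then 1 else 0) =
      lowerLeft (EthZ i p) + if i' = ctr n ∧ p < ctr n then 1 else 0 := by
    unfold EthZ
    rw [lowerLeft_add, lowerLeft_add, lowerLeft_single, lowerLeft_single, lowerLeft_single,
      lowerLeft_single]
    simp only [Fin.ext_iff, Fin.lt_def, Fin.val_rev, ctr]
    split_ifs <;> omega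
  have m6 : ∑ j with j < p, c i j = ∑ j with j < p, (C i j : ℤ) := rfl
  have m7 : ∑ j with p < j, c i' j = ∑ j with p < j, (C i' j : ℤ) := rfl
  rw [lowerLeft_add, lowerLeft_add] at hl
  rw [hd, hd', ← m6, ← m7]
  rw [m1, m2] at k8
  rw [m3, m4] at k9
  have hnum : form c' c' - lowerLeft c' = form c c - lowerLeft c +
      2 * (-∑ j with j < p, c i j + ∑ j with p < j, c i' j +
        if i = ctr n ∧ ctr n < p then 1 else 0) := by
    linarith
  rw [hnum]
  omega

/-- The power of `v` in the coefficient of the summand with index `p` in the product with a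
normalised basis element; for `i < i' ≤ n + 1` (numbered from `1`) it is `β'_p`. -/
def gam (A : Mat n) (i i' p : Fin (2 * n + 1)) : ℤ :=
  ∑ j with j ≤ p, (A i' j : ℤ) - ∑ j with j < p, (A i j : ℤ) + if i = ctr n ∧ ctr n < p then 1 else 0

lemma qint_eq (m : ℕ) : qint (m + 1) = v (2 * (m : ℤ)) * qbar (m + 1) := by
  unfold qbar qint
  rw [map_sum, Finset.mul_sum, ← Finset.sum_range_reflect]
  apply Finset.sum_congr rfl
  intro k hk
  rw [Finset.mem_range] at hk
  unfold v
  rw [LaurentPolynomial.invert_T, ← LaurentPolynomial.T_add]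
  congr 1
  omega

lemma qbar_mul (m : ℕ) : (1 - v (-2)) * qbar m = 1 - v (-2 * (m : ℤ)) := by
  unfold qbar
  induction m with
  | zero => rw [qint_zero]; simp [v_zero]
  | succ m ih =>
    rw [qint_succ, map_add, mul_add, ih]
    unfold v
    rw [LaurentPolynomial.invert_T, sub_mul, one_mul, ← LaurentPolynomial.T_add]
    rw [show -2 + -(2 * (m : ℤ)) = -2 * ((m + 1 : ℕ) : ℤ) by push_cast; ring,
      show -(2 * (m : ℤ)) = -2 * (m : ℤ) by ring]
    ring

lemma sum_split (f : Fin (2 * n + 1) → ℤ) (p : Fin (2 * n + 1)) :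
    ∑ j, f j = ∑ j with j < p, f j + f p + ∑ j with p < j, f j := by
  rw [← Finset.sum_filter_add_sum_filter_not _ (fun j => j < p), add_assoc]
  congr 1
  have : (Finset.univ.filter fun j => ¬j < p) = insert p (Finset.univ.filter fun j => p < j) := by
    ext k
    simp only [Finset.mem_filter, Finset.mem_univ, true_and, Finset.mem_insert, not_lt,
      le_iff_eq_or_lt, eq_comm]
  rw [this, Finset.sum_insert (by simp)]

lemma sum_le_eq (f : Fin (2 * n + 1) → ℤ) (p : Fin (2 * n + 1)) :
    ∑ j with j ≤ p, f j = ∑ j with j < p, f j + f p := by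
  have : (Finset.univ.filter fun j => j ≤ p) = insert p (Finset.univ.filter fun j => j < p) := by
    ext k
    simp only [Finset.mem_filter, Finset.mem_univ, true_and, Finset.mem_insert, le_iff_eq_or_lt]
  rw [this, Finset.sum_insert (by simp), add_comm]

lemma diagonal_mem_Xi (l : Fin (n + 1) → ℕ) : Matrix.diagonal (tilde n l) ∈ Xi n := by
  intro i j
  rw [Matrix.diagonal_apply, Matrix.diagonal_apply, tilde_rev, if_congr Fin.rev_inj rfl rfl]

lemma dr_Eth_add_diagonal {i i' : Fin (2 * n + 1)} (hs : (i' : ℕ) = i + 1) (m : Fin (n + 1) → ℕ) :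
    dr n (Eth n i' i + Matrix.diagonal (tilde n m)) = tilde n m i' := by
  have h := moved_diagonal m i i'
  have h1 := moved_add (i' := i') h.1
  rw [h.2] at h1
  have hne : i' ≠ i := by intro h; rw [Fin.ext_iff] at h; omega
  have hne' : i' ≠ i.rev := by
    intro h
    apply ne_rev_of_succ hs
    rw [h, Fin.rev_rev]
  rw [dr_moved hs (diagonal_mem_Xi _) h1, dr_diagonal, Finset.sum_eq_zero, Finset.sum_eq_single i',
    Matrix.diagonal_apply_eq, tilde_add_single, if_neg hne, if_neg hne', if_neg]
  · push_cast
    ring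
  · rintro ⟨rfl, h⟩
    exact lt_irrefl _ h
  · intro j _ hj
    rw [Matrix.diagonal_apply_ne _ (Ne.symm hj), Nat.cast_zero]
  · intro h
    exact absurd (Finset.mem_filter.2 ⟨Finset.mem_univ _, by rw [Fin.lt_def]; omega⟩) h
  · intro j hj
    rw [Finset.mem_filter] at hj
    rw [Matrix.diagonal_apply_ne _ (Ne.symm (ne_of_lt hj.2)), Nat.cast_zero]

/-- The multiplication formula for the normalised basis elements. -/
theorem Ajr_Eth_mul_br {i i' : Fin (2 * n + 1)} (hs : (i' : ℕ) = i + 1) {C : Mat n}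
    (hC : C ∈ Xi n) :
    Ajr n (r + 1) (Eth n i' i) 0 * br n (r + 1) C = ∑ p with Movable C i p,
      (v (gam C i i' p) * qbar (C i' p + 1)) • br n (r + 1) (moved C i i' p) := by
  rw [Ajr_Eth, br, mul_smul_comm, sum_e_mul_e _ hs (fun m => by rw [dr_Eth_add_diagonal hs]),
    Finset.smul_sum]
  apply Finset.sum_congr rfl
  intro p hp
  rw [Finset.mem_filter] at hp
  rw [br, smul_smul, smul_smul, dr_moved hs hC (moved_add hp.2), qint_eq]
  congr 1
  rw [sum_split _ p, gam, sum_le_eq, mul_right_comm, ← mul_assoc, ← mul_assoc, ← mul_assoc,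
    ← v_add, ← v_add, ← v_add, ← v_add]
  congr 2
  ring

/-! ### Summation over the diagonals -/

lemma dot_single (a : Fin (2 * n + 1) → ℕ) (i : Fin (2 * n + 1)) :
    dot n a (Pi.single i 1) = a i := by
  simp [dot, Pi.single_apply]

lemma dot_sub_right (a : Fin (2 * n + 1) → ℕ) (j j' : Fin (2 * n + 1) → ℤ) :
    dot n a (j - j') = dot n a j - dot n a j' := by
  simp only [dot, Pi.sub_apply, mul_sub, Finset.sum_sub_distrib]

lemma dot_tilde_add_single (l : Fin (n + 1) → ℕ) (i : Fin (2 * n + 1)) (j : Fin (2 * n + 1) → ℤ) :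
    dot n (tilde n (l + Pi.single (fold i) 1)) j = dot n (tilde n l) j + (j i + j i.rev) := by
  simp only [dot, tilde_add_single]
  push_cast
  simp only [add_mul, Finset.sum_add_distrib, ite_mul, one_mul, zero_mul, Finset.sum_ite_eq',
    Finset.mem_univ, if_true]

/-- The size of a symmetric matrix with zero diagonal is even: the only fixed point of the rotation
is the centre. -/
lemma even_size {A : Mat n} (hA : A ∈ Xi0 n) : ∃ t, size n A = 2 * t := by
  have h : ((size n A : ℕ) : ZMod 2) = 0 := by
    unfold size
    push_cast
    rw [← Fintype.sum_prod_type' (f := fun i j : Fin (2 * n + 1) => ((A i j : ℕ) : ZMod 2))]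
    refine Finset.sum_involution
      (fun (x : Fin (2 * n + 1) × Fin (2 * n + 1)) _ => (x.1.rev, x.2.rev)) ?_ ?_ ?_ ?_
    · intro x _
      rw [← hA.1]
      exact CharTwo.add_self_eq_zero _
    · intro x _ hx heq
      apply hx
      have h1 := (rev_eq_self_iff _).1 (congrArg Prod.fst heq)
      have h2 := (rev_eq_self_iff _).1 (congrArg Prod.snd heq)
      rw [h1, h2, hA.2, Nat.cast_zero]
    · intro x _
      exact Finset.mem_univ _
    · intro x _
      simp
  obtain ⟨t, ht⟩ := (ZMod.natCast_eq_zero_iff _ _).1 h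
  exact ⟨t, ht⟩

lemma add_diagonal_mem_Xi {A : Mat n} (hA : A ∈ Xi0 n) (l : Fin (n + 1) → ℕ) :
    A + Matrix.diagonal (tilde n l) ∈ Xi n := fun i j => by
  rw [Matrix.add_apply, Matrix.add_apply, hA.1 i j, diagonal_mem_Xi l i j]

lemma movable_of_ne {A : Mat n} (hA : A ∈ Xi n) {i p : Fin (2 * n + 1)} (hp : p ≠ i)
    (h : 1 ≤ A i p) : Movable A i p := by
  intro a b
  have hne : ¬(i.rev = i ∧ p.rev = p) := by
    rintro ⟨h1, h2⟩
    rw [rev_eq_self_iff] at h1 h2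
    exact hp (h2.trans h1.symm)
  rw [Eth_apply]
  by_cases h1 : i = a ∧ p = b
  · obtain ⟨rfl, rfl⟩ := h1
    rw [if_pos ⟨rfl, rfl⟩, if_neg hne]
    exact h
  · rw [if_neg h1]
    split_ifs with h2
    · obtain ⟨rfl, rfl⟩ := h2
      rw [← hA]
      exact h
    · omega

lemma Movable.add {A : Mat n} {i p : Fin (2 * n + 1)} (h : Movable A i p) (B : Mat n) :
    Movable (A + B) i p := fun a b => (h a b).trans (by rw [Matrix.add_apply]; omega)

lemma movable_iff {A : Mat n} (hA : A ∈ Xi n) {i p : Fin (2 * n + 1)} (hp : p ≠ i)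
    (t : Fin (2 * n + 1) → ℕ) : Movable (A + Matrix.diagonal t) i p ↔ 1 ≤ A i p := by
  constructor
  · intro h
    have h1 := h i p
    rw [Eth_apply, if_pos ⟨rfl, rfl⟩, Matrix.add_apply, Matrix.diagonal_apply_ne _ hp.symm] at h1
    omega
  · intro h
    exact (movable_of_ne hA hp h).add _

lemma movable_diagonal_iff {A : Mat n} (hA : A ∈ Xi0 n) (i : Fin (2 * n + 1))
    (l : Fin (n + 1) → ℕ) :
    Movable (A + Matrix.diagonal (tilde n l)) i i ↔ 1 ≤ l (fold i) := by
  constructor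
  · intro h
    have h1 := h i i
    rw [Eth_apply, if_pos ⟨rfl, rfl⟩, Matrix.add_apply, Matrix.diagonal_apply_eq, hA.2,
      if_congr ((and_self_iff).trans (rev_eq_self_iff i)) rfl rfl, tilde_eq] at h1
    split_ifs at h1 <;> omega
  · intro h
    have hl : l - Pi.single (fold i) 1 + Pi.single (fold i) 1 = l := by
      funext a
      by_cases ha : a = fold i
      · subst ha; simp [h]
      · simp [ha]
    have := (moved_diagonal (l - Pi.single (fold i) 1) i i).1
    rw [hl] at this
    rw [add_comm]
    exact this.add A

lemma moved_add_of_movable {A : Mat n} {i i' p : Fin (2 * n + 1)} (h : Movable A i p) (B : Mat n) :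
    moved (A + B) i i' p = moved A i i' p + B := by
  ext a b
  have := h a b
  simp only [moved, Matrix.add_apply, Matrix.sub_apply]
  omega

lemma moved_add_diagonal_self (A : Mat n) (i i' : Fin (2 * n + 1)) (l : Fin (n + 1) → ℕ) :
    moved (A + Matrix.diagonal (tilde n (l + Pi.single (fold i) 1))) i i' i =
      A + Eth n i' i + Matrix.diagonal (tilde n l) := by
  rw [add_comm, moved_add_of_movable (moved_diagonal l i i').1, (moved_diagonal l i i').2]
  abel

lemma diagonal_tilde_add_single (l : Fin (n + 1) → ℕ) (i : Fin (2 * n + 1)) :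
    Matrix.diagonal (tilde n (l + Pi.single (fold i) 1)) =
      Eth n i i + Matrix.diagonal (tilde n l) := by
  have h := moved_add (i' := i) (moved_diagonal l i i).1
  rw [(moved_diagonal l i i).2] at h
  exact (add_right_cancel h).symm

lemma moved_add_diagonal_next {A : Mat n} (hA : A ∈ Xi n) {i i' : Fin (2 * n + 1)} (hne : i' ≠ i)
    (h : 1 ≤ A i i') (l : Fin (n + 1) → ℕ) :
    moved (A + Matrix.diagonal (tilde n l)) i i' i' =
      A - Eth n i i' + Matrix.diagonal (tilde n (l + Pi.single (fold i') 1)) := by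
  rw [moved_add_of_movable (movable_of_ne hA hne h), diagonal_tilde_add_single, moved, add_assoc]

lemma size_sub_Eth {A : Mat n} {i p : Fin (2 * n + 1)} (h : Movable A i p) :
    size n (A - Eth n i p) + 2 = size n A := by
  have h2 := size_add (A - Eth n i p) (Eth n i p)
  rw [size_Eth] at h2
  rw [← h2]
  congr 1
  ext a b
  have := h a b
  simp only [Matrix.add_apply, Matrix.sub_apply]
  omega

lemma size_moved {A : Mat n} {i i' p : Fin (2 * n + 1)} (h : Movable A i p) :
    size n (moved A i i' p) = size n A := by
  unfold moved
  rw [size_add, size_Eth, size_sub_Eth h]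

lemma gam_add_diagonal {i i' : Fin (2 * n + 1)} (hs : (i' : ℕ) = i + 1) (A : Mat n)
    (t : Fin (2 * n + 1) → ℕ) (p : Fin (2 * n + 1)) :
    gam (A + Matrix.diagonal t) i i' p =
      gam A i i' p + if i' ≤ p then (t i' : ℤ) - t i else 0 := by
  have hd : ∀ a b, ((Matrix.diagonal t a b : ℕ) : ℤ) = if a = b then (t a : ℤ) else 0 := by
    intro a b
    rw [Matrix.diagonal_apply]
    split_ifs <;> simp
  have hip : i < p ↔ i' ≤ p := by rw [Fin.lt_def, Fin.le_def]; omega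
  simp only [gam, Matrix.add_apply, Nat.cast_add, Finset.sum_add_distrib, hd, Finset.sum_ite_eq,
    Finset.mem_filter, Finset.mem_univ, true_and, hip]
  split_ifs <;> ring

/-- `A(j, r)` depends on `j` only through the products with symmetric tuples. -/
lemma Ajr_congr (A : Mat n) {j j' : Fin (2 * n + 1) → ℤ}
    (h : ∀ l, dot n (tilde n l) j = dot n (tilde n l) j') : Ajr n r A j = Ajr n r A j' := by
  unfold Ajr
  simp only [h]

/-- The indicator of the central row. -/
def cen (i : Fin (2 * n + 1)) : ℤ := if i = ctr n then 1 else 0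

/-- In the difference on the left, the summands with `l (fold i') = 0` cancel. -/
lemma sub_Ajr {B : Mat n} (hB : size n B ≤ 2 * r) (i i' : Fin (2 * n + 1))
    (j : Fin (2 * n + 1) → ℤ) :
    v (-cen i') • Ajr n r B (j - Pi.single i 1 + Pi.single i' 1) -
      v (cen i') • Ajr n r B (j - Pi.single i 1 - Pi.single i' 1) =
    ∑ l ∈ Finset.Nat.antidiagonalTuple (n + 1) (r - size n B / 2) with 1 ≤ l (fold i'),
      (v (-cen i' + (dot n (tilde n l) j - tilde n l i + tilde n l i')) -
        v (cen i' + (dot n (tilde n l) j - tilde n l i - tilde n l i'))) •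
        br n r (B + Matrix.diagonal (tilde n l)) := by
  rw [Ajr, Ajr, if_pos hB, if_pos hB, Finset.smul_sum, Finset.smul_sum, ← Finset.sum_sub_distrib,
    Finset.sum_filter]
  apply Finset.sum_congr rfl
  intro l _
  rw [smul_smul, smul_smul, ← sub_smul, ← v_add, ← v_add, dot_add_right, dot_sub_right,
    dot_sub_right, dot_sub_right, dot_single, dot_single]
  split_ifs with h
  · rfl
  · have h0 : (tilde n l i' : ℤ) = cen i' := by
      rw [tilde_eq, cen]
      have : l (fold i') = 0 := by omega
      rw [this]
      split_ifs <;> simp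
    rw [h0, show -cen i' + (dot n (tilde n l) j - tilde n l i + cen i') =
      cen i' + (dot n (tilde n l) j - tilde n l i - cen i') by ring, sub_self, zero_smul]

/-- The formula for the product of `E^θ_{i',i}(0, r)` and `A(j, r)`, for neighbouring rows `i` and
`i'`. The element `D` is the summand that has a denominator over `ℚ(v)`. -/
def StepFormula (r : ℕ) (A : Mat n) (i i' : Fin (2 * n + 1)) (j : Fin (2 * n + 1) → ℤ) : Prop :=
  ∃ D : S n r,
    (1 - v (-2)) • D = (if 1 ≤ A i i' then
      v (gam A i i' i' - j i' - j i'.rev - 1) •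
        (v (-cen i') •
            Ajr n r (A - Eth n i i') (j - Pi.single i 1 + Pi.single i' 1) -
          v (cen i') •
            Ajr n r (A - Eth n i i') (j - Pi.single i 1 - Pi.single i' 1))
      else 0) ∧
    Ajr n r (Eth n i' i) 0 * Ajr n r A j =
      ∑ p with p < i ∧ 1 ≤ A i p,
        (v (gam A i i' p) * qbar (A i' p + 1)) • Ajr n r (moved A i i' p) j +
      (v (gam A i i' i + j i + j i.rev) * qbar (A i' i + 1)) • Ajr n r (A + Eth n i' i) j +
      D +
      ∑ p with i' < p ∧ 1 ≤ A i p,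
        (v (gam A i i' p) * qbar (A i' p + 1)) •
          Ajr n r (moved A i i' p) (j - Pi.single i 1 + Pi.single i' 1)

/-- For `2 r < |A|` both sides are zero. The only elements on the right that may be non-zero are those
in the difference, for `2 r = |A| - 2`; each of these is a single summand, with `λ = 0`, and the two
cancel. -/
lemma stepFormula_of_lt {A : Mat n} (hA : A ∈ Xi0 n) {i i' : Fin (2 * n + 1)}
    (hs : (i' : ℕ) = i + 1) (j : Fin (2 * n + 1) → ℤ) (hr : 2 * r < size n A) :
    StepFormula r A i i' j := by
  have hne : i' ≠ i := by intro h; rw [Fin.ext_iff] at h; omega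
  obtain ⟨t, ht⟩ := even_size hA
  refine ⟨0, ?_, ?_⟩
  · rw [smul_zero]
    by_cases h : 1 ≤ A i i'
    · rw [if_pos h]
      have hsz := size_sub_Eth (movable_of_ne hA.1 hne h)
      by_cases hr' : size n (A - Eth n i i') ≤ 2 * r
      · rw [sub_Ajr hr' i i' j, show r - size n (A - Eth n i i') / 2 = 0 by omega,
          Finset.sum_eq_zero, smul_zero]
        intro l hl
        rw [Finset.mem_filter, Finset.Nat.mem_antidiagonalTuple] at hl
        have := Finset.single_le_sum (f := l) (fun _ _ => Nat.zero_le _) (Finset.mem_univ (fold i'))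
        omega
      · rw [Ajr_of_lt (by omega), Ajr_of_lt (by omega), smul_zero, smul_zero, sub_zero, smul_zero]
    · rw [if_neg h]
  · rw [Ajr_of_lt hr, mul_zero, Finset.sum_eq_zero, Finset.sum_eq_zero,
      Ajr_of_lt (A := A + Eth n i' i) (by rw [size_add]; omega), smul_zero]
    · simp
    · intro p hp
      rw [Finset.mem_filter] at hp
      rw [Ajr_of_lt, smul_zero]
      rwa [size_moved (movable_of_ne hA.1 (fun h => ?_) hp.2.2)]
      rw [h, Fin.lt_def] at hp
      omega
    · intro p hp
      rw [Finset.mem_filter] at hp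
      rw [Ajr_of_lt, smul_zero]
      rwa [size_moved (movable_of_ne hA.1 (ne_of_lt hp.2.1) hp.2.2)]

lemma stepFormula_zero {A : Mat n} (hA : size n A = 0) {i i' : Fin (2 * n + 1)}
    (j : Fin (2 * n + 1) → ℤ) : StepFormula 0 A i i' j := by
  have hA0 : ∀ a b, A a b = 0 := by
    intro a b
    have h1 := Finset.single_le_sum (f := fun a => ∑ b, A a b) (fun _ _ => Nat.zero_le _)
      (Finset.mem_univ a)
    have h2 := Finset.single_le_sum (f := fun b => A a b) (fun _ _ => Nat.zero_le _)
      (Finset.mem_univ b)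
    beta_reduce at h1 h2
    exact Nat.le_zero.1 (h2.trans (h1.trans hA.le))
  refine ⟨0, ?_, ?_⟩
  · rw [hA0, if_neg (by omega), smul_zero]
  · rw [Ajr_of_lt (by rw [size_Eth]; omega), zero_mul,
      Ajr_of_lt (A := A + Eth n i' i) (by rw [size_add, size_Eth]; omega)]
    simp [hA0]

lemma sum_split_step {M : Type*} [AddCommMonoid M] {i i' : Fin (2 * n + 1)}
    (hs : (i' : ℕ) = i + 1) (f : Fin (2 * n + 1) → M) :
    ∑ p, f p = ∑ p with p < i, f p + f i + f i' + ∑ p with i' < p, f p := by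
  have : (Finset.univ : Finset (Fin (2 * n + 1))) =
      (Finset.univ.filter fun p => p < i) ∪ insert i (insert i'
        (Finset.univ.filter fun p => i' < p)) := by
    ext k
    simp only [Finset.mem_filter, Finset.mem_univ, true_and, Finset.mem_insert, Finset.mem_union,
      Fin.ext_iff, Fin.lt_def, true_iff]
    omega
  conv_lhs => rw [this]
  rw [Finset.sum_union, Finset.sum_insert, Finset.sum_insert]
  · simp only [add_assoc]
  · simp
  · simp only [Finset.mem_filter, Finset.mem_univ, true_and, Finset.mem_insert,
      Fin.ext_iff, Fin.lt_def]
    omega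
  · rw [Finset.disjoint_left]
    intro a
    simp only [Finset.mem_filter, Finset.mem_univ, true_and, Finset.mem_insert,
      Fin.ext_iff, Fin.lt_def]
    omega

theorem stepFormula_succ {A : Mat n} (hA : A ∈ Xi0 n) {i i' : Fin (2 * n + 1)}
    (hs : (i' : ℕ) = i + 1) (j : Fin (2 * n + 1) → ℤ) (hr : size n A ≤ 2 * (r + 1)) :
    StepFormula (r + 1) A i i' j := by
  have hne : i' ≠ i := by intro h; rw [Fin.ext_iff] at h; omega
  obtain ⟨t, ht⟩ := even_size hA
  have htr : t ≤ r + 1 := by omega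
  let Λ := Finset.Nat.antidiagonalTuple (n + 1) (r + 1 - t)
  have hAjr : ∀ B : Mat n, size n B = 2 * t → ∀ j, Ajr n (r + 1) B j =
      ∑ l ∈ Λ, v (dot n (tilde n l) j) • br n (r + 1) (B + Matrix.diagonal (tilde n l)) := by
    intro B hB j
    rw [Ajr, hB, if_pos (by omega), Nat.mul_div_cancel_left _ (by omega)]
  -- the contribution of the position `p`
  let F : Fin (2 * n + 1) → S n (r + 1) := fun p =>
    ∑ l ∈ Λ, if Movable (A + Matrix.diagonal (tilde n l)) i p then
      v (dot n (tilde n l) j) • ((v (gam (A + Matrix.diagonal (tilde n l)) i i' p) *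
        qbar ((A + Matrix.diagonal (tilde n l)) i' p + 1)) •
          br n (r + 1) (moved (A + Matrix.diagonal (tilde n l)) i i' p)) else 0
  have hprod : Ajr n (r + 1) (Eth n i' i) 0 * Ajr n (r + 1) A j = ∑ p, F p := by
    rw [hAjr A ht, Finset.mul_sum, Finset.sum_comm]
    apply Finset.sum_congr rfl
    intro l _
    rw [mul_smul_comm, Ajr_Eth_mul_br hs (add_diagonal_mem_Xi hA l), Finset.smul_sum,
      Finset.sum_filter]
  -- the positions away from the diagonal
  have hoff : ∀ p j', p ≠ i → p ≠ i' →
      (∀ l, dot n (tilde n l) j + (if i' ≤ p then (tilde n l i' : ℤ) - tilde n l i else 0) =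
        dot n (tilde n l) j') →
      F p = if 1 ≤ A i p then (v (gam A i i' p) * qbar (A i' p + 1)) •
        Ajr n (r + 1) (moved A i i' p) j' else 0 := by
    intro p j' h1 h2 h3
    simp only [F, movable_iff hA.1 h1]
    split_ifs with h
    · have hmov := movable_of_ne hA.1 h1 h
      rw [hAjr _ ((size_moved hmov).trans ht), Finset.smul_sum]
      apply Finset.sum_congr rfl
      intro l _
      rw [smul_smul, smul_smul, gam_add_diagonal hs, ← h3, moved_add_of_movable hmov,
        Matrix.add_apply, Matrix.diagonal_apply_ne _ (Ne.symm h2), add_zero, v_add, v_add]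
      congr 1
      ring
    · exact Finset.sum_const_zero
  -- the position on the diagonal of row `i`: one part of the composition decreases by one
  have hFi : F i = (v (gam A i i' i + j i + j i.rev) * qbar (A i' i + 1)) •
      Ajr n (r + 1) (A + Eth n i' i) j := by
    simp only [F, movable_diagonal_iff hA]
    rw [← Finset.sum_filter]
    simp only [Λ]
    rcases Nat.eq_zero_or_pos (r + 1 - t) with h0 | h0
    · rw [Ajr_of_lt (by rw [size_add, size_Eth]; omega), smul_zero, h0]
      apply Finset.sum_eq_zero
      intro l hl
      rw [Finset.mem_filter, Finset.Nat.mem_antidiagonalTuple] at hl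
      have := Finset.single_le_sum (f := l) (fun _ _ => Nat.zero_le _) (Finset.mem_univ (fold i))
      omega
    · obtain ⟨u, hu⟩ := Nat.exists_eq_succ_of_ne_zero h0.ne'
      rw [hu, Nat.succ_eq_add_one, sum_antidiagonalTuple_pos, Ajr, size_add, size_Eth, ht,
        if_pos (by omega), show r + 1 - (2 * t + 2) / 2 = u by omega, Finset.smul_sum]
      apply Finset.sum_congr rfl
      intro l _
      rw [moved_add_diagonal_self, gam_add_diagonal hs,
        if_neg (by rw [Fin.le_def]; omega), smul_smul, smul_smul, dot_tilde_add_single,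
        Matrix.add_apply, Matrix.diagonal_apply_ne _ hne]
      simp only [add_zero, v_add]
      congr 1
      ring
  -- the position on the diagonal of row `i'`: one part of the composition increases by one, and the
  -- coefficient depends on this part
  refine ⟨F i', ?_, ?_⟩
  · simp only [F, movable_iff hA.1 hne]
    split_ifs with h
    · have hsz := size_sub_Eth (movable_of_ne hA.1 hne h)
      rw [sub_Ajr (by omega) i i' j,
        show r + 1 - size n (A - Eth n i i') / 2 = (r + 1 - t) + 1 by omega,
        sum_antidiagonalTuple_pos, Finset.smul_sum, Finset.smul_sum]
      apply Finset.sum_congr rfl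
      intro l _
      have hii : i ≠ i'.rev := ne_rev_of_succ hs
      have hcc : ((tilde n l i' + (1 + if i' = i'.rev then 1 else 0) : ℕ) : ℤ) =
          tilde n l i' + 1 + cen i' := by
        rw [if_congr (eq_comm.trans (rev_eq_self_iff i')) rfl rfl, cen]
        split_ifs <;> push_cast <;> ring
      rw [moved_add_diagonal_next hA.1 hne h, smul_smul, smul_smul, smul_smul]
      congr 1
      rw [gam_add_diagonal hs, if_pos le_rfl, Matrix.add_apply, Matrix.diagonal_apply_eq, hA.2,
        zero_add, dot_tilde_add_single, tilde_add_single, tilde_add_single, if_pos rfl,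
        if_neg hne.symm, if_neg hii,
        show ∀ a b c d : Z, a * b * (c * d) = b * c * (a * d) from fun a b c d => by ring,
        qbar_mul, mul_sub, mul_one, mul_sub]
      simp only [← v_add]
      rw [hcc]
      congr 2
      · push_cast
        ring
      · push_cast
        ring
    · rw [Finset.sum_const_zero, smul_zero]
  · rw [hprod, sum_split_step hs, hFi]
    congr 1
    · congr 2
      rw [← Finset.filter_filter, Finset.sum_filter (p := fun p => 1 ≤ A i p)]
      apply Finset.sum_congr rfl
      intro p hp
      rw [Finset.mem_filter, Fin.lt_def] at hp
      refine hoff p j ?_ ?_ fun l => ?_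
      · rintro rfl; omega
      · rintro rfl; omega
      · rw [if_neg (by rw [Fin.le_def]; omega), add_zero]
    · rw [← Finset.filter_filter, Finset.sum_filter (p := fun p => 1 ≤ A i p)]
      apply Finset.sum_congr rfl
      intro p hp
      rw [Finset.mem_filter, Fin.lt_def] at hp
      refine hoff p _ ?_ ?_ fun l => ?_
      · rintro rfl; omega
      · rintro rfl; omega
      · rw [if_pos (by rw [Fin.le_def]; omega), dot_add_right, dot_sub_right, dot_single,
          dot_single]
        ring

theorem stepFormula {A : Mat n} (hA : A ∈ Xi0 n) {i i' : Fin (2 * n + 1)}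
    (hs : (i' : ℕ) = i + 1) (j : Fin (2 * n + 1) → ℤ) (r : ℕ) : StepFormula r A i i' j := by
  by_cases hr : size n A ≤ 2 * r
  · cases r with
    | zero => exact stepFormula_zero (by omega) j
    | succ r => exact stepFormula_succ hA hs j hr
  · exact stepFormula_of_lt hA hs j (by omega)

/-! ### The two families of formulas -/

lemma Eth_rev (i j : Fin (2 * n + 1)) : Eth n i.rev j.rev = Eth n i j := by
  unfold Eth
  rw [Fin.rev_rev, Fin.rev_rev, add_comm]

lemma hi_eq (h : Fin n) : (hi n h : ℕ) = lo n h + 1 := rfl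

lemma lo_rev_eq (h : Fin n) : ((lo n h).rev : ℕ) = (hi n h).rev + 1 := by
  simp only [Fin.val_rev, lo, hi]
  omega

lemma lo_ne_ctr (h : Fin n) : lo n h ≠ ctr n := by
  intro h'
  have := congrArg Fin.val h'
  simp only [lo, ctr] at this
  omega

lemma cen_hi (h : Fin n) : cen (hi n h) = dn n h := by
  simp only [cen, dn, Fin.ext_iff, hi, ctr]

lemma cen_lo_rev (h : Fin n) : cen (lo n h).rev = 0 := by
  rw [cen, if_neg]
  intro h'
  rw [Fin.rev_eq_iff, (rev_eq_self_iff (ctr n)).2 rfl] at h'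
  exact lo_ne_ctr h h'

lemma gam_lo_hi (A : Mat n) (h : Fin n) (p : Fin (2 * n + 1)) :
    gam A (lo n h) (hi n h) p = beta' n p A h := by
  rw [gam, beta', if_neg (fun h' => lo_ne_ctr h h'.1), add_zero]

lemma gam_rev {A : Mat n} (hA : A ∈ Xi n) (h : Fin n) (p : Fin (2 * n + 1)) :
    gam A (hi n h).rev (lo n h).rev p.rev = beta n p A h := by
  unfold gam beta
  congr 1
  · congr 1
    · rw [Finset.sum_filter, Finset.sum_filter]
      refine Fintype.sum_equiv Fin.revPerm _ _ fun j => ?_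
      rw [Fin.revPerm_apply, hA, Fin.rev_rev, if_congr Fin.le_rev_iff rfl rfl]
    · rw [Finset.sum_filter, Finset.sum_filter]
      refine Fintype.sum_equiv Fin.revPerm _ _ fun j => ?_
      rw [Fin.revPerm_apply, hA, Fin.rev_rev, if_congr Fin.lt_rev_iff rfl rfl]
  · have hp := p.2
    have hh := h.2
    simp only [dn, Fin.ext_iff, Fin.lt_def, Fin.val_rev, hi, ctr]
    split_ifs <;> omega

lemma add_alphaMinus (h : Fin n) (j : Fin (2 * n + 1) → ℤ) :
    j + alphaMinus n h = j - Pi.single (lo n h) 1 - Pi.single (hi n h) 1 := by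
  unfold alphaMinus
  abel

/-- The formula for the product with `E^θ_{h+1,h}(0)`. -/
theorem Ajr_lower_mul {A : Mat n} (hA : A ∈ Xi0 n) (h : Fin n) (j : Fin (2 * n + 1) → ℤ) (r : ℕ) :
    ∃ D : S n r,
        (1 - v (-2)) • D =
          (if 1 ≤ A (lo n h) (hi n h) then
            v (beta' n (hi n h) A h - j (hi n h) - j (hi n h).rev - 1) •
              (v (-dn n h) • Ajr n r (A - Eth n (lo n h) (hi n h)) (j - alpha n h) -
                v (dn n h) • Ajr n r (A - Eth n (lo n h) (hi n h)) (j + alphaMinus n h))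
          else 0) ∧
        Ajr n r (Eth n (hi n h) (lo n h)) 0 * Ajr n r A j =
          (∑ p with p < lo n h ∧ 1 ≤ A (lo n h) p,
            (v (beta' n p A h) * qbar (A (hi n h) p + 1)) •
              Ajr n r (A - Eth n (lo n h) p + Eth n (hi n h) p) j) +
          (v (beta' n (lo n h) A h + j (lo n h) + j (lo n h).rev) *
              qbar (A (hi n h) (lo n h) + 1)) •
            Ajr n r (A + Eth n (hi n h) (lo n h)) j +
          D +
          (∑ p with hi n h < p ∧ 1 ≤ A (lo n h) p,
            (v (beta' n p A h) * qbar (A (hi n h) p + 1)) •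
              Ajr n r (A - Eth n (lo n h) p + Eth n (hi n h) p) (j - alpha n h)) := by
  obtain ⟨D, hD1, hD2⟩ := stepFormula hA (hi_eq h) j r
  refine ⟨D, ?_, ?_⟩
  · rw [hD1, cen_hi, gam_lo_hi, alpha, add_alphaMinus, sub_sub_eq_add_sub, add_sub_right_comm]
  · simp only [gam_lo_hi, moved] at hD2
    rw [hD2, alpha, sub_sub_eq_add_sub, add_sub_right_comm]

/-- The formula for the product with `E^θ_{h,h+1}(0)`. Since `E^θ_{h,h+1}` is also
`E^θ_{N+1-h,N-h}`, this is the formula for the rows `N - h` and `N + 1 - h`, with the columns in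
reverse order. -/
theorem Ajr_upper_mul {A : Mat n} (hA : A ∈ Xi0 n) (h : Fin n) (j : Fin (2 * n + 1) → ℤ) (r : ℕ) :
    ∃ D : S n r,
        (1 - v (-2)) • D =
          (if 1 ≤ A (hi n h) (lo n h) then
            v (beta n (lo n h) A h - j (lo n h) - j (lo n h).rev - 1) •
              (Ajr n r (A - Eth n (hi n h) (lo n h)) (j + alpha n h) -
                Ajr n r (A - Eth n (hi n h) (lo n h)) (j + alphaMinus n h))
          else 0) ∧
        Ajr n r (Eth n (lo n h) (hi n h)) 0 * Ajr n r A j =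
          (∑ p with p < lo n h ∧ 1 ≤ A (hi n h) p,
            (v (beta n p A h) * qbar (A (lo n h) p + 1)) •
              Ajr n r (A + Eth n (lo n h) p - Eth n (hi n h) p) (j + alpha n h)) +
          D +
          (v (beta n (hi n h) A h + j (hi n h) + j (hi n h).rev) *
              qbar (A (lo n h) (hi n h) + 1)) •
            Ajr n r (A + Eth n (lo n h) (hi n h)) j +
          (∑ p with hi n h < p ∧ 1 ≤ A (hi n h) p,
            (v (beta n p A h) * qbar (A (lo n h) p + 1)) •
              Ajr n r (A + Eth n (lo n h) p - Eth n (hi n h) p) j) := by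
  obtain ⟨D, hD1, hD2⟩ := stepFormula hA (lo_rev_eq h) j r
  have hA' : ∀ a b, A a.rev b.rev = A a b := fun a b => (hA.1 a b).symm
  have hdot : ∀ (l : Fin (n + 1) → ℕ) (i : Fin (2 * n + 1)),
      dot n (tilde n l) (Pi.single i.rev 1) = dot n (tilde n l) (Pi.single i 1) := fun l i => by
    rw [dot_single, dot_single, tilde_rev]
  have hjp : ∀ B, Ajr n r B (j - Pi.single (hi n h).rev 1 + Pi.single (lo n h).rev 1) =
      Ajr n r B (j + alpha n h) := fun B => Ajr_congr B fun l => by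
    rw [alpha, dot_add_right, dot_sub_right, dot_add_right, dot_sub_right, hdot, hdot]
    ring
  have hjm : ∀ B, Ajr n r B (j - Pi.single (hi n h).rev 1 - Pi.single (lo n h).rev 1) =
      Ajr n r B (j + alphaMinus n h) := fun B => Ajr_congr B fun l => by
    rw [add_alphaMinus, dot_sub_right, dot_sub_right, dot_sub_right, dot_sub_right, hdot, hdot]
    ring
  -- the matrix with a moved entry, where the entry that is taken away lies in another row
  have hmov : ∀ p, p ≠ hi n h → 1 ≤ A (hi n h) p →
      moved A (hi n h).rev (lo n h).rev p.rev = A + Eth n (lo n h) p - Eth n (hi n h) p := by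
    intro p hp h1
    rw [moved, Eth_rev, Eth_rev]
    ext a b
    have := movable_of_ne hA.1 hp h1 a b
    simp only [Matrix.add_apply, Matrix.sub_apply]
    omega
  have hsum : ∀ (P : Fin (2 * n + 1) → Prop) [DecidablePred P] (f : Fin (2 * n + 1) → S n r),
      ∑ p with P p, f p = ∑ p with P (Fin.rev p), f (Fin.rev p) := by
    intro P _ f
    rw [Finset.sum_filter, Finset.sum_filter]
    exact (Fintype.sum_equiv Fin.revPerm _ _ fun _ => rfl).symm
  refine ⟨D, ?_, ?_⟩
  · rw [hD1, hA', gam_rev hA.1, cen_lo_rev, neg_zero, v_zero, one_smul, one_smul, hjp, hjm, Eth_rev,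
      Fin.rev_rev, sub_right_comm (beta n (lo n h) A h)]
  · rw [Eth_rev, hA', gam_rev hA.1, Fin.rev_rev, hsum, hsum (fun p => (lo n h).rev < p ∧ _)] at hD2
    simp only [hA', gam_rev hA.1, Fin.rev_lt_rev, hjp] at hD2
    have e1 : ∀ j' : Fin (2 * n + 1) → ℤ, ∑ p with p < lo n h ∧ 1 ≤ A (hi n h) p,
        (v (beta n p A h) * qbar (A (lo n h) p + 1)) •
          Ajr n r (moved A (hi n h).rev (lo n h).rev p.rev) j' =
        ∑ p with p < lo n h ∧ 1 ≤ A (hi n h) p,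
        (v (beta n p A h) * qbar (A (lo n h) p + 1)) •
          Ajr n r (A + Eth n (lo n h) p - Eth n (hi n h) p) j' := by
      intro j'
      apply Finset.sum_congr rfl
      intro p hp
      rw [Finset.mem_filter] at hp
      rw [hmov p ?_ hp.2.2]
      intro h'
      have := Fin.lt_def.1 hp.2.1
      rw [h', hi_eq] at this
      omega
    have e2 : ∀ j' : Fin (2 * n + 1) → ℤ, ∑ p with hi n h < p ∧ 1 ≤ A (hi n h) p,
        (v (beta n p A h) * qbar (A (lo n h) p + 1)) •
          Ajr n r (moved A (hi n h).rev (lo n h).rev p.rev) j' =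
        ∑ p with hi n h < p ∧ 1 ≤ A (hi n h) p,
        (v (beta n p A h) * qbar (A (lo n h) p + 1)) •
          Ajr n r (A + Eth n (lo n h) p - Eth n (hi n h) p) j' := by
      intro j'
      apply Finset.sum_congr rfl
      intro p hp
      rw [Finset.mem_filter] at hp
      rw [hmov p (ne_of_gt hp.2.1) hp.2.2]
    rw [hD2, e1, e2, add_right_comm (beta n (hi n h) A h)]
    abel

/-! ### Base change to the field of rational functions -/

lemma algebraMap_smul_tmul (c : Z) (a : S n r) :
    algebraMap Z K c • ((1 : K) ⊗ₜ[Z] a) = (1 : K) ⊗ₜ[Z] (c • a) := by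
  rw [algebraMap_smul, TensorProduct.tmul_smul]

lemma one_sub_vK_ne_zero : (1 - vK (-2) : K) ≠ 0 := by
  have h1 : (1 : Z) - v (-2) ≠ 0 := by
    rw [sub_ne_zero, ← v_zero]
    intro h
    have h0 := congrArg (fun f : Z => f.coeff 0) h
    simp [v] at h0
  intro h
  apply h1
  apply IsFractionRing.injective Z K
  rw [map_sub, map_one, map_zero]
  exact h

/-- An equation with the denominator cleared gives one with the denominator over `ℚ(v)`. -/
lemma tmul_eq_div_smul {D X : S n r} {a : ℤ} (h : (1 - v (-2)) • D = v a • X) :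
    (1 : K) ⊗ₜ[Z] D = (vK a / (1 - vK (-2))) • ((1 : K) ⊗ₜ[Z] X) := by
  have h1 : (1 - vK (-2)) • ((1 : K) ⊗ₜ[Z] D) = vK a • ((1 : K) ⊗ₜ[Z] X) := by
    have h2 : (1 - vK (-2) : K) = algebraMap Z K (1 - v (-2)) := by
      rw [map_sub, map_one, vK]
    rw [h2, vK, algebraMap_smul_tmul, h, algebraMap_smul_tmul]
  rw [div_eq_inv_mul, mul_smul, ← h1, smul_smul, inv_mul_cancel₀ one_sub_vK_ne_zero, one_smul]

lemma tmul_eq_zero {D : S n r} (h : (1 - v (-2)) • D = 0) : (1 : K) ⊗ₜ[Z] D = 0 := by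
  rw [tmul_eq_div_smul (X := 0) (a := 0) (by rw [h, smul_zero]), TensorProduct.tmul_zero, smul_zero]

lemma Aj_apply (A : Mat n) (j : Fin (2 * n + 1) → ℤ) (r : ℕ) :
    Aj n A j r = (1 : K) ⊗ₜ[Z] Ajr n r A j := rfl

lemma tmul_mul (a b : S n r) :
    ((1 : K) ⊗ₜ[Z] a) * ((1 : K) ⊗ₜ[Z] b) = (1 : K) ⊗ₜ[Z] (a * b) := by
  rw [Algebra.TensorProduct.tmul_mul_tmul, one_mul]

lemma vK_mul_qbarK (a : ℤ) (m : ℕ) : vK a * qbarK m = algebraMap Z K (v a * qbar m) :=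
  (map_mul _ _ _).symm

end TypeBSchur

end

theorem mainTheorem3 (n : ℕ) :
    -- the endomorphisms `e_A` exist
    (∀ (r : ℕ), ∀ A ∈ Xi n, size n A = 2 * r + 1 → IsStd n r A (e n r A)) ∧
    -- the formulas in the algebra over `ℤ[v, v⁻¹]`, for a fixed `r`
    (∀ (r : ℕ), ∀ A ∈ Xi0 n, size n A ≤ 2 * r →
      (∀ j j' : Fin (2 * n + 1) → ℤ,
        Ajr n r 0 j * Ajr n r A j' = v (dot n (ro n A) j) • Ajr n r A (j + j') ∧
        Ajr n r A j' * Ajr n r 0 j = v (dot n (co n A) j) • Ajr n r A (j + j')) ∧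
      (∀ (h : Fin n) (j : Fin (2 * n + 1) → ℤ), ∃ D : S n r,
        (1 - v (-2)) • D =
          (if 1 ≤ A (hi n h) (lo n h) then
            v (beta n (lo n h) A h - j (lo n h) - j (lo n h).rev - 1) •
              (Ajr n r (A - Eth n (hi n h) (lo n h)) (j + alpha n h) -
                Ajr n r (A - Eth n (hi n h) (lo n h)) (j + alphaMinus n h))
          else 0) ∧
        Ajr n r (Eth n (lo n h) (hi n h)) 0 * Ajr n r A j =
          (∑ p with p < lo n h ∧ 1 ≤ A (hi n h) p,
            (v (beta n p A h) * qbar (A (lo n h) p + 1)) •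
              Ajr n r (A + Eth n (lo n h) p - Eth n (hi n h) p) (j + alpha n h)) +
          D +
          (v (beta n (hi n h) A h + j (hi n h) + j (hi n h).rev) *
              qbar (A (lo n h) (hi n h) + 1)) •
            Ajr n r (A + Eth n (lo n h) (hi n h)) j +
          (∑ p with hi n h < p ∧ 1 ≤ A (hi n h) p,
            (v (beta n p A h) * qbar (A (lo n h) p + 1)) •
              Ajr n r (A + Eth n (lo n h) p - Eth n (hi n h) p) j)) ∧
      (∀ (h : Fin n) (j : Fin (2 * n + 1) → ℤ), ∃ D : S n r,
        (1 - v (-2)) • D =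
          (if 1 ≤ A (lo n h) (hi n h) then
            v (beta' n (hi n h) A h - j (hi n h) - j (hi n h).rev - 1) •
              (v (-dn n h) • Ajr n r (A - Eth n (lo n h) (hi n h)) (j - alpha n h) -
                v (dn n h) • Ajr n r (A - Eth n (lo n h) (hi n h)) (j + alphaMinus n h))
          else 0) ∧
        Ajr n r (Eth n (hi n h) (lo n h)) 0 * Ajr n r A j =
          (∑ p with p < lo n h ∧ 1 ≤ A (lo n h) p,
            (v (beta' n p A h) * qbar (A (hi n h) p + 1)) •
              Ajr n r (A - Eth n (lo n h) p + Eth n (hi n h) p) j) +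
          (v (beta' n (lo n h) A h + j (lo n h) + j (lo n h).rev) *
              qbar (A (hi n h) (lo n h) + 1)) •
            Ajr n r (A + Eth n (hi n h) (lo n h)) j +
          D +
          (∑ p with hi n h < p ∧ 1 ≤ A (lo n h) p,
            (v (beta' n p A h) * qbar (A (hi n h) p + 1)) •
              Ajr n r (A - Eth n (lo n h) p + Eth n (hi n h) p) (j - alpha n h)))) ∧
    -- the formulas in the direct product over all `r` of the algebras over `ℚ(v)`
    (∀ A ∈ Xi0 n,
      (∀ j j' : Fin (2 * n + 1) → ℤ,
        Aj n 0 j * Aj n A j' = vK (dot n (ro n A) j) • Aj n A (j + j') ∧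
        Aj n A j' * Aj n 0 j = vK (dot n (co n A) j) • Aj n A (j + j')) ∧
      (∀ (h : Fin n) (j : Fin (2 * n + 1) → ℤ),
        Aj n (Eth n (lo n h) (hi n h)) 0 * Aj n A j =
          (∑ p with p < lo n h ∧ 1 ≤ A (hi n h) p,
            (vK (beta n p A h) * qbarK (A (lo n h) p + 1)) •
              Aj n (A + Eth n (lo n h) p - Eth n (hi n h) p) (j + alpha n h)) +
          (if 1 ≤ A (hi n h) (lo n h) then
            (vK (beta n (lo n h) A h - j (lo n h) - j (lo n h).rev - 1) / (1 - vK (-2))) •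
              (Aj n (A - Eth n (hi n h) (lo n h)) (j + alpha n h) -
                Aj n (A - Eth n (hi n h) (lo n h)) (j + alphaMinus n h))
          else 0) +
          (vK (beta n (hi n h) A h + j (hi n h) + j (hi n h).rev) *
              qbarK (A (lo n h) (hi n h) + 1)) •
            Aj n (A + Eth n (lo n h) (hi n h)) j +
          (∑ p with hi n h < p ∧ 1 ≤ A (hi n h) p,
            (vK (beta n p A h) * qbarK (A (lo n h) p + 1)) •
              Aj n (A + Eth n (lo n h) p - Eth n (hi n h) p) j)) ∧
      (∀ (h : Fin n) (j : Fin (2 * n + 1) → ℤ),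
        Aj n (Eth n (hi n h) (lo n h)) 0 * Aj n A j =
          (∑ p with p < lo n h ∧ 1 ≤ A (lo n h) p,
            (vK (beta' n p A h) * qbarK (A (hi n h) p + 1)) •
              Aj n (A - Eth n (lo n h) p + Eth n (hi n h) p) j) +
          (vK (beta' n (lo n h) A h + j (lo n h) + j (lo n h).rev) *
              qbarK (A (hi n h) (lo n h) + 1)) •
            Aj n (A + Eth n (hi n h) (lo n h)) j +
          (if 1 ≤ A (lo n h) (hi n h) then
            (vK (beta' n (hi n h) A h - j (hi n h) - j (hi n h).rev - 1) / (1 - vK (-2))) •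
              (vK (-dn n h) • Aj n (A - Eth n (lo n h) (hi n h)) (j - alpha n h) -
                vK (dn n h) • Aj n (A - Eth n (lo n h) (hi n h)) (j + alphaMinus n h))
          else 0) +
          (∑ p with hi n h < p ∧ 1 ≤ A (lo n h) p,
            (vK (beta' n p A h) * qbarK (A (hi n h) p + 1)) •
              Aj n (A - Eth n (lo n h) p + Eth n (hi n h) p) (j - alpha n h)))) := by
  refine ⟨fun r A _ _ m l => by rw [coord_e, sum_cosetOf], fun r A hA _ =>
    ⟨fun j j' => ⟨Ajr_zero_mul_Ajr A j j', Ajr_mul_Ajr_zero A j j'⟩,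
      fun h j => Ajr_upper_mul hA h j r, fun h j => Ajr_lower_mul hA h j r⟩,
    fun A hA => ⟨fun j j' => ⟨?_, ?_⟩, fun h j => ?_, fun h j => ?_⟩⟩
  · funext r
    rw [Pi.mul_apply, Pi.smul_apply, Aj_apply, Aj_apply, Aj_apply, tmul_mul, Ajr_zero_mul_Ajr, vK,
      algebraMap_smul_tmul]
  · funext r
    rw [Pi.mul_apply, Pi.smul_apply, Aj_apply, Aj_apply, Aj_apply, tmul_mul, Ajr_mul_Ajr_zero, vK,
      algebraMap_smul_tmul]
  · funext r
    obtain ⟨D, hD1, hD2⟩ := Ajr_upper_mul hA h j r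
    have hD : (1 : K) ⊗ₜ[Z] D = (if 1 ≤ A (hi n h) (lo n h) then
            (vK (beta n (lo n h) A h - j (lo n h) - j (lo n h).rev - 1) / (1 - vK (-2))) •
              (Aj n (A - Eth n (hi n h) (lo n h)) (j + alpha n h) -
                Aj n (A - Eth n (hi n h) (lo n h)) (j + alphaMinus n h))
          else 0) r := by
      split_ifs at hD1 ⊢ with hc
      · rw [tmul_eq_div_smul hD1, TensorProduct.tmul_sub]
        rfl
      · rw [tmul_eq_zero hD1]
        rfl
    simp only [Pi.mul_apply, Pi.add_apply, Finset.sum_apply, Pi.smul_apply, ← hD]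
    simp only [Aj_apply, tmul_mul, hD2, TensorProduct.tmul_add, TensorProduct.tmul_sum,
      vK_mul_qbarK, algebraMap_smul_tmul]
  · funext r
    obtain ⟨D, hD1, hD2⟩ := Ajr_lower_mul hA h j r
    have hD : (1 : K) ⊗ₜ[Z] D = (if 1 ≤ A (lo n h) (hi n h) then
            (vK (beta' n (hi n h) A h - j (hi n h) - j (hi n h).rev - 1) / (1 - vK (-2))) •
              (vK (-dn n h) • Aj n (A - Eth n (lo n h) (hi n h)) (j - alpha n h) -
                vK (dn n h) • Aj n (A - Eth n (lo n h) (hi n h)) (j + alphaMinus n h))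
          else 0) r := by
      split_ifs at hD1 ⊢ with hc
      · rw [tmul_eq_div_smul hD1, TensorProduct.tmul_sub, ← algebraMap_smul_tmul,
          ← algebraMap_smul_tmul]
        rfl
      · rw [tmul_eq_zero hD1]
        rfl
    simp only [Pi.mul_apply, Pi.add_apply, Finset.sum_apply, Pi.smul_apply, ← hD]
    simp only [Aj_apply, tmul_mul, hD2, TensorProduct.tmul_add, TensorProduct.tmul_sum,
      vK_mul_qbarK, algebraMap_smul_tmul]
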